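/- For $x\in\mathbb R^3$ write $\langle x\rangle=(1+|x|^2)^{1/2}$, and for $s\in\mathbb R$ let $L^{2,s}=L^{2,s}(\mathbb R^3)$ be the space of measurable $f:\mathbb R^3\to\mathbb C$ with $\|f\|_{L^{2,s}}=\|\langle x\rangle^{s}f\|_{L^2}<\infty$. Let $\varepsilon>0$, and let $A:\mathbb R^3\to\mathbb R^3$ and $V:\mathbb R^3\to\mathbb R$ be differentiable functions such that, with constants independent of $x,\xi\in\mathbb R^3$, $$\langle x\rangle|A(x)|+|DA(x)|+|V(x)|\lesssim\langle x\rangle^{-8-\varepsilon},\qquad \sum_{|\alpha|\le 2}|D^\alpha\hat A(\xi)|\lesssim\langle\xi\rangle^{-3-\varepsilon},\qquad |\nabla V(x)|\lesssim\langle x\rangle^{-1-\varepsilon}.$$ Let $L=i(A\cdot\nabla+\nabla\cdot A)+V$, that is, $Lf=i\big(A\cdot\nabla f+\nabla\cdot(Af)\big)+Vf$ in the sense of distributions. For $z\in\mathbb C\setminus[0,\infty)$ let $R_0(z)=(-\Delta-z)^{-1}$, so that $R_0(z)F$ is the solution $u\in L^2(\mathbb R^3)$ of $-\Delta u-zu=F$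 in the sense of distributions; and for $\lambda>0$ let $R_0(\lambda^2+i0)Lf=\lim_{\eta\downarrow0}R_0(\lambda^2+i\eta)Lf$, the limit being taken in the norm of $L^{2,-\sigma}$. Let $4<\sigma<\tfrac{15}{2}+\varepsilon$. Then for every $c>0$ there exist an integer $m\ge1$ and $\lambda_0>0$ such that for every $\lambda>\lambda_0$ this limit exists for all $f\in L^{2,-\sigma}$ and defines a bounded operator $R_0(\lambda^2+i0)L$ on $L^{2,-\sigma}$, and $$\sup_{\lambda>\lambda_0}\big\|(R_0(\lambda^2+i0)L)^m\big\|_{L^{2,-\sigma}\to L^{2,-\sigma}}\le c.$$ -/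

import Mathlib

open MeasureTheory Filter Topology
open scoped SchwartzMap FourierTransform

namespace MagneticSchrodinger

/-- Three-dimensional Euclidean space. -/
abbrev E3 : Type := EuclideanSpace ℝ (Fin 3)

/-- The bracket `⟨x⟩ = (1 + |x|²)^{1/2}`. -/
noncomputable def bracket (x : E3) : ℝ := Real.sqrt (1 + ‖x‖ ^ 2)

/-- The divergence `∑ⱼ ∂ⱼ Aⱼ` of a vector field. -/
noncomputable def divergence (A : E3 → E3) (x : E3) : ℝ :=
  ∑ j : Fin 3, (fderiv ℝ A x (EuclideanSpace.single j 1)) j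

/-- The decay and regularity assumptions on the real-valued potentials `A`, `V`:
`⟨x⟩|A(x)| + |DA(x)| + |V(x)| ≲ ⟨x⟩^{-8-ε}`, `∑_{|α| ≤ 2} |D^α Â(ξ)| ≲ ⟨ξ⟩^{-3-ε}` and
`|∇V(x)| ≲ ⟨x⟩^{-1-ε}`. (Mathlib's Fourier transform has the phase `exp (-2πi x·ξ)`; the
condition on `Â` does not depend on this normalization. The derivatives of order `k` are
measured by the norm of the `k`-th Fréchet derivative.) -/
structure AdmissiblePotentials (ε : ℝ) (A : E3 → E3) (V : E3 → ℝ) : Prop where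
  differentiable_A : Differentiable ℝ A
  differentiable_V : Differentiable ℝ V
  decay : ∃ C : ℝ, ∀ x : E3,
    bracket x * ‖A x‖ + ‖fderiv ℝ A x‖ + |V x| ≤ C * bracket x ^ (-8 - ε)
  fourier_decay : ∃ C : ℝ, ∀ ξ : E3,
    ∑ k ∈ Finset.range 3, ∑ j : Fin 3,
      ‖iteratedFDeriv ℝ k (𝓕 (fun x : E3 => ((A x j : ℝ) : ℂ))) ξ‖ ≤ C * bracket ξ ^ (-3 - ε)
  gradient_decay : ∃ C : ℝ, ∀ x : E3, ‖fderiv ℝ V x‖ ≤ C * bracket x ^ (-1 - ε)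

/-- The weighted measure `⟨x⟩^{2s} dx`. -/
noncomputable def weightedMeasure (s : ℝ) : Measure E3 :=
  volume.withDensity (fun x => ENNReal.ofReal (bracket x ^ (2 * s)))

/-- The weighted space `L^{2,s}(ℝ³)` of complex-valued functions, with norm
`‖f‖ = (∫ |f(x)|² ⟨x⟩^{2s} dx)^{1/2} = ‖⟨x⟩^s f‖₂`. -/
noncomputable abbrev WeightedL2 (s : ℝ) : Type := Lp ℂ 2 (weightedMeasure s)

/-- The distribution `L f = i (A·∇f + ∇·(A f)) + V f`, evaluated at a test function `φ`.
The derivatives fall on the test function: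
`⟨A·∇f, φ⟩ = -∫ f div(φ A) = -∫ f (A·∇φ + φ div A)` and `⟨∇·(A f), φ⟩ = -∫ f A·∇φ`. -/
noncomputable def magneticL (A : E3 → E3) (V : E3 → ℝ) (f : E3 → ℂ) (φ : 𝓢(E3, ℂ)) : ℂ :=
  Complex.I *
      (-(∫ x, f x * (fderiv ℝ φ x (A x) + φ x * (divergence A x : ℂ)))
        + -(∫ x, f x * fderiv ℝ φ x (A x)))
    + ∫ x, (V x : ℂ) * f x * φ x

/-- `u = R₀(z) F = (-Δ - z)⁻¹ F` for a distribution `F` and a complex number `z ∉ [0, ∞)`: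
`u` is the (unique) function in `L²(ℝ³)` with `-Δu - z u = F` in the sense of distributions. -/
def IsFreeResolvent (z : ℂ) (F : 𝓢(E3, ℂ) → ℂ) (u : E3 → ℂ) : Prop :=
  MemLp u 2 volume ∧
    ∀ φ : 𝓢(E3, ℂ), ∫ x, u x * (-(Laplacian.laplacian φ x) - z * φ x) = F φ

/-- `T` is the bounded operator `R₀(l² + i0) L` on `L^{2,s}(ℝ³)`: for every `f` in this space,
`T f` is the limit in `L^{2,s}(ℝ³)` of `R₀(l² + iη) L f` as `η` decreases to `0`. -/
def IsBoundaryResolventL (A : E3 → E3) (V : E3 → ℝ) (s l : ℝ)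
    (T : WeightedL2 s →L[ℂ] WeightedL2 s) : Prop :=
  ∀ f : WeightedL2 s, ∃ u : ℝ → WeightedL2 s,
    (∀ η : ℝ, 0 < η →
      IsFreeResolvent ((l : ℂ) ^ 2 + Complex.I * (η : ℂ)) (magneticL A V f) (u η)) ∧
    Tendsto u (𝓝[>] (0 : ℝ)) (𝓝 (T f))

end MagneticSchrodinger

/-!
# High-energy decay of powers of `R₀(λ² + i0) L`

Write `L f = ∑_a 2i ∂_a (A_a f) + (V - i div A) f`. Multiplication by `⟨x⟩^{-σ}` turns operators on
`L^{2,-σ}` into operators on `L²` (`weightIso`), where `R₀(z) L` becomes the sum of a first-order part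
`magOp`, built from `∂_a R₀(z)`, and of a zeroth-order part, built from `R₀(z)` (`weightedRes`).

The zeroth-order part tends to `0` as `λ → ∞`, uniformly in `Im z > 0`, since between suitable weights
`R₀(z) = O(1/λ)` (`exists_norm_weightedRes_le_small`). The first-order part is bounded, but not small:
between the weights `⟨x⟩⁻¹` the operators `∂_a R₀(z)` are only `O(1)`. Its high powers are small,
because the outgoing resolvent transports a wave packet of frequency `ξ` in the direction of `ξ` only,
and a packet meets the potential `A` only during a bounded time.

This is made quantitative as follows. Frequency space near the sphere `|ξ| = λ/2π` is divided into six
cones around the directions `ω = ±e_a`. For functions localized to such a cone, the norm with weight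
`e^{-N arctan(x·ω)}`, which decreases along the flow, sees a gain of `1/N`:
multiplying `-ΔU - zU = F` by `e^{-2N arctan(x·ω)} ∂_ω U` and integrating by parts gives a bound for
`∇U` (`rellich_identity`, `exists_directional_estimate`), in which the flux term has a good sign because
`∂_ω` is `i` times a positive operator on the cone (`exists_flux_nonneg`). The localizations commute
with `R₀(z)`, and up to `O(1/λ)` with the weights and with the Lipschitz field `⟨x⟩² A`. So in the norm
`locNorm`, which is equivalent to that of `L²` with constants depending on `N` only, the step `magStep`
from one power of `magOp` to the next is a contraction with factor `1/2`, once `N` is large, and then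
`λ` is large depending on `N` (`exists_iterate_magStep_le`). Hence `‖magOp ^ m‖ ≲ 2⁻ᵐ` uniformly in `λ`
and `Im z`; after `m` is chosen, a larger `λ` makes the contribution of the zeroth-order part small.

For the limit on the real axis, the kernel of `R₀(k²)` is identified as a constant times
`e^{ik|x-y|}/|x-y|` (`integral_helm_mul`). It is dominated by `|x-y|⁻¹`, and it depends on `k` in a
Lipschitz way up to the real axis, so that the weighted resolvents converge strongly
(`exists_clm_tendsto_weightedRes`, `exists_clm_tendsto_resGrad`), and all bounds pass to the limit.
-/


open scoped ENNReal

namespace MagneticSchrodinger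

open LineDeriv

/-! ### Integral operators on `L²` -/

/-- The space `L²(ℝ³; ℂ)`. -/
noncomputable abbrev L2 : Type := Lp ℂ 2 (volume : Measure E3)

lemma eLpNorm_two_sq {α : Type*} [MeasurableSpace α] (μ : Measure α) (f : α → ℂ) :
    eLpNorm f 2 μ ^ 2 = ∫⁻ x, ‖f x‖ₑ ^ 2 ∂μ := by
  have := eLpNorm_nnreal_pow_eq_lintegral (f := f) (μ := μ) (p := 2) (by norm_num)
  simpa using this

lemma lintegral_mul_sq_le {α : Type*} [MeasurableSpace α] (μ : Measure α) {f g : α → ℝ≥0∞}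
    (hf : AEMeasurable f μ) (hg : AEMeasurable g μ) :
    (∫⁻ x, f x * g x ∂μ) ^ 2 ≤ (∫⁻ x, f x ^ 2 ∂μ) * ∫⁻ x, g x ^ 2 ∂μ := by
  have h := ENNReal.lintegral_mul_le_Lp_mul_Lq μ Real.HolderConjugate.two_two hf hg
  calc (∫⁻ x, f x * g x ∂μ) ^ 2
      ≤ ((∫⁻ x, f x ^ (2 : ℝ) ∂μ) ^ (1 / (2 : ℝ)) * (∫⁻ x, g x ^ (2 : ℝ) ∂μ) ^ (1 / (2 : ℝ))) ^ 2 := by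
        gcongr
        simpa using h
    _ = _ := by
        rw [mul_pow, ← ENNReal.rpow_natCast, ← ENNReal.rpow_natCast, ← ENNReal.rpow_mul,
          ← ENNReal.rpow_mul]
        norm_num

/-- Young's inequality `L¹ * L² ⊆ L²`, for nonnegative functions. -/
lemma lintegral_conv_sq_le {κ φ : E3 → ℝ≥0∞} (hκ : Measurable κ) (hφ : AEMeasurable φ) :
    ∫⁻ x, (∫⁻ y, κ (x - y) * φ y) ^ 2 ≤ (∫⁻ z, κ z) ^ 2 * ∫⁻ y, φ y ^ 2 := by
  have hm : ∀ x, AEMeasurable (fun y => κ (x - y)) := fun x => by fun_prop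
  have hsq : ∀ x, (∫⁻ y, κ (x - y) * φ y) ^ 2 ≤ (∫⁻ z, κ z) * ∫⁻ y, κ (x - y) * φ y ^ 2 := by
    intro x
    have h1 : (fun y => κ (x - y) * φ y)
        = fun y => κ (x - y) ^ (1 / 2 : ℝ) * (κ (x - y) ^ (1 / 2 : ℝ) * φ y) := by
      ext y
      rw [← mul_assoc, ← ENNReal.rpow_add_of_nonneg _ _ (by norm_num) (by norm_num)]
      norm_num
    have h2 : ∀ a : ℝ≥0∞, (a ^ (1 / 2 : ℝ)) ^ 2 = a := fun a => by
      rw [← ENNReal.rpow_natCast, ← ENNReal.rpow_mul]; norm_num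
    rw [h1]
    refine (lintegral_mul_sq_le _ ((hm x).pow_const _)
      (((hm x).pow_const _).mul hφ)).trans ?_
    simp only [Pi.mul_apply, mul_pow, h2]
    rw [lintegral_sub_left_eq_self κ x]
  have hm2 : AEMeasurable (Function.uncurry fun x y => κ (x - y) * φ y ^ 2)
      ((volume : Measure E3).prod volume) := by
    refine AEMeasurable.mul ?_ ?_
    · exact (hκ.comp (measurable_fst.sub measurable_snd)).aemeasurable
    · exact (hφ.comp_snd).pow_const _
  calc ∫⁻ x, (∫⁻ y, κ (x - y) * φ y) ^ 2
      ≤ ∫⁻ x, (∫⁻ z, κ z) * ∫⁻ y, κ (x - y) * φ y ^ 2 := lintegral_mono hsq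
    _ = (∫⁻ z, κ z) * ∫⁻ x, ∫⁻ y, κ (x - y) * φ y ^ 2 := by
        exact lintegral_const_mul'' _ hm2.lintegral_prod_right'
    _ = (∫⁻ z, κ z) * ∫⁻ y, ∫⁻ x, κ (x - y) * φ y ^ 2 := by
        rw [lintegral_lintegral_swap hm2]
    _ = (∫⁻ z, κ z) * ∫⁻ y, (∫⁻ z, κ z) * φ y ^ 2 := by
        congr 1
        refine lintegral_congr fun y => ?_
        rw [lintegral_mul_const _ (by fun_prop), lintegral_sub_right_eq_self κ y]
    _ = _ := by
        rw [lintegral_const_mul'' _ (hφ.pow_const _), sq, mul_assoc]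

/-- The Hilbert–Schmidt bound, for nonnegative functions. -/
lemma lintegral_hilbertSchmidt_sq_le {k : E3 → E3 → ℝ≥0∞} (hk : Measurable (Function.uncurry k))
    {φ : E3 → ℝ≥0∞} (hφ : AEMeasurable φ) :
    ∫⁻ x, (∫⁻ y, k x y * φ y) ^ 2 ≤ (∫⁻ x, ∫⁻ y, k x y ^ 2) * ∫⁻ y, φ y ^ 2 := by
  calc ∫⁻ x, (∫⁻ y, k x y * φ y) ^ 2
      ≤ ∫⁻ x, (∫⁻ y, k x y ^ 2) * ∫⁻ y, φ y ^ 2 :=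
        lintegral_mono fun x => lintegral_mul_sq_le _ (hk.of_uncurry_left).aemeasurable hφ
    _ = _ := lintegral_mul_const _ (Measurable.lintegral_prod_right' (hk.pow_const 2))

lemma L2.norm_le_of_lintegral_sq_le {f g : L2} {C : ℝ} (hC : 0 ≤ C)
    (h : ∫⁻ x, ‖f x‖ₑ ^ 2 ≤ ENNReal.ofReal C ^ 2 * ∫⁻ x, ‖g x‖ₑ ^ 2) : ‖f‖ ≤ C * ‖g‖ := by
  rw [← eLpNorm_two_sq, ← eLpNorm_two_sq, ← mul_pow] at h
  have h2 : eLpNorm f 2 volume ≤ ENNReal.ofReal C * eLpNorm g 2 volume :=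
    le_of_not_gt fun hlt => (not_lt.2 h) (ENNReal.pow_lt_pow_left two_ne_zero hlt)
  rw [Lp.norm_def, Lp.norm_def]
  calc _ ≤ (ENNReal.ofReal C * eLpNorm g 2 volume).toReal :=
        ENNReal.toReal_mono (ENNReal.mul_ne_top ENNReal.ofReal_ne_top (Lp.eLpNorm_ne_top g)) h2
    _ = _ := by rw [ENNReal.toReal_mul, ENNReal.toReal_ofReal hC]

lemma L2.lintegral_sq_ne_top (f : L2) : ∫⁻ x, ‖f x‖ₑ ^ 2 ≠ ∞ := by
  rw [← eLpNorm_two_sq]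
  exact ENNReal.pow_ne_top (Lp.eLpNorm_ne_top f)

lemma L2.aemeasurable_enorm (f : L2) : AEMeasurable (fun x => ‖f x‖ₑ) volume :=
  (Lp.aestronglyMeasurable f).enorm

lemma memLp_two_of_lintegral_sq_ne_top {f : E3 → ℂ} (hf : AEStronglyMeasurable f volume)
    (h : ∫⁻ x, ‖f x‖ₑ ^ 2 ≠ ∞) : MemLp f 2 volume := by
  refine ⟨hf, ?_⟩
  rw [← eLpNorm_two_sq] at h
  by_contra hc
  rw [not_lt_top_iff] at hc
  simp [hc] at h

/-- `k` is a measurable kernel dominated by the translation invariant kernel `κ (x - y)`, with `κ`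
integrable. -/
structure KerBound (k : E3 → E3 → ℂ) (κ : E3 → ℝ≥0∞) : Prop where
  meas : Measurable (Function.uncurry k)
  measBound : Measurable κ
  integral_ne_top : ∫⁻ z, κ z ≠ ∞
  le : ∀ x y, ‖k x y‖ₑ ≤ κ (x - y)

namespace KerBound

variable {k : E3 → E3 → ℂ} {κ : E3 → ℝ≥0∞}

lemma lintegral_sq_ne_top (h : KerBound k κ) (f : L2) :
    ∫⁻ x, (∫⁻ y, κ (x - y) * ‖f y‖ₑ) ^ 2 ≠ ∞ :=
  ne_top_of_le_ne_top (ENNReal.mul_ne_top (ENNReal.pow_ne_top h.integral_ne_top)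
    f.lintegral_sq_ne_top) (lintegral_conv_sq_le h.measBound f.aemeasurable_enorm)

lemma aemeasurable_majorant (h : KerBound k κ) (f : L2) :
    AEMeasurable (fun x => ∫⁻ y, κ (x - y) * ‖f y‖ₑ) := by
  refine AEMeasurable.lintegral_prod_right' (f := fun p : E3 × E3 => κ (p.1 - p.2) * ‖f p.2‖ₑ) ?_
  refine AEMeasurable.mul ?_ ?_
  · exact (h.measBound.comp (measurable_fst.sub measurable_snd)).aemeasurable
  · exact f.aemeasurable_enorm.comp_snd

lemma ae_integrable (h : KerBound k κ) (f : L2) :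
    ∀ᵐ x, Integrable (fun y => k x y * f y) := by
  have h1 := ae_lt_top' ((h.aemeasurable_majorant f).pow_const 2) (h.lintegral_sq_ne_top f)
  filter_upwards [h1] with x hx
  refine ⟨(h.meas.of_uncurry_left).aestronglyMeasurable.mul (Lp.aestronglyMeasurable f), ?_⟩
  have h2 : ∫⁻ y, κ (x - y) * ‖f y‖ₑ < ∞ := by
    by_contra hc
    rw [not_lt_top_iff] at hc
    simp [hc] at hx
  refine lt_of_le_of_lt (lintegral_mono fun y => ?_) h2
  rw [enorm_mul]
  gcongr
  exact h.le x y

lemma enorm_integral_le (h : KerBound k κ) (f : L2) (x : E3) :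
    ‖∫ y, k x y * f y‖ₑ ≤ ∫⁻ y, κ (x - y) * ‖f y‖ₑ := by
  refine (enorm_integral_le_lintegral_enorm _).trans (lintegral_mono fun y => ?_)
  rw [enorm_mul]
  gcongr
  exact h.le x y

lemma aestronglyMeasurable (h : KerBound k κ) (f : L2) :
    AEStronglyMeasurable (fun x => ∫ y, k x y * f y) volume := by
  refine AEStronglyMeasurable.integral_prod_right' (f := fun p : E3 × E3 => k p.1 p.2 * f p.2) ?_
  exact h.meas.aestronglyMeasurable.mul (Lp.aestronglyMeasurable f).comp_snd

lemma memLp (h : KerBound k κ) (f : L2) : MemLp (fun x => ∫ y, k x y * f y) 2 volume := by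
  refine memLp_two_of_lintegral_sq_ne_top (h.aestronglyMeasurable f)
    (ne_top_of_le_ne_top (h.lintegral_sq_ne_top f) (lintegral_mono fun x => ?_))
  gcongr
  exact h.enorm_integral_le f x

lemma norm_le (h : KerBound k κ) (f : L2) {g : L2} (hg : g =ᵐ[volume] fun x => ∫ y, k x y * f y) :
    ‖g‖ ≤ (∫⁻ z, κ z).toReal * ‖f‖ := by
  refine L2.norm_le_of_lintegral_sq_le ENNReal.toReal_nonneg ?_
  rw [ENNReal.ofReal_toReal h.integral_ne_top]
  refine le_trans (lintegral_mono_ae ?_)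
    (lintegral_conv_sq_le h.measBound f.aemeasurable_enorm)
  filter_upwards [hg] with x hx
  rw [hx]
  gcongr
  exact h.enorm_integral_le f x

/-- The bounded operator on `L²` with a kernel as in `KerBound`. -/
noncomputable def toCLM (h : KerBound k κ) : L2 →L[ℂ] L2 :=
  LinearMap.mkContinuous
    { toFun := fun f => (h.memLp f).toLp
      map_add' := fun f g => by
        rw [← MemLp.toLp_add]
        refine MemLp.toLp_congr _ _ ?_
        filter_upwards [h.ae_integrable f, h.ae_integrable g] with x hf hg
        rw [Pi.add_apply, ← integral_add hf hg]
        refine integral_congr_ae ?_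
        filter_upwards [Lp.coeFn_add f g] with y hy
        rw [hy, Pi.add_apply, mul_add]
      map_smul' := fun c f => by
        rw [RingHom.id_apply, ← MemLp.toLp_const_smul]
        refine MemLp.toLp_congr _ _ (Eventually.of_forall fun x => ?_)
        rw [Pi.smul_apply, ← integral_smul]
        refine integral_congr_ae ?_
        filter_upwards [Lp.coeFn_smul c f] with y hy
        rw [hy, Pi.smul_apply, smul_eq_mul, smul_eq_mul]
        ring }
    (∫⁻ z, κ z).toReal fun f => h.norm_le f (MemLp.coeFn_toLp (h.memLp f))

end KerBound

open Classical in
/-- The integral operator on `L²` with kernel `k`, for a kernel dominated by an integrable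
translation invariant one; it is `0` for any other kernel. -/
noncomputable def kerOp (k : E3 → E3 → ℂ) : L2 →L[ℂ] L2 :=
  if h : ∃ κ, KerBound k κ then h.choose_spec.toCLM else 0

lemma KerBound.kerOp_ae {k : E3 → E3 → ℂ} {κ : E3 → ℝ≥0∞} (h : KerBound k κ) (f : L2) :
    kerOp k f =ᵐ[volume] fun x => ∫ y, k x y * f y := by
  have h' : ∃ κ, KerBound k κ := ⟨κ, h⟩
  rw [kerOp, dif_pos h']
  exact MemLp.coeFn_toLp (h'.choose_spec.memLp f)

lemma KerBound.norm_kerOp_le {k : E3 → E3 → ℂ} {κ : E3 → ℝ≥0∞} (h : KerBound k κ) :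
    ‖kerOp k‖ ≤ (∫⁻ z, κ z).toReal :=
  ContinuousLinearMap.opNorm_le_bound _ ENNReal.toReal_nonneg fun f => h.norm_le f (h.kerOp_ae f)

/-- A bounded measurable function. -/
structure BddMeas (g : E3 → ℂ) : Prop where
  meas : Measurable g
  bdd : ∃ C, ∀ x, ‖g x‖ ≤ C

namespace BddMeas

variable {g g₁ g₂ : E3 → ℂ}

lemma memLp (h : BddMeas g) (f : L2) : MemLp (fun x => g x * f x) 2 volume := by
  obtain ⟨C, hC⟩ := h.bdd
  refine (Lp.memLp f).of_le_mul (c := C)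
    (h.meas.aestronglyMeasurable.mul (Lp.aestronglyMeasurable f)) (Eventually.of_forall fun x => ?_)
  rw [norm_mul]
  gcongr
  exact hC x

lemma norm_le {C : ℝ} (hC : ∀ x, ‖g x‖ ≤ C) (f : L2) {f' : L2}
    (hf : f' =ᵐ[volume] fun x => g x * f x) : ‖f'‖ ≤ C * ‖f‖ := by
  refine Lp.norm_le_mul_norm_of_ae_le_mul ?_
  filter_upwards [hf] with x hx
  rw [hx, norm_mul]
  gcongr
  exact hC x

/-- Multiplication by a bounded measurable function, as an operator on `L²`. -/
noncomputable def toCLM (h : BddMeas g) : L2 →L[ℂ] L2 :=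
  LinearMap.mkContinuous
    { toFun := fun f => (h.memLp f).toLp
      map_add' := fun f f' => by
        rw [← MemLp.toLp_add]
        refine MemLp.toLp_congr _ _ ?_
        filter_upwards [Lp.coeFn_add f f'] with y hy
        rw [hy, Pi.add_apply, Pi.add_apply, mul_add]
      map_smul' := fun c f => by
        rw [RingHom.id_apply, ← MemLp.toLp_const_smul]
        refine MemLp.toLp_congr _ _ ?_
        filter_upwards [Lp.coeFn_smul c f] with y hy
        rw [hy, Pi.smul_apply, Pi.smul_apply, smul_eq_mul, smul_eq_mul]
        ring }
    h.bdd.choose fun f => norm_le h.bdd.choose_spec f (MemLp.coeFn_toLp (h.memLp f))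

lemma mul (h₁ : BddMeas g₁) (h₂ : BddMeas g₂) : BddMeas (fun x => g₁ x * g₂ x) := by
  obtain ⟨C₁, hC₁⟩ := h₁.bdd
  obtain ⟨C₂, hC₂⟩ := h₂.bdd
  refine ⟨h₁.meas.mul h₂.meas, C₁ * C₂, fun x => ?_⟩
  rw [norm_mul]
  exact mul_le_mul (hC₁ x) (hC₂ x) (norm_nonneg _) ((norm_nonneg _).trans (hC₁ x))

lemma const (c : ℂ) : BddMeas (fun _ => c) := ⟨measurable_const, ‖c‖, fun _ => le_rfl⟩

lemma add (h₁ : BddMeas g₁) (h₂ : BddMeas g₂) : BddMeas (fun x => g₁ x + g₂ x) := by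
  obtain ⟨C₁, hC₁⟩ := h₁.bdd
  obtain ⟨C₂, hC₂⟩ := h₂.bdd
  exact ⟨h₁.meas.add h₂.meas, C₁ + C₂, fun x => (norm_add_le _ _).trans (add_le_add (hC₁ x) (hC₂ x))⟩

end BddMeas

open Classical in
/-- Multiplication by `g` on `L²`; it is `0` unless `g` is bounded and measurable. -/
noncomputable def mulOp (g : E3 → ℂ) : L2 →L[ℂ] L2 := if h : BddMeas g then h.toCLM else 0

lemma mulOp_ae {g : E3 → ℂ} (h : BddMeas g) (f : L2) :
    mulOp g f =ᵐ[volume] fun x => g x * f x := by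
  rw [mulOp, dif_pos h]
  exact MemLp.coeFn_toLp (h.memLp f)

lemma norm_mulOp_apply_le {g : E3 → ℂ} (h : BddMeas g) {C : ℝ} (hC : ∀ x, ‖g x‖ ≤ C) (f : L2) :
    ‖mulOp g f‖ ≤ C * ‖f‖ :=
  BddMeas.norm_le hC f (mulOp_ae h f)

lemma mulOp_mulOp {g₁ g₂ : E3 → ℂ} (h₁ : BddMeas g₁) (h₂ : BddMeas g₂) (f : L2) :
    mulOp g₁ (mulOp g₂ f) = mulOp (fun x => g₁ x * g₂ x) f := by
  refine Lp.ext ?_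
  filter_upwards [mulOp_ae h₁ (mulOp g₂ f), mulOp_ae h₂ f, mulOp_ae (h₁.mul h₂) f] with x h1 h2 h3
  rw [h1, h2, h3, mul_assoc]

lemma mulOp_comm {g₁ g₂ : E3 → ℂ} (h₁ : BddMeas g₁) (h₂ : BddMeas g₂) (f : L2) :
    mulOp g₁ (mulOp g₂ f) = mulOp g₂ (mulOp g₁ f) := by
  rw [mulOp_mulOp h₁ h₂, mulOp_mulOp h₂ h₁]
  simp_rw [mul_comm]

lemma mulOp_const (c : ℂ) (f : L2) : mulOp (fun _ => c) f = c • f := by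
  refine Lp.ext ?_
  filter_upwards [mulOp_ae (.const c) f, Lp.coeFn_smul c f] with x h1 h2
  rw [h1, h2, Pi.smul_apply, smul_eq_mul]

lemma mulOp_add {g₁ g₂ : E3 → ℂ} (h₁ : BddMeas g₁) (h₂ : BddMeas g₂) (f : L2) :
    mulOp (fun x => g₁ x + g₂ x) f = mulOp g₁ f + mulOp g₂ f := by
  refine Lp.ext ?_
  filter_upwards [mulOp_ae h₁ f, mulOp_ae h₂ f, mulOp_ae (h₁.add h₂) f,
    Lp.coeFn_add (mulOp g₁ f) (mulOp g₂ f)] with x h1 h2 h3 h4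
  rw [h3, h4, Pi.add_apply, h1, h2, add_mul]

lemma mulOp_smul {g : E3 → ℂ} (h : BddMeas g) (c : ℂ) (f : L2) :
    mulOp (fun x => c * g x) f = c • mulOp g f := by
  rw [← mulOp_mulOp (.const c) h, mulOp_const]

lemma mulOp_sum {ι : Type*} {g : ι → E3 → ℂ} (s : Finset ι) (h : ∀ i ∈ s, BddMeas (g i)) (f : L2) :
    BddMeas (fun x => ∑ i ∈ s, g i x) ∧
      mulOp (fun x => ∑ i ∈ s, g i x) f = ∑ i ∈ s, mulOp (g i) f := by
  classical
  induction s using Finset.induction_on with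
  | empty => exact ⟨by simpa using BddMeas.const 0, by simpa using mulOp_const 0 f⟩
  | insert a s ha ih =>
    obtain ⟨h1, h2⟩ := ih fun i hi => h i (Finset.mem_insert_of_mem hi)
    have h3 := h a (Finset.mem_insert_self _ _)
    simp only [Finset.sum_insert ha]
    exact ⟨h3.add h1, by rw [mulOp_add h3 h1, h2]⟩

lemma inner_mulOp_left {g : E3 → ℂ} (h : BddMeas g) (f₁ f₂ : L2) :
    inner ℂ (mulOp g f₁) f₂ = inner ℂ f₁ (mulOp (fun x => star (g x)) f₂) := by
  have h' : BddMeas (fun x => star (g x)) := by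
    obtain ⟨C, hC⟩ := h.bdd
    exact ⟨continuous_star.measurable.comp h.meas, C, fun x => by simpa using hC x⟩
  rw [L2.inner_def, L2.inner_def]
  refine integral_congr_ae ?_
  filter_upwards [mulOp_ae h f₁, mulOp_ae h' f₂] with x h1 h2
  rw [h1, h2]
  simp [mul_comm, mul_left_comm, mul_assoc]

/-- Compositions of an integral operator with multiplications are integral operators. -/
lemma KerBound.mulOp_comp {k k' : E3 → E3 → ℂ} {κ κ' : E3 → ℝ≥0∞} (h : KerBound k κ)
    (h' : KerBound k' κ') {a b : E3 → ℂ} (ha : BddMeas a) (hb : BddMeas b)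
    (heq : ∀ x y, a x * k x y = k' x y * b y) (f : L2) :
    mulOp a (kerOp k f) = kerOp k' (mulOp b f) := by
  refine Lp.ext ?_
  filter_upwards [mulOp_ae ha (kerOp k f), h.kerOp_ae f, h'.kerOp_ae (mulOp b f)] with x h1 h2 h3
  rw [h1, h2, h3, ← integral_const_mul]
  refine integral_congr_ae ?_
  filter_upwards [mulOp_ae hb f] with y hy
  rw [hy, ← mul_assoc, heq, mul_assoc]

/-- The commutator type identity `k₁ b - a k₂ = k₃` for integral operators. -/
lemma KerBound.commutator {k₁ k₂ k₃ : E3 → E3 → ℂ} {κ₁ κ₂ κ₃ : E3 → ℝ≥0∞} (h₁ : KerBound k₁ κ₁)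
    (h₂ : KerBound k₂ κ₂) (h₃ : KerBound k₃ κ₃) {a b : E3 → ℂ} (ha : BddMeas a) (hb : BddMeas b)
    (heq : ∀ x y, k₁ x y * b y - a x * k₂ x y = k₃ x y) (f : L2) :
    kerOp k₁ (mulOp b f) - mulOp a (kerOp k₂ f) = kerOp k₃ f := by
  refine Lp.ext ?_
  filter_upwards [mulOp_ae ha (kerOp k₂ f), h₂.kerOp_ae f, h₁.kerOp_ae (mulOp b f), h₃.kerOp_ae f,
    Lp.coeFn_sub (kerOp k₁ (mulOp b f)) (mulOp a (kerOp k₂ f)), h₁.ae_integrable (mulOp b f),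
    h₂.ae_integrable f] with x h1 h2 h3 h4 h5 i1 i2
  rw [h5, Pi.sub_apply, h1, h2, h3, h4, ← integral_const_mul, ← integral_sub i1 (i2.const_mul _)]
  refine integral_congr_ae ?_
  filter_upwards [mulOp_ae hb f] with y hy
  rw [hy, ← heq]
  ring

/-! ### Fourier multipliers on `L²` -/

/-- The Fourier multiplier with the bounded measurable symbol `m`, as an operator on `L²`. The
frequency variable is that of Mathlib: the symbol of `∂_v` is `2πi ⟪ξ, v⟫`. -/
noncomputable def fm (m : E3 → ℂ) : L2 →L[ℂ] L2 :=
  (Lp.fourierTransformₗᵢ E3 ℂ).symm.toContinuousLinearEquiv.toContinuousLinearMap ∘L mulOp m ∘L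
    (Lp.fourierTransformₗᵢ E3 ℂ).toContinuousLinearEquiv.toContinuousLinearMap

lemma fm_apply (m : E3 → ℂ) (f : L2) :
    fm m f = (Lp.fourierTransformₗᵢ E3 ℂ).symm (mulOp m (Lp.fourierTransformₗᵢ E3 ℂ f)) := rfl

lemma fm_fm {m₁ m₂ : E3 → ℂ} (h₁ : BddMeas m₁) (h₂ : BddMeas m₂) (f : L2) :
    fm m₁ (fm m₂ f) = fm (fun x => m₁ x * m₂ x) f := by
  simp only [fm_apply, LinearIsometryEquiv.apply_symm_apply, mulOp_mulOp h₁ h₂]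

lemma fm_add {m₁ m₂ : E3 → ℂ} (h₁ : BddMeas m₁) (h₂ : BddMeas m₂) (f : L2) :
    fm (fun x => m₁ x + m₂ x) f = fm m₁ f + fm m₂ f := by
  simp only [fm_apply, mulOp_add h₁ h₂, map_add]

lemma fm_smul {m : E3 → ℂ} (h : BddMeas m) (c : ℂ) (f : L2) :
    fm (fun x => c * m x) f = c • fm m f := by
  simp only [fm_apply, mulOp_smul h, map_smul]

lemma fm_sum {ι : Type*} {m : ι → E3 → ℂ} (s : Finset ι) (h : ∀ i ∈ s, BddMeas (m i)) (f : L2) :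
    fm (fun x => ∑ i ∈ s, m i x) f = ∑ i ∈ s, fm (m i) f := by
  simp only [fm_apply, (mulOp_sum s h _).2, map_sum]

lemma fm_one (f : L2) : fm (fun _ => 1) f = f := by
  simp only [fm_apply, mulOp_const, one_smul, LinearIsometryEquiv.symm_apply_apply]

lemma norm_fm_apply_le {m : E3 → ℂ} (h : BddMeas m) {C : ℝ} (hC : ∀ x, ‖m x‖ ≤ C) (f : L2) :
    ‖fm m f‖ ≤ C * ‖f‖ := by
  rw [fm_apply, LinearIsometryEquiv.norm_map]
  simpa using norm_mulOp_apply_le h hC (Lp.fourierTransformₗᵢ E3 ℂ f)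

lemma inner_fm_left {m : E3 → ℂ} (h : BddMeas m) (f₁ f₂ : L2) :
    inner ℂ (fm m f₁) f₂ = inner ℂ f₁ (fm (fun x => star (m x)) f₂) := by
  have e : ∀ a b : L2, inner ℂ ((Lp.fourierTransformₗᵢ E3 ℂ).symm a) b
      = inner ℂ a (Lp.fourierTransformₗᵢ E3 ℂ b) := fun a b => by
    rw [← LinearIsometryEquiv.inner_map_map (Lp.fourierTransformₗᵢ E3 ℂ),
      LinearIsometryEquiv.apply_symm_apply]
  have e' : ∀ a b : L2, inner ℂ b ((Lp.fourierTransformₗᵢ E3 ℂ).symm a)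
      = inner ℂ (Lp.fourierTransformₗᵢ E3 ℂ b) a := fun a b => by
    rw [← LinearIsometryEquiv.inner_map_map (Lp.fourierTransformₗᵢ E3 ℂ),
      LinearIsometryEquiv.apply_symm_apply]
  rw [fm_apply, fm_apply, e, e', inner_mulOp_left h]

/-- The embedding of the Schwartz space into `L²`. -/
noncomputable def toH : 𝓢(E3, ℂ) →L[ℂ] L2 := SchwartzMap.toLpCLM ℂ ℂ 2 (volume : Measure E3)

lemma toH_ae (f : 𝓢(E3, ℂ)) : toH f =ᵐ[volume] f := f.coeFn_toLp 2 volume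

lemma denseRange_toH : DenseRange toH :=
  SchwartzMap.denseRange_toLpCLM (F := ℂ) (p := 2) (μ := (volume : Measure E3)) ENNReal.ofNat_ne_top

lemma mulOp_toH {m : E3 → ℂ} (h : BddMeas m) (hm : m.HasTemperateGrowth) (f : 𝓢(E3, ℂ)) :
    mulOp m (toH f) = toH (SchwartzMap.smulLeftCLM ℂ m f) := by
  refine Lp.ext ?_
  filter_upwards [mulOp_ae h (toH f), toH_ae f, toH_ae (SchwartzMap.smulLeftCLM ℂ m f)]
    with x h1 h2 h3
  rw [h1, h2, h3, SchwartzMap.smulLeftCLM_apply_apply hm, smul_eq_mul]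

lemma fm_toH {m : E3 → ℂ} (h : BddMeas m) (hm : m.HasTemperateGrowth) (f : 𝓢(E3, ℂ)) :
    fm m (toH f) = toH (SchwartzMap.fourierMultiplierCLM ℂ m f) := by
  have h1 : Lp.fourierTransformₗᵢ E3 ℂ (toH f) = toH (𝓕 f) := SchwartzMap.toLp_fourier_eq f
  rw [fm_apply, h1, mulOp_toH h hm, SchwartzMap.fourierMultiplierCLM_apply]
  exact SchwartzMap.toLp_fourierInv_eq _

/-! ### Semiclassical Fourier multipliers and their commutators -/

/-- The symbol `ξ ↦ χ(ξ/μ)`. -/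
noncomputable def scaledSymbol (μ : ℝ) (χ : 𝓢(E3, ℂ)) (ξ : E3) : ℂ := χ (μ⁻¹ • ξ)

/-- The convolution kernel `μ³ (𝓕⁻ χ)(μ x)` of the Fourier multiplier with symbol `χ(ξ/μ)`. -/
noncomputable def scaledKernel (μ : ℝ) (χ : 𝓢(E3, ℂ)) (x : E3) : ℂ := (μ : ℂ) ^ 3 * 𝓕⁻ χ (μ • x)

/-- The moment `∫ |z|ʲ |(𝓕⁻ χ)(z)| dz`. -/
noncomputable def kernelMoment (j : ℕ) (χ : 𝓢(E3, ℂ)) : ℝ := ∫ z, ‖z‖ ^ j * ‖𝓕⁻ χ z‖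

lemma kernelMoment_nonneg (j : ℕ) (χ : 𝓢(E3, ℂ)) : 0 ≤ kernelMoment j χ :=
  integral_nonneg fun _ => by positivity

lemma exists_scaled_schwartz {μ : ℝ} (hμ : 0 < μ) (χ : 𝓢(E3, ℂ)) :
    ∃ χ' : 𝓢(E3, ℂ), ⇑χ' = scaledSymbol μ χ := by
  refine ⟨SchwartzMap.compCLMOfContinuousLinearEquiv ℂ
    (ContinuousLinearEquiv.smulLeft (Units.mk0 μ⁻¹ (inv_ne_zero hμ.ne'))) χ, ?_⟩
  ext ξ
  rfl

lemma SchwartzMap.bddMeas (χ : 𝓢(E3, ℂ)) : BddMeas χ :=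
  ⟨χ.continuous.measurable, _, fun x => χ.norm_le_seminorm ℝ x⟩

lemma bddMeas_scaledSymbol {μ : ℝ} (hμ : 0 < μ) (χ : 𝓢(E3, ℂ)) : BddMeas (scaledSymbol μ χ) := by
  obtain ⟨χ', h⟩ := exists_scaled_schwartz hμ χ
  exact h ▸ SchwartzMap.bddMeas χ'

lemma hasTemperateGrowth_scaledSymbol {μ : ℝ} (hμ : 0 < μ) (χ : 𝓢(E3, ℂ)) :
    (scaledSymbol μ χ).HasTemperateGrowth := by
  obtain ⟨χ', h⟩ := exists_scaled_schwartz hμ χ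
  exact h ▸ χ'.hasTemperateGrowth

lemma fourierInv_scaledSymbol {μ : ℝ} (hμ : 0 < μ) (χ : 𝓢(E3, ℂ)) (x : E3) :
    𝓕⁻ (scaledSymbol μ χ) x = scaledKernel μ χ x := by
  rw [scaledKernel, SchwartzMap.fourierInv_coe, Real.fourierInv_eq, Real.fourierInv_eq]
  have h := Measure.integral_comp_smul (volume : Measure E3)
    (fun v : E3 => Real.fourierChar (inner ℝ v (μ • x)) • χ v) μ⁻¹
  have h2 : |((μ⁻¹ ^ Module.finrank ℝ E3)⁻¹ : ℝ)| = μ ^ 3 := by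
    rw [finrank_euclideanSpace_fin, inv_pow, inv_inv, abs_of_pos (by positivity)]
  rw [h2] at h
  have h3 : ((μ : ℂ) ^ 3 * ∫ v, Real.fourierChar (inner ℝ v (μ • x)) • χ v)
      = (μ ^ 3 : ℝ) • ∫ v, Real.fourierChar (inner ℝ v (μ • x)) • χ v := by
    rw [Complex.real_smul]; push_cast; rfl
  rw [h3, ← h]
  refine integral_congr_ae (Eventually.of_forall fun v => ?_)
  simp only [scaledSymbol]
  congr 2
  rw [inner_smul_left, inner_smul_right]
  simp only [conj_trivial]
  field_simp

lemma continuous_scaledKernel (μ : ℝ) (χ : 𝓢(E3, ℂ)) : Continuous (scaledKernel μ χ) := by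
  unfold scaledKernel
  have := (𝓕⁻ χ).continuous
  fun_prop

lemma integrable_pow_mul_scaledKernel {μ : ℝ} (hμ : 0 < μ) (χ : 𝓢(E3, ℂ)) (j : ℕ) :
    Integrable (fun z => ‖z‖ ^ j * ‖scaledKernel μ χ z‖) ∧
      ∫ z, ‖z‖ ^ j * ‖scaledKernel μ χ z‖ = kernelMoment j χ / μ ^ j := by
  have e : (fun z : E3 => ‖z‖ ^ j * ‖scaledKernel μ χ z‖)
      = fun z => μ ^ 3 / μ ^ j * ((fun v : E3 => ‖v‖ ^ j * ‖𝓕⁻ χ v‖) (μ • z)) := by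
    ext z
    simp only [scaledKernel, norm_mul, norm_pow, Complex.norm_real, norm_smul, Real.norm_eq_abs,
      abs_of_pos hμ, mul_pow]
    field_simp
  have h0 : Integrable (fun v : E3 => ‖v‖ ^ j * ‖𝓕⁻ χ v‖) :=
    (𝓕⁻ χ).integrable_pow_mul volume j
  rw [e]
  refine ⟨((integrable_comp_smul_iff volume _ hμ.ne').2 h0).const_mul _, ?_⟩
  rw [integral_const_mul,
    Measure.integral_comp_smul volume (fun v : E3 => ‖v‖ ^ j * ‖𝓕⁻ χ v‖) μ, finrank_euclideanSpace_fin,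
    abs_of_pos (by positivity), smul_eq_mul, kernelMoment]
  field_simp

/-- Kernels `g(x, y) K_μ(x - y)`, with `K_μ` a semiclassical convolution kernel, are governed by the
growth of `g` off the diagonal; each power of `|x - y|` gains a factor `1/μ`. -/
lemma exists_kerBound_scaled {μ : ℝ} (hμ : 0 < μ) (χ : 𝓢(E3, ℂ)) {g : E3 → E3 → ℂ}
    (hg : Measurable (Function.uncurry g)) {α β γ : ℝ} (hα : 0 ≤ α) (hβ : 0 ≤ β) (hγ : 0 ≤ γ)
    (hb : ∀ x y, ‖g x y‖ ≤ α + β * ‖x - y‖ + γ * ‖x - y‖ ^ 2) :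
    ∃ κ, KerBound (fun x y => g x y * scaledKernel μ χ (x - y)) κ ∧
      (∫⁻ z, κ z).toReal = α * kernelMoment 0 χ + β * (kernelMoment 1 χ / μ)
        + γ * (kernelMoment 2 χ / μ ^ 2) := by
  obtain ⟨i0, e0⟩ := integrable_pow_mul_scaledKernel hμ χ 0
  obtain ⟨i1, e1⟩ := integrable_pow_mul_scaledKernel hμ χ 1
  obtain ⟨i2, e2⟩ := integrable_pow_mul_scaledKernel hμ χ 2
  set F : E3 → ℝ := fun z => α * (‖z‖ ^ 0 * ‖scaledKernel μ χ z‖)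
    + β * (‖z‖ ^ 1 * ‖scaledKernel μ χ z‖) + γ * (‖z‖ ^ 2 * ‖scaledKernel μ χ z‖) with hF
  have iF : Integrable F := ((i0.const_mul α).add (i1.const_mul β)).add (i2.const_mul γ)
  have F0 : ∀ z, 0 ≤ F z := fun z => by positivity
  have eF : ∫ z, F z = α * kernelMoment 0 χ + β * (kernelMoment 1 χ / μ)
        + γ * (kernelMoment 2 χ / μ ^ 2) := by
    have h1 := integral_add ((i0.const_mul α).add (i1.const_mul β)) (i2.const_mul γ)
    simp only [Pi.add_apply] at h1
    rw [hF, h1, integral_add (i0.const_mul α) (i1.const_mul β), integral_const_mul, integral_const_mul,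
      integral_const_mul, e0, e1, e2]
    simp
  have hc := continuous_scaledKernel μ χ
  have eI : ∫⁻ z, ENNReal.ofReal (F z) = ENNReal.ofReal (∫ z, F z) :=
    (ofReal_integral_eq_lintegral_ofReal iF (Eventually.of_forall F0)).symm
  refine ⟨fun z => ENNReal.ofReal (F z), ⟨?_, ?_, ?_, fun x y => ?_⟩, ?_⟩
  · exact hg.mul (hc.comp (continuous_fst.sub continuous_snd)).measurable
  · have : Continuous F := by fun_prop
    exact this.measurable.ennreal_ofReal
  · rw [eI]; exact ENNReal.ofReal_ne_top
  · rw [← ofReal_norm, norm_mul]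
    refine ENNReal.ofReal_le_ofReal ((mul_le_mul_of_nonneg_right (hb x y) (norm_nonneg _)).trans
      (le_of_eq ?_))
    simp only [hF]
    ring
  · rw [eI, ENNReal.toReal_ofReal (integral_nonneg F0), eF]

lemma exists_kerBound_scaledKernel {μ : ℝ} (hμ : 0 < μ) (χ : 𝓢(E3, ℂ)) :
    ∃ κ, KerBound (fun x y => scaledKernel μ χ (x - y)) κ ∧
      (∫⁻ z, κ z).toReal = kernelMoment 0 χ := by
  obtain ⟨κ, h, h'⟩ := exists_kerBound_scaled hμ χ (g := fun _ _ => 1) measurable_const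
    zero_le_one le_rfl le_rfl (fun x y => by simp)
  exact ⟨κ, by simpa using h, by simpa using h'⟩

/-- The Fourier multiplier with symbol `χ(ξ/μ)` is convolution with `μ³ (𝓕⁻ χ)(μ x)`. -/
lemma fm_scaledSymbol_eq_kerOp {μ : ℝ} (hμ : 0 < μ) (χ : 𝓢(E3, ℂ)) (f : L2) :
    fm (scaledSymbol μ χ) f = kerOp (fun x y => scaledKernel μ χ (x - y)) f := by
  obtain ⟨κ, hκ, -⟩ := exists_kerBound_scaledKernel hμ χ
  refine denseRange_toH.induction_on (p := fun f => fm (scaledSymbol μ χ) f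
    = kerOp (fun x y => scaledKernel μ χ (x - y)) f) f
    (isClosed_eq (ContinuousLinearMap.continuous _) (ContinuousLinearMap.continuous _)) fun f => ?_
  rw [fm_toH (bddMeas_scaledSymbol hμ χ) (hasTemperateGrowth_scaledSymbol hμ χ)]
  refine Lp.ext ?_
  filter_upwards [hκ.kerOp_ae (toH f),
    toH_ae (SchwartzMap.fourierMultiplierCLM ℂ (scaledSymbol μ χ) f)] with x h1 h2
  rw [h1, h2]
  obtain ⟨χ', h⟩ := exists_scaled_schwartz hμ χ
  have h3 : SchwartzMap.fourierMultiplierCLM ℂ (scaledSymbol μ χ) f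
      = SchwartzMap.convolution (ContinuousLinearMap.mul ℂ ℂ) (𝓕⁻ χ') f := by
    rw [SchwartzMap.fourierMultiplierCLM_apply]
    simp only [SchwartzMap.convolution, LinearMap.coe_mk, AddHom.coe_mk,
      ContinuousLinearMap.comp_apply, FourierTransform.fourierCLM_apply,
      FourierTransform.fourierInvCLM_apply, FourierTransform.fourier_fourierInv_eq]
    congr 1
    ext ξ
    rw [SchwartzMap.smulLeftCLM_apply_apply (hasTemperateGrowth_scaledSymbol hμ χ),
      SchwartzMap.pairing_apply_apply, ← h]
    rfl
  rw [h3, SchwartzMap.convolution_apply, convolution_eq_swap]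
  refine integral_congr_ae ?_
  filter_upwards [toH_ae f] with y hy
  rw [hy, ContinuousLinearMap.mul_apply', SchwartzMap.fourierInv_coe, h, fourierInv_scaledSymbol hμ]

/-- Semiclassical multipliers are bounded on weighted `L²`: the weight costs only `O(1/μ)`. -/
lemma norm_mulOp_fm_scaledSymbol_le {μ : ℝ} (hμ : 0 < μ) (χ : 𝓢(E3, ℂ)) {ψ : E3 → ℝ}
    (hψm : Measurable ψ) (hψ0 : ∀ x, 0 < ψ x) {C : ℝ} (hψC : ∀ x, ψ x ≤ C) {L : ℝ} (hL : 0 ≤ L)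
    (hψ : ∀ x y, ψ x ≤ ψ y * (1 + L * ‖x - y‖ + L * ‖x - y‖ ^ 2)) (f : L2) :
    ‖mulOp (fun x => (ψ x : ℂ)) (fm (scaledSymbol μ χ) f)‖
      ≤ (kernelMoment 0 χ + L * (kernelMoment 1 χ / μ) + L * (kernelMoment 2 χ / μ ^ 2))
        * ‖mulOp (fun x => (ψ x : ℂ)) f‖ := by
  have hb : BddMeas (fun x => (ψ x : ℂ)) := ⟨Complex.measurable_ofReal.comp hψm, C, fun x => by
    rw [Complex.norm_real, Real.norm_eq_abs, abs_of_pos (hψ0 x)]; exact hψC x⟩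
  obtain ⟨κ₀, h₀, -⟩ := exists_kerBound_scaledKernel hμ χ
  obtain ⟨κ, h, hκ⟩ := exists_kerBound_scaled hμ χ (g := fun x y => ((ψ x / ψ y : ℝ) : ℂ))
    (α := 1) (β := L) (γ := L)
    (Complex.measurable_ofReal.comp
      ((hψm.comp measurable_fst).div (hψm.comp measurable_snd))) zero_le_one hL hL (fun x y => by
      rw [Complex.norm_real, Real.norm_eq_abs, abs_of_pos (div_pos (hψ0 x) (hψ0 y)),
        div_le_iff₀' (hψ0 y)]
      exact hψ x y)
  rw [one_mul] at hκ
  rw [fm_scaledSymbol_eq_kerOp hμ, h₀.mulOp_comp h hb hb (fun x y => ?_), ← hκ]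
  · exact (kerOp _).le_of_opNorm_le h.norm_kerOp_le _
  · have := (hψ0 y).ne'
    have h' : (ψ y : ℂ) ≠ 0 := by exact_mod_cast this
    push_cast
    field_simp

/-- The commutator of a semiclassical multiplier with a bounded Lipschitz function is `O(1/μ)`. -/
lemma norm_commutator_fm_scaledSymbol_le {μ : ℝ} (hμ : 0 < μ) (χ : 𝓢(E3, ℂ)) {g : E3 → ℂ}
    (hg : BddMeas g) {L : ℝ} (hL : 0 ≤ L) (hgL : ∀ x y, ‖g x - g y‖ ≤ L * ‖x - y‖) (f : L2) :
    ‖fm (scaledSymbol μ χ) (mulOp g f) - mulOp g (fm (scaledSymbol μ χ) f)‖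
      ≤ L * (kernelMoment 1 χ / μ) * ‖f‖ := by
  obtain ⟨κ₀, h₀, -⟩ := exists_kerBound_scaledKernel hμ χ
  obtain ⟨κ, h, hκ⟩ := exists_kerBound_scaled hμ χ (g := fun x y => g y - g x)
    (α := 0) (β := L) (γ := 0)
    ((hg.meas.comp measurable_snd).sub (hg.meas.comp measurable_fst)) le_rfl hL le_rfl
    (fun x y => by rw [norm_sub_rev]; simpa using hgL x y)
  have hκ' : (∫⁻ z, κ z).toReal = L * (kernelMoment 1 χ / μ) := by rw [hκ]; ring
  rw [fm_scaledSymbol_eq_kerOp hμ, fm_scaledSymbol_eq_kerOp hμ,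
    h₀.commutator h₀ h hg hg (fun x y => by ring), ← hκ']
  exact (kerOp _).le_of_opNorm_le h.norm_kerOp_le _

/-! ### A weighted Rellich identity -/

/-- A bounded continuous function on the line. -/
structure BddCont (W : ℝ → ℝ) : Prop where
  cont : Continuous W
  bdd : ∃ C, ∀ t, |W t| ≤ C

/-- Multiplication by `W(ω · x)`. -/
noncomputable def dirOp (ω : E3) (W : ℝ → ℝ) : L2 →L[ℂ] L2 :=
  mulOp fun x => ((W (inner ℝ ω x) : ℝ) : ℂ)

lemma BddCont.bddMeas {W : ℝ → ℝ} (h : BddCont W) (ω : E3) :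
    BddMeas fun x => ((W (inner ℝ ω x) : ℝ) : ℂ) := by
  obtain ⟨C, hC⟩ := h.bdd
  refine ⟨?_, C, fun x => ?_⟩
  · have := h.cont
    exact Continuous.measurable (by fun_prop)
  · rw [Complex.norm_real]; exact hC _

lemma BddCont.const_mul {W : ℝ → ℝ} (h : BddCont W) (c : ℝ) : BddCont fun t => c * W t := by
  obtain ⟨C, hC⟩ := h.bdd
  refine ⟨h.cont.const_mul c, |c| * C, fun t => ?_⟩
  rw [abs_mul]
  exact mul_le_mul_of_nonneg_left (hC t) (abs_nonneg c)

lemma dirOp_const_mul {W : ℝ → ℝ} (h : BddCont W) (ω : E3) (c : ℝ) (f : L2) :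
    dirOp ω (fun t => c * W t) f = (c : ℂ) • dirOp ω W f := by
  rw [dirOp, dirOp, ← mulOp_smul (h.bddMeas ω)]
  push_cast
  rfl

lemma inner_dirOp_left {W : ℝ → ℝ} (h : BddCont W) (ω : E3) (f g : L2) :
    inner ℂ (dirOp ω W f) g = inner ℂ f (dirOp ω W g) := by
  rw [dirOp, inner_mulOp_left (h.bddMeas ω)]
  simp [Complex.conj_ofReal]

lemma re_inner_dirOp_comm {W : ℝ → ℝ} (h : BddCont W) (ω : E3) (f g : L2) :
    (inner ℂ f (dirOp ω W g)).re = (inner ℂ g (dirOp ω W f)).re := by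
  rw [← inner_dirOp_left h, ← inner_conj_symm, Complex.conj_re]

lemma re_inner_I_smul_dirOp_self {W : ℝ → ℝ} (h : BddCont W) (ω : E3) (f : L2) :
    (inner ℂ (Complex.I • f) (dirOp ω W f)).re = 0 := by
  have h1 : (inner ℂ f (dirOp ω W f)).im = 0 := by
    rw [← Complex.conj_eq_iff_im, inner_conj_symm, inner_dirOp_left h]
  rw [inner_smul_left, Complex.conj_I]
  simp [h1]

lemma dirOp_toH_ae {W : ℝ → ℝ} (h : BddCont W) (ω : E3) (f : 𝓢(E3, ℂ)) :
    dirOp ω W (toH f) =ᵐ[volume] fun x => (W (inner ℝ ω x) : ℂ) * f x := by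
  filter_upwards [mulOp_ae (h.bddMeas ω) (toH f), toH_ae f] with x h1 h2
  rw [dirOp, h1, h2]

/-- Integration by parts against the weight `W(ω · x)`. -/
lemma inner_lineDeriv_dirOp {W W' : ℝ → ℝ} (hW : BddCont W) (hW' : BddCont W')
    (hd : ∀ t, HasDerivAt W (W' t) t) (ω v : E3) (f g : 𝓢(E3, ℂ)) :
    inner ℂ (toH (∂_{v} f)) (dirOp ω W (toH g)) +
      inner ℂ (toH f) (dirOp ω W (toH (∂_{v} g))) +
      ((inner ℝ ω v : ℝ) : ℂ) * inner ℂ (toH f) (dirOp ω W' (toH g)) = (0 : ℂ) := by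
  have key : ∀ (V : ℝ → ℝ) (_ : BddCont V) (p q : 𝓢(E3, ℂ)),
      Integrable (fun x => star (p x) * ((V (inner ℝ ω x) : ℂ) * q x)) ∧
      inner ℂ (toH p) (dirOp ω V (toH q))
        = ∫ x, star (p x) * ((V (inner ℝ ω x) : ℂ) * q x) := by
    intro V hV p q
    have e : (fun x => inner ℂ ((toH p) x) ((dirOp ω V (toH q)) x)) =ᵐ[volume]
        fun x => star (p x) * ((V (inner ℝ ω x) : ℂ) * q x) := by
      filter_upwards [dirOp_toH_ae hV ω q, toH_ae p] with x h1 h2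
      rw [h1, h2, RCLike.inner_apply, mul_comm]
      rfl
    exact ⟨(L2.integrable_inner (𝕜 := ℂ) (toH p) (dirOp ω V (toH q))).congr e,
      by rw [L2.inner_def]; exact integral_congr_ae e⟩
  obtain ⟨i1, e1⟩ := key W hW (∂_{v} f) g
  obtain ⟨i2, e2⟩ := key W hW f (∂_{v} g)
  obtain ⟨i3, e3⟩ := key W' hW' f g
  obtain ⟨i4, -⟩ := key W hW f g
  have hlin : ∀ x : E3, HasFDerivAt (fun x : E3 => inner ℝ ω x) (innerSL ℝ ω) x :=
    fun x => (innerSL ℝ ω).hasFDerivAt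
  have hfd : ∀ x : E3, HasFDerivAt (fun x => (W (inner ℝ ω x) : ℂ) * g x)
      ((W (inner ℝ ω x) : ℂ) • fderiv ℝ g x +
        g x • (Complex.ofRealCLM ∘L (W' (inner ℝ ω x) • innerSL ℝ ω))) x := fun x =>
    (Complex.ofRealCLM.hasFDerivAt.comp x ((hd _).comp_hasFDerivAt x (hlin x))).mul
      (g.hasFDerivAt x)
  have hff : ∀ x : E3, HasFDerivAt (fun x => star (f x))
      (Complex.conjCLE.toContinuousLinearMap ∘L fderiv ℝ f x) x := fun x =>
    Complex.conjCLE.toContinuousLinearMap.hasFDerivAt.comp x (f.hasFDerivAt x)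
  have ibp := integral_bilinear_hasFDerivAt_right_eq_neg_left_of_integrable
    (μ := (volume : Measure E3)) (B := ContinuousLinearMap.mul ℝ ℂ) (v := v)
    (f := fun x => star (f x)) (g := fun x => (W (inner ℝ ω x) : ℂ) * g x) ?_ ?_ i4
    (fun x _ => hff x) (fun x _ => hfd x)
  · rw [e1, e2, e3, ← integral_const_mul, add_assoc, ← integral_add i2 (i3.const_mul _), add_comm,
      ← eq_neg_iff_add_eq_zero]
    refine Eq.trans (integral_congr_ae (Eventually.of_forall fun x => ?_)) (ibp.trans ?_)
    · simp [SchwartzMap.lineDerivOp_apply_eq_fderiv]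
      ring
    · simp [SchwartzMap.lineDerivOp_apply_eq_fderiv]
  · simpa [SchwartzMap.lineDerivOp_apply_eq_fderiv] using i1
  · refine (i2.add (i3.const_mul ((inner ℝ ω v : ℝ) : ℂ))).congr (Eventually.of_forall fun x => ?_)
    simp [SchwartzMap.lineDerivOp_apply_eq_fderiv]
    ring

/-- The standard basis vector. -/
noncomputable abbrev basisVec (a : Fin 3) : E3 := EuclideanSpace.single a 1

lemma inner_basisVec (ω : E3) (a : Fin 3) : inner ℝ ω (basisVec a) = ω a := by
  simp [basisVec, EuclideanSpace.inner_single_right]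

lemma lineDeriv_eq_sum (ω : E3) (U : 𝓢(E3, ℂ)) :
    ∂_{ω} U = ∑ a, (ω a : ℂ) • ∂_{basisVec a} U := by
  ext x
  have h : ω = ∑ a, ω a • basisVec a := by
    have := (EuclideanSpace.basisFun (Fin 3) ℝ).sum_repr ω
    simpa using this.symm
  rw [SchwartzMap.lineDerivOp_apply_eq_fderiv]
  conv_lhs => rw [h, map_sum]
  simp [SchwartzMap.lineDerivOp_apply_eq_fderiv]

lemma lineDeriv_comm (v w : E3) (U : 𝓢(E3, ℂ)) : ∂_{v} (∂_{w} U) = ∂_{w} (∂_{v} U) := by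
  simp only [SchwartzMap.lineDeriv_eq_fourierMultiplierCLM]
  rw [← SchwartzMap.fourierMultiplierCLM_ofReal ℂ (by fun_prop),
    ← SchwartzMap.fourierMultiplierCLM_ofReal ℂ (by fun_prop),
    ← SchwartzMap.fourierMultiplierCLM_ofReal ℂ (by fun_prop),
    ← SchwartzMap.fourierMultiplierCLM_ofReal ℂ (by fun_prop)]
  simp only [map_smul]
  rw [SchwartzMap.fourierMultiplierCLM_fourierMultiplierCLM_apply (by fun_prop) (by fun_prop),
    SchwartzMap.fourierMultiplierCLM_fourierMultiplierCLM_apply (by fun_prop) (by fun_prop),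
    mul_comm (fun x : E3 => (RCLike.ofReal (inner ℝ x v) : ℂ))]

lemma laplacian_eq_sum' (U : 𝓢(E3, ℂ)) :
    Laplacian.laplacian U = ∑ a, ∂_{basisVec a} (∂_{basisVec a} U) := by
  rw [SchwartzMap.laplacian_eq_sum (EuclideanSpace.basisFun (Fin 3) ℝ)]
  simp [basisVec]

/-- The weighted Rellich identity: for a solution of `-ΔU - (λ² + iη) U = F` and a weight `W(ω · x)`
with `W' = -2Nρ`, the weighted energy of `∂_ω U` is controlled by `F`, by the flux `⟨iU, W ∂_ω U⟩`,
and by terms of lower order. -/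
lemma rellich_identity {W ρ ρ₁ ρ₂ : ℝ → ℝ} {N l η : ℝ} {ω : E3} (hω : ‖ω‖ = 1) (hW : BddCont W)
    (hρ : BddCont ρ) (hρ₁ : BddCont ρ₁) (hρ₂ : BddCont ρ₂)
    (dW : ∀ t, HasDerivAt W (-2 * N * ρ t) t) (dρ : ∀ t, HasDerivAt ρ (ρ₁ t) t)
    (dρ₁ : ∀ t, HasDerivAt ρ₁ (ρ₂ t) t) {U F : 𝓢(E3, ℂ)}
    (hU : -(Laplacian.laplacian U) = F + ((l : ℂ) ^ 2 + Complex.I * η) • U) :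
    2 * N * (inner ℂ (toH (∂_{ω} U)) (dirOp ω ρ (toH (∂_{ω} U)))).re
      = N * (inner ℂ (toH F) (dirOp ω ρ (toH U))).re
        + N / 2 * (inner ℂ (toH U) (dirOp ω ρ₂ (toH U))).re
        - (inner ℂ (toH F) (dirOp ω W (toH (∂_{ω} U)))).re
        - η * (inner ℂ (Complex.I • toH U) (dirOp ω W (toH (∂_{ω} U)))).re := by
  have hωω : inner ℝ ω ω = 1 := by rw [real_inner_self_eq_norm_sq, hω]; norm_num
  set u : L2 := toH U
  set d : L2 := toH (∂_{ω} U) with hd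
  set D : Fin 3 → L2 := fun a => toH (∂_{basisVec a} U)
  set DD : Fin 3 → L2 := fun a => toH (∂_{basisVec a} (∂_{basisVec a} U))
  set E : Fin 3 → L2 := fun a => toH (∂_{ω} (∂_{basisVec a} U))
  have hdD : d = ∑ a, (ω a : ℂ) • D a := by
    rw [hd, lineDeriv_eq_sum, map_sum]
    simp only [map_smul]
    rfl
  have hEq : -(∑ a, DD a) = toH F + ((l : ℂ) ^ 2 + Complex.I * η) • u := by
    rw [← map_smul, ← map_add, ← hU, laplacian_eq_sum', map_neg, map_sum]
  have hW' : BddCont fun t => -2 * N * ρ t := hρ.const_mul _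
  -- the two integrations by parts for each second derivative
  have h1 : ∀ a, (inner ℂ (DD a) (dirOp ω W d)).re + (inner ℂ (D a) (dirOp ω W (E a))).re
      + -2 * N * ω a * (inner ℂ (D a) (dirOp ω ρ d)).re = 0 := by
    intro a
    have := congrArg Complex.re
      (inner_lineDeriv_dirOp hW hW' dW ω (basisVec a) (∂_{basisVec a} U) (∂_{ω} U))
    rw [dirOp_const_mul hρ, inner_smul_right, inner_basisVec, lineDeriv_comm (basisVec a) ω] at this
    simp only [Complex.add_re, Complex.re_ofReal_mul, Complex.zero_re] at this
    linarith
  have h2 : ∀ a, (inner ℂ (D a) (dirOp ω W (E a))).re = N * (inner ℂ (D a) (dirOp ω ρ (D a))).re := by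
    intro a
    have := congrArg Complex.re
      (inner_lineDeriv_dirOp hW hW' dW ω ω (∂_{basisVec a} U) (∂_{basisVec a} U))
    rw [dirOp_const_mul hρ, inner_smul_right, hωω] at this
    simp only [Complex.add_re, Complex.re_ofReal_mul, Complex.zero_re] at this
    rw [re_inner_dirOp_comm hW] at this
    linarith
  have h3 : (inner ℂ u (dirOp ω W d)).re = N * (inner ℂ u (dirOp ω ρ u)).re := by
    have := congrArg Complex.re (inner_lineDeriv_dirOp hW hW' dW ω ω U U)
    rw [dirOp_const_mul hρ, inner_smul_right, hωω] at this
    simp only [Complex.add_re, Complex.re_ofReal_mul, Complex.zero_re] at this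
    rw [re_inner_dirOp_comm hW] at this
    linarith
  have h4 : ∀ a, (inner ℂ (DD a) (dirOp ω ρ u)).re + (inner ℂ (D a) (dirOp ω ρ (D a))).re
      + ω a * (inner ℂ (D a) (dirOp ω ρ₁ u)).re = 0 := by
    intro a
    have := congrArg Complex.re
      (inner_lineDeriv_dirOp hρ hρ₁ dρ ω (basisVec a) (∂_{basisVec a} U) U)
    rw [inner_basisVec] at this
    simpa only [Complex.add_re, Complex.re_ofReal_mul, Complex.zero_re] using this
  have h5 : (inner ℂ d (dirOp ω ρ₁ u)).re = -(1 / 2) * (inner ℂ u (dirOp ω ρ₂ u)).re := by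
    have := congrArg Complex.re (inner_lineDeriv_dirOp hρ₁ hρ₂ dρ₁ ω ω U U)
    rw [hωω] at this
    simp only [Complex.add_re, Complex.re_ofReal_mul, Complex.zero_re] at this
    rw [re_inner_dirOp_comm hρ₁ ω u d] at this
    linarith
  have hsum : ∀ f : L2, (inner ℂ d f).re = ∑ a, ω a * (inner ℂ (D a) f).re := by
    intro f
    rw [hdD, sum_inner, Complex.re_sum]
    refine Finset.sum_congr rfl fun a _ => ?_
    rw [inner_smul_left, Complex.conj_ofReal, Complex.re_ofReal_mul]
  have hlap : ∀ f : L2, -(∑ a, (inner ℂ (DD a) f).re) = (inner ℂ (toH F) f).re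
      + l ^ 2 * (inner ℂ u f).re + η * (inner ℂ (Complex.I • u) f).re := by
    intro f
    rw [← Complex.re_sum, ← sum_inner, ← Complex.neg_re, ← inner_neg_left, hEq, inner_add_left,
      add_smul, inner_add_left, mul_comm Complex.I, mul_smul, inner_smul_left, inner_smul_left]
    simp only [Complex.conj_ofReal, ← Complex.ofReal_pow, Complex.add_re,
      Complex.re_ofReal_mul]
    ring
  have s1 := hlap (dirOp ω W d)
  have s2 := hlap (dirOp ω ρ u)
  rw [re_inner_I_smul_dirOp_self hρ] at s2
  have s3 := hsum (dirOp ω ρ d)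
  have s4 := hsum (dirOp ω ρ₁ u)
  simp only [Fin.sum_univ_three] at s1 s2 s3 s4
  have h10 := h1 0
  have h11 := h1 1
  have h12 := h1 2
  rw [h2] at h10 h11 h12
  have h40 := h4 0
  have h41 := h4 1
  have h42 := h4 2
  rw [h3] at s1
  rw [h5] at s4
  linear_combination 2 * N * s3 - (h10 + h11 + h12) - s1 + N * (h40 + h41 + h42) + N * s2 + N * s4

/-! ### The bracket and the resolvent symbol -/

lemma bracket_pos (x : E3) : 0 < bracket x := Real.sqrt_pos.2 (by positivity)

lemma one_le_bracket (x : E3) : 1 ≤ bracket x := Real.one_le_sqrt.2 (by nlinarith [norm_nonneg x])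

lemma bracket_sq (x : E3) : bracket x ^ 2 = 1 + ‖x‖ ^ 2 := Real.sq_sqrt (by positivity)

lemma norm_le_bracket (x : E3) : ‖x‖ ≤ bracket x := Real.le_sqrt_of_sq_le (by linarith)

lemma bracket_le_add (x y : E3) : bracket x ≤ bracket y + ‖x - y‖ := by
  have hy := norm_le_bracket y
  have h1 : ‖x‖ ≤ ‖y‖ + ‖x - y‖ := by simpa using norm_add_le y (x - y)
  refine Real.sqrt_le_iff.2 ⟨by positivity [bracket_pos y], ?_⟩
  have := bracket_sq y
  nlinarith [norm_nonneg x, norm_nonneg y, norm_nonneg (x - y), bracket_pos y]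

lemma continuous_bracket : Continuous bracket := by
  unfold bracket
  fun_prop

lemma continuous_bracket_rpow (s : ℝ) : Continuous fun x => bracket x ^ s :=
  continuous_bracket.rpow_const fun x => Or.inl (bracket_pos x).ne'

/-- The weight `⟨x⟩ˢ`, as a complex-valued function. -/
noncomputable def weight (s : ℝ) (x : E3) : ℂ := ((bracket x ^ s : ℝ) : ℂ)

lemma norm_weight (s : ℝ) (x : E3) : ‖weight s x‖ = bracket x ^ s := by
  rw [weight, Complex.norm_real, Real.norm_eq_abs, abs_of_pos (Real.rpow_pos_of_pos (bracket_pos x) s)]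

lemma weight_mul (s t : ℝ) (x : E3) : weight s x * weight t x = weight (s + t) x := by
  rw [weight, weight, weight, Real.rpow_add (bracket_pos x)]
  push_cast
  rfl

lemma weight_zero (x : E3) : weight 0 x = 1 := by simp [weight]

lemma continuous_weight (s : ℝ) : Continuous (weight s) :=
  Complex.continuous_ofReal.comp (continuous_bracket_rpow s)

lemma norm_weight_le_one {s : ℝ} (hs : s ≤ 0) (x : E3) : ‖weight s x‖ ≤ 1 := by
  rw [norm_weight]
  exact Real.rpow_le_one_of_one_le_of_nonpos (one_le_bracket x) hs

lemma bddMeas_weight {s : ℝ} (hs : s ≤ 0) : BddMeas (weight s) :=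
  ⟨(continuous_weight s).measurable, 1, norm_weight_le_one hs⟩

lemma hasTemperateGrowth_weight (s : ℝ) : (weight s).HasTemperateGrowth := by
  have h : weight s = fun x : E3 => (((1 + ‖x‖ ^ 2) ^ (s / 2) : ℝ) : ℂ) := by
    ext x
    rw [weight, bracket, Real.sqrt_eq_rpow, ← Real.rpow_mul (by positivity),
      one_div_mul_eq_div]
  rw [h]
  exact Function.Complex.hasTemperateGrowth_ofReal.comp
    (Function.hasTemperateGrowth_one_add_norm_sq_rpow E3 (s / 2))

/-- The symbol `(4π²|ξ|² - z)⁻¹` of the free resolvent. -/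
noncomputable def resSymbol (z : ℂ) (ξ : E3) : ℂ :=
  (((4 * Real.pi ^ 2 * ‖ξ‖ ^ 2 : ℝ) : ℂ) - z)⁻¹

lemma resSymbol_ne {z : ℂ} (hz : z.im ≠ 0) (t : ℝ) : (t : ℂ) - z ≠ 0 := fun h => hz (by
  have := congrArg Complex.im h
  simpa using this)

lemma mul_resSymbol {z : ℂ} (hz : z.im ≠ 0) (ξ : E3) :
    (((4 * Real.pi ^ 2 * ‖ξ‖ ^ 2 : ℝ) : ℂ) - z) * resSymbol z ξ = 1 :=
  mul_inv_cancel₀ (resSymbol_ne hz _)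

lemma norm_inv_sub_le {z : ℂ} (hz : z.im ≠ 0) (t : ℝ) : ‖((t : ℂ) - z)⁻¹‖ ≤ |z.im|⁻¹ := by
  rw [norm_inv]
  refine inv_anti₀ (abs_pos.2 hz) ?_
  have := Complex.abs_im_le_norm ((t : ℂ) - z)
  simpa using this

lemma continuous_resSymbol {z : ℂ} (hz : z.im ≠ 0) : Continuous (resSymbol z) := by
  unfold resSymbol
  refine Continuous.inv₀ (by fun_prop) fun ξ => resSymbol_ne hz _

lemma bddMeas_resSymbol {z : ℂ} (hz : z.im ≠ 0) : BddMeas (resSymbol z) :=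
  ⟨(continuous_resSymbol hz).measurable, |z.im|⁻¹, fun _ => norm_inv_sub_le hz _⟩

/-- The symbol of the derivative `∂_v`. -/
noncomputable def derivSymbol (v : E3) (ξ : E3) : ℂ := 2 * Real.pi * Complex.I * (inner ℝ ξ v : ℝ)

lemma norm_derivSymbol_le (v ξ : E3) : ‖derivSymbol v ξ‖ ≤ 2 * Real.pi * (‖ξ‖ * ‖v‖) := by
  have : ‖derivSymbol v ξ‖ = 2 * Real.pi * |inner ℝ ξ v| := by
    simp [derivSymbol, abs_of_pos Real.pi_pos]
  rw [this]
  gcongr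
  exact abs_real_inner_le_norm ξ v

lemma hasTemperateGrowth_derivSymbol (v : E3) : (derivSymbol v).HasTemperateGrowth := by
  unfold derivSymbol
  have : (fun ξ : E3 => ((inner ℝ ξ v : ℝ) : ℂ)).HasTemperateGrowth :=
    Function.Complex.hasTemperateGrowth_ofReal.comp (Function.hasTemperateGrowth_inner_left v)
  fun_prop

lemma continuous_derivSymbol (v : E3) : Continuous (derivSymbol v) :=
  (hasTemperateGrowth_derivSymbol v).1.continuous

lemma bddMeas_derivSymbol_mul_resSymbol {z : ℂ} (hz : z.im ≠ 0) (v : E3) :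
    BddMeas fun ξ => derivSymbol v ξ * resSymbol z ξ := by
  refine ⟨((continuous_derivSymbol v).mul (continuous_resSymbol hz)).measurable,
    2 * Real.pi * ‖v‖ * (|z.im|⁻¹ + (1 + ‖z‖ * |z.im|⁻¹)), fun ξ => ?_⟩
  have h1 : ‖resSymbol z ξ‖ ≤ |z.im|⁻¹ := norm_inv_sub_le hz _
  have h2 : 4 * Real.pi ^ 2 * ‖ξ‖ ^ 2 * ‖resSymbol z ξ‖ ≤ 1 + ‖z‖ * |z.im|⁻¹ := by
    have : (((4 * Real.pi ^ 2 * ‖ξ‖ ^ 2 : ℝ) : ℂ)) * resSymbol z ξ = 1 + z * resSymbol z ξ := by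
      have := mul_resSymbol hz ξ
      linear_combination this
    have h3 := congrArg norm this
    rw [norm_mul, Complex.norm_real, Real.norm_eq_abs, abs_of_nonneg (by positivity)] at h3
    rw [h3]
    refine (norm_add_le _ _).trans ?_
    rw [norm_one, norm_mul]
    gcongr
  have h3 : ‖ξ‖ ≤ 1 + 4 * Real.pi ^ 2 * ‖ξ‖ ^ 2 := by
    have h4 : (1 : ℝ) ≤ 4 * Real.pi ^ 2 := by nlinarith [Real.pi_gt_three]
    nlinarith [mul_le_mul_of_nonneg_right h4 (sq_nonneg ‖ξ‖), sq_nonneg (‖ξ‖ - 1)]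
  rw [norm_mul]
  calc ‖derivSymbol v ξ‖ * ‖resSymbol z ξ‖ ≤ 2 * Real.pi * (‖ξ‖ * ‖v‖) * ‖resSymbol z ξ‖ := by
        gcongr
        exact norm_derivSymbol_le v ξ
    _ = 2 * Real.pi * ‖v‖ * (‖ξ‖ * ‖resSymbol z ξ‖) := by ring
    _ ≤ _ := by
        gcongr
        calc ‖ξ‖ * ‖resSymbol z ξ‖ ≤ (1 + 4 * Real.pi ^ 2 * ‖ξ‖ ^ 2) * ‖resSymbol z ξ‖ := by gcongr
          _ ≤ _ := by linarith

lemma hasTemperateGrowth_inv_sub {z : ℂ} (hz : z.im ≠ 0) :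
    (fun t : ℝ => ((t : ℂ) - z)⁻¹).HasTemperateGrowth := by
  have hne := resSymbol_ne hz
  have hsm : ContDiff ℝ (⊤ : ℕ∞) (fun t : ℝ => ((t : ℂ) - z)⁻¹) :=
    (Complex.ofRealCLM.contDiff.sub contDiff_const).inv hne
  have hd : ∀ n : ℕ, iteratedDeriv n (fun t : ℝ => ((t : ℂ) - z)⁻¹)
      = fun t : ℝ => (-1) ^ n * (n.factorial : ℂ) * (((t : ℂ) - z)⁻¹) ^ (n + 1) := by
    intro n
    induction n with
    | zero => ext t; simp
    | succ n ih =>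
      rw [iteratedDeriv_succ, ih]
      ext t
      have h0 : HasDerivAt (fun t : ℝ => (t : ℂ) - z) 1 t :=
        (Complex.ofRealCLM.hasDerivAt (x := t)).sub_const z
      have h1 := ((h0.inv (hne t)).pow (n + 1)).const_mul ((-1) ^ n * (n.factorial : ℂ))
      have h2 := h1.deriv
      simp only [Pi.pow_apply, Pi.inv_apply] at h2
      refine Eq.trans ?_ (h2.trans ?_)
      · rfl
      · rw [div_eq_mul_inv, ← inv_pow, Nat.add_sub_cancel]
        push_cast [Nat.factorial_succ]
        ring
  refine ⟨hsm, fun n => ⟨0, n.factorial * (|z.im|⁻¹) ^ (n + 1), fun t => ?_⟩⟩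
  rw [norm_iteratedFDeriv_eq_norm_iteratedDeriv, hd, norm_mul, norm_mul, norm_pow, norm_pow]
  simp only [norm_neg, norm_one, one_pow, one_mul, Complex.norm_natCast, pow_zero, mul_one]
  gcongr
  exact norm_inv_sub_le hz t

lemma hasTemperateGrowth_resSymbol {z : ℂ} (hz : z.im ≠ 0) : (resSymbol z).HasTemperateGrowth := by
  have h : (fun ξ : E3 => 4 * Real.pi ^ 2 * ‖ξ‖ ^ 2).HasTemperateGrowth := by
    have := Function.hasTemperateGrowth_norm_sq E3
    fun_prop
  exact (hasTemperateGrowth_inv_sub hz).comp h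

/-! ### Derivatives of Fourier multipliers -/

lemma lineDeriv_eq_multiplier (v : E3) (f : 𝓢(E3, ℂ)) :
    ∂_{v} f = SchwartzMap.fourierMultiplierCLM ℂ (derivSymbol v) f := by
  have hg : (fun ξ : E3 => ((inner ℝ ξ v : ℝ) : ℂ)).HasTemperateGrowth :=
    Function.Complex.hasTemperateGrowth_ofReal.comp (Function.hasTemperateGrowth_inner_left v)
  have h := SchwartzMap.fourierMultiplierCLM_smul (F := ℂ) hg (2 * Real.pi * Complex.I)
  have h2 : derivSymbol v
      = (2 * Real.pi * Complex.I : ℂ) • fun ξ : E3 => ((inner ℝ ξ v : ℝ) : ℂ) := by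
    ext ξ
    simp [derivSymbol]
  rw [SchwartzMap.lineDeriv_eq_fourierMultiplierCLM,
    ← SchwartzMap.fourierMultiplierCLM_ofReal ℂ (by fun_prop), h2, h]
  rfl

lemma laplacian_eq_multiplier (f : 𝓢(E3, ℂ)) :
    -(Laplacian.laplacian f) = SchwartzMap.fourierMultiplierCLM ℂ
      (fun ξ : E3 => ((4 * Real.pi ^ 2 * ‖ξ‖ ^ 2 : ℝ) : ℂ)) f := by
  have h0 := Function.hasTemperateGrowth_norm_sq E3
  have hg : (fun ξ : E3 => ((‖ξ‖ ^ 2 : ℝ) : ℂ)).HasTemperateGrowth :=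
    Function.Complex.hasTemperateGrowth_ofReal.comp h0
  have h := SchwartzMap.fourierMultiplierCLM_smul (F := ℂ) hg (4 * Real.pi ^ 2)
  have h2 : (fun ξ : E3 => ((4 * Real.pi ^ 2 * ‖ξ‖ ^ 2 : ℝ) : ℂ))
      = (4 * Real.pi ^ 2 : ℂ) • fun ξ : E3 => ((‖ξ‖ ^ 2 : ℝ) : ℂ) := by
    ext ξ
    simp
  rw [SchwartzMap.laplacian_eq_fourierMultiplierCLM,
    ← SchwartzMap.fourierMultiplierCLM_ofReal ℂ h0, h2, h, neg_smul, neg_neg]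
  ext x
  simp only [smul_apply, Complex.real_smul, smul_eq_mul]
  push_cast
  ring_nf
  rfl

/-! ### Exponential weights along a direction -/

/-- The weight `e^{-N arctan t}`. It is comparable to `1`, but its logarithmic derivative is
`-N / (1 + t²)`, so that large `N` makes it strongly decreasing on the scale `t ≲ 1`. -/
noncomputable def expW (N t : ℝ) : ℝ := Real.exp (-N * Real.arctan t)

/-- The weight `(1 + t²)^{-1/2} e^{-N arctan t}`. -/
noncomputable def expPsi (N t : ℝ) : ℝ := expW N t / Real.sqrt (1 + t ^ 2)

/-- The weight `(1 + t²)⁻¹ e^{-2N arctan t}`, the square of `expPsi`. -/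
noncomputable def expRho (N t : ℝ) : ℝ := expW N t ^ 2 / (1 + t ^ 2)

/-- The logarithmic derivative of `expRho`. -/
noncomputable def logDerivRho (N t : ℝ) : ℝ := -2 * (t + N) / (1 + t ^ 2)

/-- The quotient `ρ'' / ρ` for `ρ = expRho`. -/
noncomputable def quotRho (N t : ℝ) : ℝ :=
  (4 * (t + N) ^ 2 - 2 * (1 + t ^ 2) + 4 * t * (t + N)) / (1 + t ^ 2) ^ 2

lemma expW_pos (N t : ℝ) : 0 < expW N t := Real.exp_pos _

lemma expW_le {N : ℝ} (hN : 0 ≤ N) (t : ℝ) : expW N t ≤ Real.exp (2 * N) := by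
  refine Real.exp_le_exp.2 ?_
  nlinarith [Real.neg_pi_div_two_lt_arctan t, Real.pi_lt_four]

lemma le_expW {N : ℝ} (hN : 0 ≤ N) (t : ℝ) : Real.exp (-(2 * N)) ≤ expW N t := by
  refine Real.exp_le_exp.2 ?_
  nlinarith [Real.arctan_lt_pi_div_two t, Real.pi_lt_four]

lemma continuous_expW (N : ℝ) : Continuous (expW N) := by
  unfold expW
  have := Real.continuous_arctan
  fun_prop

lemma hasDerivAt_expW (N t : ℝ) : HasDerivAt (expW N) (-N / (1 + t ^ 2) * expW N t) t := by
  have := ((Real.hasDerivAt_arctan t).const_mul (-N)).exp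
  refine this.congr_deriv ?_
  rw [expW]
  ring

lemma hasDerivAt_expW_sq (N t : ℝ) :
    HasDerivAt (fun t => expW N t ^ 2) (-2 * N * expRho N t) t := by
  refine ((hasDerivAt_expW N t).pow 2).congr_deriv ?_
  rw [expRho]
  push_cast
  ring

lemma hasDerivAt_expRho (N t : ℝ) :
    HasDerivAt (expRho N) (logDerivRho N t * expRho N t) t := by
  have h0 : (1 + t ^ 2) ≠ 0 := by positivity
  have h1 : HasDerivAt (fun t : ℝ => 1 + t ^ 2) (2 * t) t := by
    simpa using ((hasDerivAt_id t).pow 2).const_add 1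
  refine ((hasDerivAt_expW_sq N t).div h1 h0).congr_deriv ?_
  rw [expRho, logDerivRho]
  field_simp
  ring

lemma hasDerivAt_logDerivRho_mul (N t : ℝ) :
    HasDerivAt (fun t => logDerivRho N t * expRho N t) (quotRho N t * expRho N t) t := by
  have h0 : (1 + t ^ 2) ≠ 0 := by positivity
  have h1 : HasDerivAt (fun t : ℝ => 1 + t ^ 2) (2 * t) t := by
    simpa using ((hasDerivAt_id t).pow 2).const_add 1
  have h2 : HasDerivAt (fun t : ℝ => -2 * (t + N)) (-2) t := by
    simpa using ((hasDerivAt_id t).add_const N).const_mul (-2)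
  refine ((h2.div h1 h0).mul (hasDerivAt_expRho N t)).congr_deriv ?_
  simp only [logDerivRho, quotRho, Pi.div_apply]
  field_simp
  ring

lemma continuous_quotRho (N : ℝ) : Continuous (quotRho N) := by
  unfold quotRho
  exact Continuous.div (by fun_prop) (by fun_prop) fun t => by positivity

lemma abs_quotRho_le {N : ℝ} (hN : 0 ≤ N) (t : ℝ) : |quotRho N t| ≤ 16 * (1 + N) ^ 2 := by
  have h0 : 0 < 1 + t ^ 2 := by positivity
  rw [quotRho, abs_div, abs_of_pos (by positivity : 0 < (1 + t ^ 2) ^ 2), div_le_iff₀ (by positivity)]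
  have h1 : |4 * (t + N) ^ 2 - 2 * (1 + t ^ 2) + 4 * t * (t + N)|
      ≤ 16 * (1 + N) ^ 2 * (1 + t ^ 2) := by
    rw [abs_le]
    constructor <;> nlinarith [sq_nonneg (t - N), sq_nonneg (t - 1), sq_nonneg (t + 1),
      mul_nonneg hN (sq_nonneg (t - 1)), mul_nonneg hN (sq_nonneg (t + 1)), mul_nonneg hN hN,
      mul_nonneg (mul_nonneg hN hN) (sq_nonneg t), mul_nonneg hN (sq_nonneg t)]
  refine h1.trans ?_
  have : (1 + t ^ 2) ≤ (1 + t ^ 2) ^ 2 := by nlinarith [sq_nonneg t]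
  gcongr

lemma abs_logDerivRho_le {N : ℝ} (hN : 0 ≤ N) (t : ℝ) : |logDerivRho N t| ≤ 2 * (1 + N) := by
  rw [logDerivRho, abs_div, abs_of_pos (by positivity : 0 < 1 + t ^ 2), div_le_iff₀ (by positivity),
    abs_le]
  constructor <;> nlinarith [sq_nonneg (t - 1), sq_nonneg (t + 1), mul_nonneg hN (sq_nonneg t)]

lemma expRho_pos (N t : ℝ) : 0 < expRho N t := by
  have := expW_pos N t
  unfold expRho
  positivity

lemma expPsi_pos (N t : ℝ) : 0 < expPsi N t := by
  have := expW_pos N t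
  unfold expPsi
  positivity

lemma expPsi_sq (N t : ℝ) : expPsi N t * expPsi N t = expRho N t := by
  rw [expPsi, expRho, div_mul_div_comm, Real.mul_self_sqrt (by positivity), sq (expW N t)]

lemma expPsi_le_expW (N t : ℝ) : expPsi N t ≤ expW N t :=
  div_le_self (expW_pos N t).le (Real.one_le_sqrt.2 (by nlinarith [sq_nonneg t]))

lemma expRho_le_expW_sq (N t : ℝ) : expRho N t ≤ expW N t ^ 2 :=
  div_le_self (by positivity) (by nlinarith [sq_nonneg t])

lemma continuous_expPsi (N : ℝ) : Continuous (expPsi N) :=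
  (continuous_expW N).div (by fun_prop) fun t => by positivity

lemma continuous_expRho (N : ℝ) : Continuous (expRho N) :=
  ((continuous_expW N).pow 2).div (by fun_prop) fun t => by positivity

lemma bddCont_expW {N : ℝ} (hN : 0 ≤ N) : BddCont (expW N) :=
  ⟨continuous_expW N, _, fun t => by rw [abs_of_pos (expW_pos N t)]; exact expW_le hN t⟩

lemma bddCont_expW_sq {N : ℝ} (hN : 0 ≤ N) : BddCont fun t => expW N t ^ 2 :=
  ⟨(continuous_expW N).pow 2, Real.exp (2 * N) ^ 2, fun t => by
    rw [abs_of_pos (pow_pos (expW_pos N t) 2)]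
    exact pow_le_pow_left₀ (expW_pos N t).le (expW_le hN t) 2⟩

lemma bddCont_expPsi {N : ℝ} (hN : 0 ≤ N) : BddCont (expPsi N) :=
  ⟨continuous_expPsi N, _, fun t => by
    rw [abs_of_pos (expPsi_pos N t)]; exact (expPsi_le_expW N t).trans (expW_le hN t)⟩

lemma bddCont_expRho {N : ℝ} (hN : 0 ≤ N) : BddCont (expRho N) :=
  ⟨continuous_expRho N, Real.exp (2 * N) ^ 2, fun t => by
    rw [abs_of_pos (expRho_pos N t)]
    exact (expRho_le_expW_sq N t).trans (pow_le_pow_left₀ (expW_pos N t).le (expW_le hN t) 2)⟩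

lemma BddCont.mul {V W : ℝ → ℝ} (hV : BddCont V) (hW : BddCont W) : BddCont fun t => V t * W t := by
  obtain ⟨C, hC⟩ := hV.bdd
  obtain ⟨C', hC'⟩ := hW.bdd
  refine ⟨hV.cont.mul hW.cont, C * C', fun t => ?_⟩
  rw [abs_mul]
  exact mul_le_mul (hC t) (hC' t) (abs_nonneg _) ((abs_nonneg _).trans (hC t))

lemma bddCont_quotRho {N : ℝ} (hN : 0 ≤ N) : BddCont (quotRho N) :=
  ⟨continuous_quotRho N, _, abs_quotRho_le hN⟩

lemma bddCont_logDerivRho {N : ℝ} (hN : 0 ≤ N) : BddCont (logDerivRho N) := by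
  refine ⟨?_, _, abs_logDerivRho_le hN⟩
  unfold logDerivRho
  exact Continuous.div (by fun_prop) (by fun_prop) fun t => by positivity

lemma dirOp_dirOp {V W : ℝ → ℝ} (hV : BddCont V) (hW : BddCont W) (ω : E3) (f : L2) :
    dirOp ω V (dirOp ω W f) = dirOp ω (fun t => V t * W t) f := by
  rw [dirOp, dirOp, dirOp, mulOp_mulOp (hV.bddMeas ω) (hW.bddMeas ω)]
  push_cast
  rfl

lemma inner_dirOp_rho {N : ℝ} (hN : 0 ≤ N) (ω : E3) (f g : L2) :
    inner ℂ f (dirOp ω (expRho N) g) = inner ℂ (dirOp ω (expPsi N) f) (dirOp ω (expPsi N) g) := by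
  rw [inner_dirOp_left (bddCont_expPsi hN), dirOp_dirOp (bddCont_expPsi hN) (bddCont_expPsi hN)]
  simp only [expPsi_sq]

lemma abs_arctan_sub_le (s t : ℝ) : |Real.arctan s - Real.arctan t| ≤ |s - t| := by
  have h := Convex.norm_image_sub_le_of_norm_hasDerivWithin_le (f := Real.arctan)
    (f' := fun t => 1 / (1 + t ^ 2)) (s := Set.univ) (C := 1) (x := t) (y := s)
    (fun t _ => (Real.hasDerivAt_arctan t).hasDerivWithinAt) (fun t _ => by
      rw [Real.norm_eq_abs, abs_of_nonneg (by positivity)]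
      exact div_le_one_of_le₀ (by nlinarith [sq_nonneg t]) (by positivity)) convex_univ
    (Set.mem_univ _) (Set.mem_univ _)
  simpa using h

/-- `expPsi` varies slowly: its relative variation over a distance `d` is `O(d + d²)`. -/
lemma expPsi_le {N : ℝ} (hN : 0 ≤ N) (s t : ℝ) :
    expPsi N t ≤ expPsi N s * (1 + (1 + N * Real.exp (4 * N)) * |t - s|
      + (1 + N * Real.exp (4 * N)) * |t - s| ^ 2) := by
  set d := |t - s| with hd
  have hd0 : 0 ≤ d := abs_nonneg _
  set K := N * Real.exp (4 * N) with hK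
  have hK0 : 0 ≤ K := by positivity
  have h1 : expW N t ≤ expW N s * (1 + K * d) := by
    set x := N * (Real.arctan s - Real.arctan t)
    have e : expW N t = expW N s * Real.exp x := by
      rw [expW, expW, ← Real.exp_add]; congr 1; ring
    rw [e]
    refine mul_le_mul_of_nonneg_left ?_ (expW_pos N s).le
    have hx : x ≤ N * d := by
      refine mul_le_mul_of_nonneg_left ?_ hN
      rw [hd, abs_sub_comm]
      exact (le_abs_self _).trans (abs_arctan_sub_le s t)
    have hx4 : x ≤ 4 * N := by
      have : Real.arctan s - Real.arctan t ≤ 4 := by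
        linarith [Real.arctan_lt_pi_div_two s, Real.neg_pi_div_two_lt_arctan t, Real.pi_lt_four]
      nlinarith
    rcases le_total x 0 with h | h
    · calc Real.exp x ≤ 1 := Real.exp_le_one_iff.2 h
        _ ≤ 1 + K * d := by nlinarith [mul_nonneg hK0 hd0]
    · have h2 : Real.exp x ≤ 1 + x * Real.exp x := by
        have h3 := Real.add_one_le_exp (-x)
        have h4 : Real.exp x * Real.exp (-x) = 1 := by rw [← Real.exp_add]; simp
        nlinarith [Real.exp_pos x]
      have h3 : x * Real.exp x ≤ (N * d) * Real.exp (4 * N) := by gcongr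
      calc Real.exp x ≤ 1 + x * Real.exp x := h2
        _ ≤ 1 + (N * d) * Real.exp (4 * N) := by linarith
        _ = _ := by rw [hK]; ring
  have h2 : Real.sqrt (1 + s ^ 2) ≤ Real.sqrt (1 + t ^ 2) * (1 + d) := by
    have hs : Real.sqrt (1 + t ^ 2) ^ 2 = 1 + t ^ 2 := Real.sq_sqrt (by positivity)
    have ht : |t| ≤ Real.sqrt (1 + t ^ 2) := by
      rw [← Real.sqrt_sq_eq_abs]; exact Real.sqrt_le_sqrt (by linarith)
    have hsd : |s| ≤ |t| + d := by
      have := abs_sub_abs_le_abs_sub s t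
      rw [hd, abs_sub_comm t s]; linarith
    refine Real.sqrt_le_iff.2 ⟨by positivity, ?_⟩
    rw [mul_pow, hs]
    have h5 : s ^ 2 ≤ (|t| + d) ^ 2 := by rw [← sq_abs s]; gcongr
    have h6 : 2 * |t| ≤ 2 * (1 + t ^ 2) := by nlinarith [sq_nonneg (|t| - 1), sq_abs t, abs_nonneg t]
    nlinarith [sq_abs t, mul_nonneg hd0 (sub_nonneg.2 h6), mul_nonneg (sq_nonneg d) (sq_nonneg t)]
  have hst : 0 < Real.sqrt (1 + t ^ 2) := by positivity
  have hss : 0 < Real.sqrt (1 + s ^ 2) := by positivity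
  have hWs := expW_pos N s
  calc expPsi N t ≤ expW N s * (1 + K * d) / Real.sqrt (1 + t ^ 2) := by
        unfold expPsi; gcongr
    _ ≤ expW N s / Real.sqrt (1 + s ^ 2) * ((1 + d) * (1 + K * d)) := by
        rw [div_mul_eq_mul_div, div_le_div_iff₀ hst hss]
        calc expW N s * (1 + K * d) * Real.sqrt (1 + s ^ 2)
            ≤ expW N s * (1 + K * d) * (Real.sqrt (1 + t ^ 2) * (1 + d)) := by gcongr
          _ = _ := by ring
    _ ≤ _ := by
        refine mul_le_mul_of_nonneg_left ?_ (expPsi_pos N s).le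
        nlinarith [mul_nonneg hK0 hd0, sq_nonneg d]

/-- `e^{-2N arctan t}` is Lipschitz. -/
lemma abs_expW_sq_sub_le {N : ℝ} (hN : 0 ≤ N) (s t : ℝ) :
    |expW N s ^ 2 - expW N t ^ 2| ≤ 2 * N * Real.exp (2 * N) ^ 2 * |s - t| := by
  have h := Convex.norm_image_sub_le_of_norm_hasDerivWithin_le (f := fun t => expW N t ^ 2)
    (f' := fun t => -2 * N * expRho N t) (s := Set.univ) (C := 2 * N * Real.exp (2 * N) ^ 2)
    (x := t) (y := s)
    (fun t _ => (hasDerivAt_expW_sq N t).hasDerivWithinAt) (fun t _ => by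
      rw [Real.norm_eq_abs, abs_mul, abs_mul, abs_of_pos (expRho_pos N t), abs_of_nonneg hN]
      norm_num
      gcongr
      exact (expRho_le_expW_sq N t).trans (pow_le_pow_left₀ (expW_pos N t).le (expW_le hN t) 2))
    convex_univ (Set.mem_univ _) (Set.mem_univ _)
  simpa using h

/-! ### The directional resolvent estimate -/

/-- Auxiliary symbols for the cone around the direction `ω` that contains the support of `χ`: they
invert `ξ · ω`, express `ξ` through `ξ · ω`, and factor `ξ · ω` as the square of a real symbol,
all on the support of `χ`. -/
structure ConeSymbols (ω : E3) (χ : 𝓢(E3, ℂ)) where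
  /-- A symbol equal to `1 / (ξ · ω)` on the support of `χ`. -/
  inv : 𝓢(E3, ℂ)
  /-- Symbols equal to `ξ_a / (ξ · ω)` on the support of `χ`. -/
  ratio : Fin 3 → 𝓢(E3, ℂ)
  /-- A real symbol equal to `(ξ · ω)^{1/2}` on the support of `χ`. -/
  root : 𝓢(E3, ℂ)
  inv_mul : ∀ ξ, χ ξ ≠ 0 → inv ξ * (inner ℝ ξ ω : ℝ) = 1
  ratio_mul : ∀ a ξ, χ ξ ≠ 0 → ratio a ξ * (inner ℝ ξ ω : ℝ) = (ξ a : ℝ)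
  root_sq : ∀ ξ, χ ξ ≠ 0 → root ξ * root ξ = (inner ℝ ξ ω : ℝ)
  star_root : ∀ ξ, star (root ξ) = root ξ

/-- The flux `⟨iU, W ∂_ω U⟩` is nonnegative, for `U` frequency localized to a cone around `ω`, once
the frequency scale `μ` is large: `∂_ω = 2πiμ B²` with `B` self-adjoint, and `B` almost commutes
with the weight. -/
lemma exists_flux_nonneg {ω : E3} (hω : ‖ω‖ = 1) {χ : 𝓢(E3, ℂ)} (S : ConeSymbols ω χ) {N : ℝ}
    (hN : 0 ≤ N) :
    ∃ μ₀ : ℝ, 0 < μ₀ ∧ ∀ μ, μ₀ ≤ μ → ∀ u d : L2,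
      d = (2 * Real.pi * Complex.I * μ) • fm (scaledSymbol μ S.root) (fm (scaledSymbol μ S.root) u) →
      u = fm (scaledSymbol μ S.inv) (fm (scaledSymbol μ S.root) (fm (scaledSymbol μ S.root) u)) →
      0 ≤ (inner ℂ (Complex.I • u) (dirOp ω (fun t => expW N t ^ 2) d)).re := by
  set L : ℝ := 2 * N * Real.exp (2 * N) ^ 2 with hL
  set K : ℝ := kernelMoment 0 S.inv * kernelMoment 0 S.root with hK
  set K1 := kernelMoment 1 S.root with hK1
  have hK0 : 0 ≤ K := mul_nonneg (kernelMoment_nonneg _ _) (kernelMoment_nonneg _ _)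
  have hK10 : 0 ≤ K1 := kernelMoment_nonneg _ _
  have hL0 : 0 ≤ L := by positivity
  refine ⟨L * K1 * K * Real.exp (2 * N) ^ 2 + 1, by positivity, fun μ hμ u d hd hu => ?_⟩
  have hμ0 : 0 < μ := lt_of_lt_of_le (by positivity) hμ
  set B := fm (scaledSymbol μ S.root) with hB
  set W := dirOp ω (fun t => expW N t ^ 2) with hW
  set v := B u with hv
  have hWb := bddCont_expW_sq hN
  have hcomm : ∀ f, ‖B (W f) - W (B f)‖ ≤ L * (K1 / μ) * ‖f‖ := by
    refine norm_commutator_fm_scaledSymbol_le hμ0 S.root (hWb.bddMeas ω) hL0 fun x y => ?_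
    rw [← Complex.ofReal_sub, Complex.norm_real, Real.norm_eq_abs]
    refine (abs_expW_sq_sub_le hN _ _).trans ?_
    rw [← inner_sub_right]
    refine mul_le_mul_of_nonneg_left ?_ hL0
    simpa [hω] using abs_real_inner_le_norm ω (x - y)
  have hnorm : ∀ (q : 𝓢(E3, ℂ)) (f : L2), ‖fm (scaledSymbol μ q) f‖ ≤ kernelMoment 0 q * ‖f‖ := by
    intro q f
    obtain ⟨κ, h, h'⟩ := exists_kerBound_scaledKernel hμ0 q
    rw [fm_scaledSymbol_eq_kerOp hμ0, ← h']
    exact (kerOp _).le_of_opNorm_le h.norm_kerOp_le _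
  have hu' : ‖u‖ ≤ K * ‖v‖ := by
    rw [hu, hK, mul_assoc]
    exact (hnorm _ _).trans (mul_le_mul_of_nonneg_left (hnorm _ _) (kernelMoment_nonneg _ _))
  -- self-adjointness of `B`
  have hsa : ∀ f g : L2, inner ℂ (B f) g = inner ℂ f (B g) := by
    intro f g
    rw [hB, inner_fm_left (bddMeas_scaledSymbol hμ0 _)]
    simp only [scaledSymbol, S.star_root]
    rfl
  have h1 : (inner ℂ (Complex.I • u) (W d)).re = 2 * Real.pi * μ * (inner ℂ u (W (B v))).re := by
    rw [hd, map_smul, inner_smul_left, inner_smul_right, Complex.conj_I]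
    have : -Complex.I * (2 * Real.pi * Complex.I * μ * inner ℂ u (W (B v)))
        = ((2 * Real.pi * μ : ℝ) : ℂ) * inner ℂ u (W (B v)) := by
      push_cast
      linear_combination (-(2 * Real.pi * μ) * inner ℂ u (W (B v)) : ℂ) * Complex.I_mul_I
    rw [this, Complex.re_ofReal_mul]
  have h2 : (inner ℂ u (W (B v))).re = (inner ℂ v (W v)).re - (inner ℂ u (B (W v) - W (B v))).re := by
    rw [inner_sub_right, ← hsa, Complex.sub_re]
    ring
  have h3 : Real.exp (-(2 * N)) ^ 2 * ‖v‖ ^ 2 ≤ (inner ℂ v (W v)).re := by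
    have hE := bddCont_expW hN
    have e1 : inner ℂ v (W v) = inner ℂ (dirOp ω (expW N) v) (dirOp ω (expW N) v) := by
      rw [inner_dirOp_left hE, dirOp_dirOp hE hE, hW]
      simp only [sq]
    have e2 : ‖v‖ ≤ Real.exp (2 * N) * ‖dirOp ω (expW N) v‖ := by
      refine Lp.norm_le_mul_norm_of_ae_le_mul ?_
      filter_upwards [mulOp_ae (hE.bddMeas ω) v] with x hx
      rw [dirOp, hx, norm_mul, Complex.norm_real, Real.norm_eq_abs, abs_of_pos (expW_pos _ _),
        ← mul_assoc]
      refine le_mul_of_one_le_left (norm_nonneg _) ?_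
      calc (1 : ℝ) = Real.exp (2 * N) * Real.exp (-(2 * N)) := by rw [← Real.exp_add]; simp
        _ ≤ _ := by gcongr; exact le_expW hN _
    rw [e1, inner_self_eq_norm_sq_to_K]
    have e3 : ((‖dirOp ω (expW N) v‖ : ℂ) ^ 2).re = ‖dirOp ω (expW N) v‖ ^ 2 := by
      rw [← Complex.ofReal_pow, Complex.ofReal_re]
    refine le_trans ?_ e3.ge
    rw [← mul_pow]
    gcongr
    rw [Real.exp_neg, inv_mul_le_iff₀ (Real.exp_pos _)]
    exact e2
  have h4 : (inner ℂ u (B (W v) - W (B v))).re ≤ K * ‖v‖ * (L * (K1 / μ) * ‖v‖) := by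
    refine (Complex.re_le_norm _).trans ((norm_inner_le_norm _ _).trans ?_)
    exact mul_le_mul hu' (hcomm v) (norm_nonneg _) (by positivity)
  have h5 : K * (L * (K1 / μ)) ≤ Real.exp (-(2 * N)) ^ 2 := by
    rw [Real.exp_neg, inv_pow, ← one_div, le_div_iff₀ (by positivity)]
    have : K * (L * (K1 / μ)) * Real.exp (2 * N) ^ 2 = (L * K1 * K * Real.exp (2 * N) ^ 2) / μ := by
      ring
    rw [this, div_le_one hμ0]
    linarith
  rw [h1, h2]
  refine mul_nonneg (by positivity [Real.pi_pos]) ?_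
  nlinarith [mul_le_mul_of_nonneg_right h5 (sq_nonneg ‖v‖)]

set_option maxHeartbeats 1600000 in
/-- The directional resolvent estimate. Functions `F` localized in frequency to a cone around `ω`
satisfy a weighted bound for `∇R₀(λ² + iη)F`, `λ = 2πμ`, which gains `1/N` from the weight
`e^{-N arctan(x·ω)}`, uniformly in `η > 0` and `μ ≥ μ₀(N)`. -/
theorem exists_directional_estimate {ω : E3} (hω : ‖ω‖ = 1) {χ : 𝓢(E3, ℂ)} (S : ConeSymbols ω χ) :
    ∃ C : ℝ, 0 < C ∧ ∀ N : ℝ, 1 ≤ N → ∃ μ₀ : ℝ, 1 ≤ μ₀ ∧ ∀ μ, μ₀ ≤ μ → ∀ η : ℝ, 0 < η →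
      ∀ z : ℂ, z = ((2 * Real.pi * μ : ℝ) : ℂ) ^ 2 + Complex.I * η → ∀ (F₀ : 𝓢(E3, ℂ)) (G : L2),
      fm (scaledSymbol μ χ) (toH F₀) = mulOp (weight (-1)) G →
      (∀ a, ‖dirOp ω (expPsi N) (fm (fun ξ => derivSymbol (basisVec a) ξ * resSymbol z ξ
          * scaledSymbol μ χ ξ) (toH F₀))‖ ≤ C / N * ‖dirOp ω (expW N) G‖) ∧
      ‖dirOp ω (expPsi N) (fm (fun ξ => resSymbol z ξ * scaledSymbol μ χ ξ) (toH F₀))‖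
        ≤ C / (N * μ) * ‖dirOp ω (expW N) G‖ := by
  set C₁ : ℝ := ∑ a, kernelMoment 0 (S.ratio a) + 1 with hC₁
  set C₂ : ℝ := kernelMoment 0 S.inv + 1 with hC₂
  have m0 : ∀ q : 𝓢(E3, ℂ), 0 ≤ kernelMoment 0 q := kernelMoment_nonneg 0
  have hC₁0 : 1 ≤ C₁ := by
    have : 0 ≤ ∑ a, kernelMoment 0 (S.ratio a) := Finset.sum_nonneg fun a _ => m0 _
    linarith
  have hC₂0 : 1 ≤ C₂ := by linarith [m0 S.inv]
  refine ⟨C₁ + C₂, by linarith, fun N hN => ?_⟩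
  have hN0 : 0 ≤ N := by linarith
  obtain ⟨μ₁, hμ₁, hflux⟩ := exists_flux_nonneg hω S hN0
  set L : ℝ := 1 + N * Real.exp (4 * N) with hL
  have hL0 : 0 ≤ L := by positivity
  -- a bound for the weighted corrections of all auxiliary multipliers
  set M : ℝ := L * (kernelMoment 1 S.inv + kernelMoment 2 S.inv
    + ∑ a, (kernelMoment 1 (S.ratio a) + kernelMoment 2 (S.ratio a))) with hM
  have m1 : ∀ (j : ℕ) (q : 𝓢(E3, ℂ)), 0 ≤ kernelMoment j q := kernelMoment_nonneg
  have hM0 : 0 ≤ M := by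
    refine mul_nonneg hL0 ?_
    have : 0 ≤ ∑ a, (kernelMoment 1 (S.ratio a) + kernelMoment 2 (S.ratio a)) :=
      Finset.sum_nonneg fun a _ => add_nonneg (m1 _ _) (m1 _ _)
    linarith [m1 1 S.inv, m1 2 S.inv]
  refine ⟨μ₁ + 1 + M + 2 * C₂ * N + 16 * (1 + N) ^ 2 * C₂ ^ 2, ?_, fun μ hμ η hη z hz F₀ G hG => ?_⟩
  · have h1 : 0 ≤ 2 * C₂ * N := by positivity
    have h2 : 0 ≤ 16 * (1 + N) ^ 2 * C₂ ^ 2 := by positivity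
    linarith
  have hCN : 0 ≤ 2 * C₂ * N := by positivity
  have hbig : 0 ≤ 16 * (1 + N) ^ 2 * C₂ ^ 2 := by positivity
  have hμ1 : 1 ≤ μ := by linarith
  have hμ0 : 0 < μ := by linarith
  have hμM : M ≤ μ := by linarith
  have hzim : z.im ≠ 0 := by
    have h0 : (((2 * Real.pi * μ : ℝ) : ℂ) ^ 2).im = 0 := by
      rw [← Complex.ofReal_pow]
      exact Complex.ofReal_im _
    rw [hz, Complex.add_im, h0, Complex.I_mul_im, Complex.ofReal_re, zero_add]
    exact hη.ne'
  have tχ := hasTemperateGrowth_scaledSymbol hμ0 χ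
  have bχ := bddMeas_scaledSymbol hμ0 χ
  have tr := hasTemperateGrowth_resSymbol hzim
  have br := bddMeas_resSymbol hzim
  set m : E3 → ℂ := fun ξ => resSymbol z ξ * scaledSymbol μ χ ξ with hm
  have tm : m.HasTemperateGrowth := tr.mul tχ
  have bm : BddMeas m := br.mul bχ
  have bd : ∀ v, BddMeas fun ξ => derivSymbol v ξ * m ξ := fun v => by
    have := (bddMeas_derivSymbol_mul_resSymbol hzim v).mul bχ
    simpa only [hm, mul_assoc] using this
  set U := SchwartzMap.fourierMultiplierCLM ℂ m F₀ with hU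
  set F := SchwartzMap.fourierMultiplierCLM ℂ (scaledSymbol μ χ) F₀ with hF
  set u : L2 := toH U with hu
  set d : L2 := toH (∂_{ω} U) with hd
  have hFH : toH F = mulOp (weight (-1)) G := by rw [← hG, fm_toH bχ tχ]
  have uE : u = fm m (toH F₀) := (fm_toH bm tm F₀).symm
  have dE : ∀ v, toH (∂_{v} U) = fm (fun ξ => derivSymbol v ξ * m ξ) (toH F₀) := by
    intro v
    have td := hasTemperateGrowth_derivSymbol v
    rw [lineDeriv_eq_multiplier, hU,
      SchwartzMap.fourierMultiplierCLM_fourierMultiplierCLM_apply td tm, fm_toH (bd v) (td.mul tm)]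
    rfl
  -- the equation
  have heq : -(Laplacian.laplacian U) = F + (((2 * Real.pi * μ : ℝ) : ℂ) ^ 2 + Complex.I * η) • U := by
    have tl : (fun ξ : E3 => ((4 * Real.pi ^ 2 * ‖ξ‖ ^ 2 : ℝ) : ℂ)).HasTemperateGrowth := by
      have h0 := Function.hasTemperateGrowth_norm_sq E3
      exact Function.Complex.hasTemperateGrowth_ofReal.comp (by fun_prop)
    have e1 : (fun ξ : E3 => ((4 * Real.pi ^ 2 * ‖ξ‖ ^ 2 : ℝ) : ℂ)) * m
        = scaledSymbol μ χ + z • m := by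
      ext ξ
      have := mul_resSymbol hzim ξ
      simp only [Pi.mul_apply, Pi.add_apply, Pi.smul_apply, smul_eq_mul, hm]
      linear_combination scaledSymbol μ χ ξ * this
    have e2 : SchwartzMap.fourierMultiplierCLM ℂ (scaledSymbol μ χ + z • m) F₀
        = F + z • U := by
      have tzm : (z • m).HasTemperateGrowth := by
        have : (fun _ : E3 => z).HasTemperateGrowth := Function.HasTemperateGrowth.const z
        exact this.mul tm
      have e3 := SchwartzMap.smulLeftCLM_add (F := ℂ) tχ tzm
      rw [SchwartzMap.fourierMultiplierCLM_apply, e3, SchwartzMap.smulLeftCLM_smul tm]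
      simp only [hF, hU, SchwartzMap.fourierMultiplierCLM_apply]
      rw [add_apply, smul_apply, FourierTransform.fourierInv_add, FourierTransform.fourierInv_smul]
    rw [laplacian_eq_multiplier, hU,
      SchwartzMap.fourierMultiplierCLM_fourierMultiplierCLM_apply tl tm, e1, e2, ← hz]
  -- the multiplier identities on the cone
  have hsc : ∀ ξ : E3, (inner ℝ ξ ω : ℝ) = μ * inner ℝ (μ⁻¹ • ξ) ω := fun ξ => by
    rw [inner_smul_left]; simp [mul_inv_cancel_left₀ hμ0.ne']
  have idRatio : ∀ a, toH (∂_{basisVec a} U) = fm (scaledSymbol μ (S.ratio a)) d := by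
    intro a
    rw [hd, dE, dE, fm_fm (bddMeas_scaledSymbol hμ0 _) (bd _)]
    congr 2
    ext ξ
    by_cases h0 : χ (μ⁻¹ • ξ) = 0
    · simp [hm, scaledSymbol, h0]
    · have h1 := S.ratio_mul a _ h0
      have h2 : derivSymbol (basisVec a) ξ
          = scaledSymbol μ (S.ratio a) ξ * derivSymbol ω ξ := by
        rw [derivSymbol, derivSymbol, inner_basisVec, hsc, scaledSymbol]
        have h3 : ((ξ a : ℝ) : ℂ) = μ * (((μ⁻¹ • ξ) a : ℝ) : ℂ) := by
          rw [PiLp.smul_apply, smul_eq_mul, ← Complex.ofReal_mul, mul_inv_cancel_left₀ hμ0.ne']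
        rw [h3, ← h1]
        push_cast
        ring
      rw [h2, mul_assoc]
  have idInv : u = ((2 * Real.pi * Complex.I * μ)⁻¹ : ℂ) • fm (scaledSymbol μ S.inv) d := by
    rw [hd, dE, uE, fm_fm (bddMeas_scaledSymbol hμ0 _) (bd _),
      ← fm_smul ((bddMeas_scaledSymbol hμ0 _).mul (bd _))]
    congr 2
    ext ξ
    by_cases h0 : χ (μ⁻¹ • ξ) = 0
    · simp [hm, scaledSymbol, h0]
    · have h1 := S.inv_mul _ h0
      have h2 : scaledSymbol μ S.inv ξ * derivSymbol ω ξ = 2 * Real.pi * Complex.I * μ := by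
        rw [derivSymbol, hsc, scaledSymbol]
        push_cast
        linear_combination (2 * Real.pi * Complex.I * μ) * h1
      rw [← mul_assoc (scaledSymbol μ S.inv ξ), h2, inv_mul_cancel_left₀]
      simp [Real.pi_ne_zero, hμ0.ne']
  have broot := bddMeas_scaledSymbol hμ0 S.root
  have idRoot : d = (2 * Real.pi * Complex.I * μ : ℂ) • fm (scaledSymbol μ S.root)
      (fm (scaledSymbol μ S.root) u) := by
    rw [hd, dE, uE, fm_fm broot bm, fm_fm broot (broot.mul bm), ← fm_smul (broot.mul (broot.mul bm))]
    congr 2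
    ext ξ
    by_cases h0 : χ (μ⁻¹ • ξ) = 0
    · simp [hm, scaledSymbol, h0]
    · have h1 : scaledSymbol μ S.root ξ * scaledSymbol μ S.root ξ = _ := S.root_sq _ h0
      rw [derivSymbol, hsc]
      push_cast
      linear_combination (-(2 * Real.pi * Complex.I * μ) * m ξ) * h1
  have hflux' : 0 ≤ (inner ℂ (Complex.I • u) (dirOp ω (fun t => expW N t ^ 2) d)).re := by
    refine hflux μ (by linarith) u d idRoot ?_
    have hne : (2 * Real.pi * Complex.I * μ : ℂ) ≠ 0 := by simp [Real.pi_ne_zero, hμ0.ne']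
    rw [idRoot, map_smul, smul_smul, inv_mul_cancel₀ hne, one_smul] at idInv
    exact idInv
  -- weighted bounds for the multipliers
  set X : ℝ := ‖dirOp ω (expPsi N) d‖ with hX
  have hX0 : 0 ≤ X := norm_nonneg _
  have hw : ∀ (q : 𝓢(E3, ℂ)), L * (kernelMoment 1 q + kernelMoment 2 q) ≤ M →
      ‖dirOp ω (expPsi N) (fm (scaledSymbol μ q) d)‖ ≤ (kernelMoment 0 q + 1) * X := by
    intro q hq
    refine (norm_mulOp_fm_scaledSymbol_le hμ0 q (ψ := fun x => expPsi N (inner ℝ ω x))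
      ((bddCont_expPsi hN0).cont.measurable.comp (by fun_prop)) (fun x => expPsi_pos _ _)
      (C := Real.exp (2 * N)) (fun x => (expPsi_le_expW _ _).trans (expW_le hN0 _)) hL0
      (fun x y => ?_) d).trans ?_
    · have h1 : |inner ℝ ω x - inner ℝ ω y| ≤ ‖x - y‖ := by
        rw [← inner_sub_right]
        simpa [hω] using abs_real_inner_le_norm ω (x - y)
      refine (expPsi_le hN0 (inner ℝ ω y) (inner ℝ ω x)).trans ?_
      refine mul_le_mul_of_nonneg_left ?_ (expPsi_pos _ _).le
      gcongr
    · refine mul_le_mul_of_nonneg_right ?_ hX0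
      have h1 : kernelMoment 1 q / μ ≤ kernelMoment 1 q / μ := le_rfl
      have h2 : kernelMoment 2 q / μ ^ 2 ≤ kernelMoment 2 q / μ := by
        gcongr
        · exact m1 _ _
        · nlinarith
      have h3 : L * (kernelMoment 1 q / μ) + L * (kernelMoment 2 q / μ ^ 2) ≤ 1 := by
        calc _ ≤ L * (kernelMoment 1 q / μ) + L * (kernelMoment 2 q / μ) := by gcongr
          _ = L * (kernelMoment 1 q + kernelMoment 2 q) / μ := by ring
          _ ≤ 1 := by rw [div_le_one hμ0]; linarith
      linarith
  have hY : ‖dirOp ω (expPsi N) u‖ ≤ C₂ / μ * X := by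
    have h1 := hw S.inv (by
      refine mul_le_mul_of_nonneg_left ?_ hL0
      have : 0 ≤ ∑ a, (kernelMoment 1 (S.ratio a) + kernelMoment 2 (S.ratio a)) :=
        Finset.sum_nonneg fun a _ => add_nonneg (m1 _ _) (m1 _ _)
      linarith)
    rw [idInv, map_smul, norm_smul, norm_inv]
    have h2 : ‖(2 * Real.pi * Complex.I * μ : ℂ)‖ = 2 * Real.pi * μ := by
      simp [abs_of_pos Real.pi_pos, abs_of_pos hμ0]
    rw [h2]
    have h3 : (2 * Real.pi * μ)⁻¹ ≤ μ⁻¹ := by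
      refine inv_anti₀ hμ0 ?_
      nlinarith [Real.pi_gt_three]
    calc _ ≤ μ⁻¹ * (C₂ * X) := mul_le_mul h3 h1 (norm_nonneg _) (by positivity)
      _ = _ := by ring
  set Y : ℝ := ‖dirOp ω (expPsi N) u‖ with hYdef
  have hY0 : 0 ≤ Y := norm_nonneg _
  have hZ : ∀ a, ‖dirOp ω (expPsi N) (toH (∂_{basisVec a} U))‖ ≤ C₁ * X := by
    intro a
    rw [idRatio]
    refine (hw (S.ratio a) ?_).trans ?_
    · refine mul_le_mul_of_nonneg_left ?_ hL0
      have : kernelMoment 1 (S.ratio a) + kernelMoment 2 (S.ratio a)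
          ≤ ∑ a, (kernelMoment 1 (S.ratio a) + kernelMoment 2 (S.ratio a)) :=
        Finset.single_le_sum (f := fun a => kernelMoment 1 (S.ratio a) + kernelMoment 2 (S.ratio a))
          (fun a _ => add_nonneg (m1 _ _) (m1 _ _)) (Finset.mem_univ a)
      linarith [m1 1 S.inv, m1 2 S.inv]
    · refine mul_le_mul_of_nonneg_right ?_ hX0
      have : kernelMoment 0 (S.ratio a) ≤ ∑ a, kernelMoment 0 (S.ratio a) :=
        Finset.single_le_sum (f := fun a => kernelMoment 0 (S.ratio a)) (fun a _ => m0 _)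
          (Finset.mem_univ a)
      linarith
  -- the Rellich identity
  have hR := rellich_identity hω (bddCont_expW_sq hN0) (bddCont_expRho hN0)
    ((bddCont_logDerivRho hN0).mul (bddCont_expRho hN0))
    ((bddCont_quotRho hN0).mul (bddCont_expRho hN0)) (hasDerivAt_expW_sq N) (hasDerivAt_expRho N)
    (hasDerivAt_logDerivRho_mul N) heq
  set f : ℝ := ‖dirOp ω (expW N) G‖ with hf
  have hf0 : 0 ≤ f := norm_nonneg _
  have bw := bddMeas_weight (s := -1) (by norm_num)
  have bE := bddCont_expW hN0
  have bψ := bddCont_expPsi hN0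
  have hsqrt : ∀ x : E3, Real.sqrt (1 + inner ℝ ω x ^ 2) ≤ bracket x := fun x => by
    refine Real.sqrt_le_sqrt ?_
    have h1 : |inner ℝ ω x| ≤ ‖x‖ := by simpa [hω] using abs_real_inner_le_norm ω x
    have h2 : (inner ℝ ω x : ℝ) ^ 2 ≤ ‖x‖ ^ 2 := by
      rw [← sq_abs]
      gcongr
    linarith
  have t1 : (inner ℂ d (dirOp ω (expRho N) d)).re = X ^ 2 := by
    rw [inner_dirOp_rho hN0, inner_self_eq_norm_sq_to_K]
    exact congrArg Complex.re (Complex.ofReal_pow X 2).symm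
  have t2 : (inner ℂ (toH F) (dirOp ω (expRho N) u)).re ≤ f * Y := by
    rw [inner_dirOp_rho hN0]
    refine (Complex.re_le_norm _).trans ((norm_inner_le_norm _ _).trans ?_)
    refine mul_le_mul_of_nonneg_right ?_ hY0
    rw [hFH, hf, ← one_mul ‖dirOp ω (expW N) G‖]
    refine Lp.norm_le_mul_norm_of_ae_le_mul ?_
    filter_upwards [mulOp_ae (bψ.bddMeas ω) (mulOp (weight (-1)) G), mulOp_ae bw G,
      mulOp_ae (bE.bddMeas ω) G] with x h1 h2 h3
    rw [dirOp, dirOp, h1, h2, h3, norm_mul, norm_mul, norm_mul, Complex.norm_real, Complex.norm_real,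
      one_mul, Real.norm_eq_abs, Real.norm_eq_abs, abs_of_pos (expPsi_pos _ _),
      abs_of_pos (expW_pos _ _)]
    exact mul_le_mul (expPsi_le_expW _ _) (mul_le_of_le_one_left (norm_nonneg _)
      (norm_weight_le_one (by norm_num) x)) (by positivity) (expW_pos _ _).le
  have t3 : (inner ℂ u (dirOp ω (fun t => quotRho N t * expRho N t) u)).re
      ≤ 16 * (1 + N) ^ 2 * Y ^ 2 := by
    have e1 : inner ℂ u (dirOp ω (fun t => quotRho N t * expRho N t) u)
        = inner ℂ (dirOp ω (expPsi N) u) (dirOp ω (quotRho N) (dirOp ω (expPsi N) u)) := by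
      rw [inner_dirOp_left bψ, dirOp_dirOp (bddCont_quotRho hN0) bψ,
        dirOp_dirOp bψ ((bddCont_quotRho hN0).mul bψ)]
      congr 3
      ext t
      rw [← expPsi_sq]
      ring
    rw [e1]
    refine (Complex.re_le_norm _).trans ((norm_inner_le_norm _ _).trans ?_)
    have h1 : ‖dirOp ω (quotRho N) (dirOp ω (expPsi N) u)‖ ≤ 16 * (1 + N) ^ 2 * Y :=
      norm_mulOp_apply_le ((bddCont_quotRho hN0).bddMeas ω) (fun x => by
        rw [Complex.norm_real]; exact abs_quotRho_le hN0 _) _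
    calc _ ≤ Y * (16 * (1 + N) ^ 2 * Y) := mul_le_mul_of_nonneg_left h1 hY0
      _ = _ := by ring
  have t4 : -(inner ℂ (toH F) (dirOp ω (fun t => expW N t ^ 2) d)).re ≤ f * X := by
    have e1 : inner ℂ (toH F) (dirOp ω (fun t => expW N t ^ 2) d)
        = inner ℂ (dirOp ω (expW N) G) (mulOp (weight (-1)) (dirOp ω (expW N) d)) := by
      have e2 : (fun x => star (weight (-1) x)) = weight (-1) := by
        ext x
        simp [weight, Complex.conj_ofReal]
      have e3 : dirOp ω (fun t => expW N t ^ 2) d = dirOp ω (expW N) (dirOp ω (expW N) d) := by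
        rw [dirOp_dirOp bE bE]
        simp only [sq]
      rw [hFH, inner_mulOp_left bw, e2, inner_dirOp_left bE, e3, dirOp, mulOp_comm bw (bE.bddMeas ω)]
    rw [e1]
    refine (neg_le_abs _).trans ((Complex.abs_re_le_norm _).trans ((norm_inner_le_norm _ _).trans ?_))
    refine mul_le_mul_of_nonneg_left ?_ hf0
    rw [hX, ← one_mul ‖dirOp ω (expPsi N) d‖]
    refine Lp.norm_le_mul_norm_of_ae_le_mul ?_
    filter_upwards [mulOp_ae bw (dirOp ω (expW N) d), mulOp_ae (bψ.bddMeas ω) d,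
      mulOp_ae (bE.bddMeas ω) d] with x h1 h2 h3
    rw [h1, dirOp, h3, dirOp, h2, norm_mul, norm_mul, norm_mul, Complex.norm_real, Complex.norm_real,
      one_mul, Real.norm_eq_abs, Real.norm_eq_abs, abs_of_pos (expPsi_pos _ _),
      abs_of_pos (expW_pos _ _), ← mul_assoc, norm_weight]
    refine mul_le_mul_of_nonneg_right ?_ (norm_nonneg _)
    rw [expPsi, Real.rpow_neg_one, ← div_eq_inv_mul]
    exact div_le_div_of_nonneg_left (expW_pos _ _).le (by positivity) (hsqrt x)
  rw [t1] at hR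
  -- absorb the lower order terms
  have hYX : Y * μ ≤ C₂ * X := by
    rw [div_mul_eq_mul_div, le_div_iff₀ hμ0] at hY
    exact hY
  have hY1 : 2 * N * Y ≤ X := by
    have h1 : 2 * C₂ * N ≤ μ := by linarith
    have h2 : 2 * N * (Y * μ) ≤ 2 * N * (C₂ * X) := mul_le_mul_of_nonneg_left hYX (by linarith)
    have h3 : 2 * C₂ * N * X ≤ μ * X := mul_le_mul_of_nonneg_right h1 hX0
    refine le_of_mul_le_mul_right ?_ hμ0
    linarith
  have hμK : 16 * (1 + N) ^ 2 * C₂ ^ 2 ≤ μ := by linarith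
  have hY2 : 16 * (1 + N) ^ 2 * Y ^ 2 ≤ X ^ 2 := by
    have h1 : (Y * μ) ^ 2 ≤ (C₂ * X) ^ 2 := by gcongr
    have h2 : (16 * (1 + N) ^ 2 * C₂ ^ 2) * X ^ 2 ≤ μ * X ^ 2 := by gcongr
    have h3 : 16 * (1 + N) ^ 2 * Y ^ 2 * μ ^ 2 ≤ X ^ 2 * μ ^ 2 := by
      calc 16 * (1 + N) ^ 2 * Y ^ 2 * μ ^ 2 = 16 * (1 + N) ^ 2 * (Y * μ) ^ 2 := by ring
        _ ≤ 16 * (1 + N) ^ 2 * (C₂ * X) ^ 2 := by gcongr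
        _ = (16 * (1 + N) ^ 2 * C₂ ^ 2) * X ^ 2 := by ring
        _ ≤ μ * X ^ 2 := h2
        _ ≤ X ^ 2 * μ ^ 2 := by
          rw [mul_comm]
          exact mul_le_mul_of_nonneg_left (by nlinarith) (sq_nonneg X)
    exact le_of_mul_le_mul_right h3 (by positivity)
  have hfin : N * X ≤ f := by
    have h1 : 2 * N * X ^ 2 ≤ N * (f * Y) + N / 2 * X ^ 2 + f * X := by
      have a1 := mul_le_mul_of_nonneg_left t2 hN0
      have a2 : N / 2 * (inner ℂ u (dirOp ω (fun t => quotRho N t * expRho N t) u)).re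
          ≤ N / 2 * X ^ 2 := mul_le_mul_of_nonneg_left (t3.trans hY2) (by linarith)
      have a3 := mul_nonneg hη.le hflux'
      linarith
    have h2 : f * (2 * N * Y) ≤ f * X := mul_le_mul_of_nonneg_left hY1 hf0
    have h3 : (N * X) * X ≤ f * X := by linarith
    rcases hX0.eq_or_lt with h0 | h0
    · rw [← h0, mul_zero]
      exact hf0
    · exact le_of_mul_le_mul_right h3 h0
  have hXf : X ≤ 1 / N * f := by
    rw [one_div, ← div_eq_inv_mul, le_div_iff₀ (by linarith)]
    linarith
  constructor
  · intro a
    have e : (fun ξ => derivSymbol (basisVec a) ξ * resSymbol z ξ * scaledSymbol μ χ ξ)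
        = fun ξ => derivSymbol (basisVec a) ξ * m ξ := by
      ext ξ
      simp only [hm, mul_assoc]
    rw [e, ← dE]
    calc _ ≤ C₁ * X := hZ a
      _ ≤ (C₁ + C₂) * (1 / N * f) := by gcongr; linarith
      _ = _ := by ring
  · rw [← uE]
    calc _ ≤ C₂ / μ * X := hY
      _ ≤ (C₁ + C₂) / μ * (1 / N * f) := by gcongr; linarith
      _ = _ := by field_simp

/-! ### A conical partition of frequency space -/

/-- A smooth function on a neighbourhood of the support of a cutoff `θ`, multiplied by `θ`, as a
Schwartz function. -/
lemma exists_schwartz_cutoff_mul {θ g : E3 → ℝ} (hθ : ContDiff ℝ (⊤ : ℕ∞) θ) (hc : HasCompactSupport θ)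
    (hg : ∀ ξ ∈ tsupport θ, ContDiffAt ℝ (⊤ : ℕ∞) g ξ) :
    ∃ q : 𝓢(E3, ℂ), ∀ ξ, q ξ = ((θ ξ * g ξ : ℝ) : ℂ) := by
  have h1 : ContDiff ℝ (⊤ : ℕ∞) fun ξ => θ ξ * g ξ := by
    refine (contMDiff_of_tsupport fun ξ hξ => ContDiffAt.contMDiffAt ?_).contDiff
    exact hθ.contDiffAt.mul (hg ξ (tsupport_mul_subset_left hξ))
  have h2 : HasCompactSupport fun ξ => ((θ ξ * g ξ : ℝ) : ℂ) :=
    (hc.mul_right (f' := g)).comp_left (g := Complex.ofReal) Complex.ofReal_zero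
  exact ⟨h2.toSchwartzMap (Complex.ofRealCLM.contDiff.comp h1), fun ξ => rfl⟩

lemma nonempty_coneSymbols {ω : E3} {χ : 𝓢(E3, ℂ)} (hc : HasCompactSupport χ)
    (hχ : ∀ ξ ∈ tsupport χ, 0 < inner ℝ ξ ω) : Nonempty (ConeSymbols ω χ) := by
  have hV : IsOpen {ξ : E3 | 0 < inner ℝ ξ ω} := isOpen_lt continuous_const (by fun_prop)
  obtain ⟨K, hK, hK1, hK2⟩ := exists_compact_between hc.isCompact hV hχ
  obtain ⟨θ, hθ1, hθ0, -⟩ := exists_contMDiffMap_one_nhds_of_subset_interior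
    (n := ⊤) (modelWithCornersSelf ℝ E3) (isClosed_tsupport χ) hK1
  have hθK : tsupport θ ⊆ K := closure_minimal
    (fun ξ hξ => by by_contra h; exact hξ (hθ0 ξ h)) hK.isClosed
  have hθc : HasCompactSupport θ := hK.of_isClosed_subset (isClosed_tsupport _) hθK
  have hθs : ContDiff ℝ (⊤ : ℕ∞) θ := θ.contMDiff.contDiff
  have hpos : ∀ ξ ∈ tsupport θ, 0 < inner ℝ ξ ω := fun ξ hξ => hK2 (hθK hξ)
  have hin : ContDiff ℝ (⊤ : ℕ∞) fun ξ : E3 => (inner ℝ ξ ω : ℝ) := contDiff_id.inner ℝ contDiff_const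
  obtain ⟨qi, hqi⟩ := exists_schwartz_cutoff_mul hθs hθc (g := fun ξ => (inner ℝ ξ ω)⁻¹)
    fun ξ hξ => hin.contDiffAt.inv (hpos ξ hξ).ne'
  have hr : ∀ a : Fin 3, ∃ q : 𝓢(E3, ℂ), ∀ ξ, q ξ = ((θ ξ * (ξ a * (inner ℝ ξ ω)⁻¹) : ℝ) : ℂ) :=
    fun a => exists_schwartz_cutoff_mul hθs hθc fun ξ hξ =>
      (contDiff_euclidean.1 contDiff_id a).contDiffAt.mul
        (hin.contDiffAt.inv (hpos ξ hξ).ne')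
  choose qr hqr using hr
  obtain ⟨qs, hqs⟩ := exists_schwartz_cutoff_mul hθs hθc (g := fun ξ => Real.sqrt (inner ℝ ξ ω))
    fun ξ hξ => hin.contDiffAt.sqrt (hpos ξ hξ).ne'
  have hone : ∀ ξ, χ ξ ≠ 0 → θ ξ = 1 ∧ 0 < inner ℝ ξ ω := fun ξ hξ =>
    have h := subset_tsupport χ hξ
    ⟨hθ1.self_of_nhdsSet ξ h, hχ ξ h⟩
  refine ⟨⟨qi, qr, qs, fun ξ hξ => ?_, fun a ξ hξ => ?_, fun ξ hξ => ?_, fun ξ => ?_⟩⟩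
  · obtain ⟨h1, h2⟩ := hone ξ hξ
    rw [hqi, h1, one_mul, ← Complex.ofReal_mul, inv_mul_cancel₀ h2.ne', Complex.ofReal_one]
  · obtain ⟨h1, h2⟩ := hone ξ hξ
    rw [hqr, h1, one_mul, ← Complex.ofReal_mul, inv_mul_cancel_right₀ h2.ne']
  · obtain ⟨h1, h2⟩ := hone ξ hξ
    rw [hqs, h1, one_mul, ← Complex.ofReal_mul, Real.mul_self_sqrt h2.le]
  · rw [hqs]
    exact Complex.conj_ofReal _

/-- The six unit vectors `±e_a`. -/
noncomputable def axis (j : Fin 3 × Bool) : E3 := (if j.2 then (1 : ℝ) else -1) • basisVec j.1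

lemma norm_axis (j : Fin 3 × Bool) : ‖axis j‖ = 1 := by
  rw [axis, norm_smul]
  have : ‖basisVec j.1‖ = 1 := by simp [basisVec]
  rw [this]
  split_ifs <;> simp

lemma exists_half_norm_lt_inner_axis {ξ : E3} (hξ : ξ ≠ 0) : ∃ j, ‖ξ‖ / 2 < inner ℝ ξ (axis j) := by
  by_contra! h
  have h1 : ∀ a, ξ a ^ 2 ≤ ‖ξ‖ ^ 2 / 4 := fun a => by
    have h2 := h (a, true)
    have h3 := h (a, false)
    simp only [axis, inner_smul_right, inner_basisVec] at h2 h3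
    norm_num at h2 h3
    nlinarith
  have h4 := EuclideanSpace.norm_sq_eq ξ
  simp only [Real.norm_eq_abs, sq_abs, Fin.sum_univ_three] at h4
  nlinarith [h1 0, h1 1, h1 2, norm_pos_iff.2 hξ]

/-- A smooth partition of unity on the annulus `1/2 ≤ |ξ| ≤ 3/2` by symbols supported in cones around
the six directions `±e_a`. -/
lemma exists_cone_partition : ∃ χ : Fin 3 × Bool → 𝓢(E3, ℂ),
    (∀ j, Nonempty (ConeSymbols (axis j) (χ j))) ∧ (∀ ξ, ‖1 - ∑ j, χ j ξ‖ ≤ 1) ∧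
      ∀ ξ : E3, 1 / 2 ≤ ‖ξ‖ → ‖ξ‖ ≤ 3 / 2 → ∑ j, χ j ξ = 1 := by
  set s : Set E3 := {ξ | 1 / 2 ≤ ‖ξ‖ ∧ ‖ξ‖ ≤ 3 / 2}
  set U : Fin 3 × Bool → Set E3 := fun j =>
    {ξ | 1 / 4 < ‖ξ‖ ∧ ‖ξ‖ < 2 ∧ ‖ξ‖ / 2 < inner ℝ ξ (axis j)}
  have hs : IsClosed s :=
    (isClosed_le continuous_const continuous_norm).inter (isClosed_le continuous_norm continuous_const)
  have hU : ∀ j, IsOpen (U j) := fun j =>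
    (isOpen_lt continuous_const continuous_norm).inter ((isOpen_lt continuous_norm continuous_const).inter
      (isOpen_lt (continuous_norm.div_const 2)
        (continuous_id.inner continuous_const)))
  have hsU : s ⊆ ⋃ j, U j := fun ξ hξ => by
    have h0 : ξ ≠ 0 := by
      rintro rfl
      have := hξ.1
      norm_num at this
    obtain ⟨j, hj⟩ := exists_half_norm_lt_inner_axis h0
    exact Set.mem_iUnion.2 ⟨j, by linarith [hξ.1], by linarith [hξ.2], hj⟩
  obtain ⟨p, hp⟩ := SmoothPartitionOfUnity.exists_isSubordinate (modelWithCornersSelf ℝ E3) hs U hU hsU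
  have hpc : ∀ j, HasCompactSupport (p j) := fun j =>
    (isCompact_closedBall (0 : E3) 2).of_isClosed_subset (isClosed_tsupport _) fun ξ hξ => by
      rw [mem_closedBall_zero_iff]
      exact (hp j hξ).2.1.le
  have hpc' : ∀ j, HasCompactSupport fun ξ => ((p j ξ : ℝ) : ℂ) := fun j =>
    (hpc j).comp_left (g := Complex.ofReal) Complex.ofReal_zero
  set χ : Fin 3 × Bool → 𝓢(E3, ℂ) := fun j =>
    (hpc' j).toSchwartzMap (Complex.ofRealCLM.contDiff.comp (p j).contMDiff.contDiff)
  have hχ : ∀ j ξ, χ j ξ = ((p j ξ : ℝ) : ℂ) := fun j ξ => rfl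
  have hsum : ∀ ξ, ∑ j, χ j ξ = ((∑ᶠ j, p j ξ : ℝ) : ℂ) := fun ξ => by
    rw [finsum_eq_sum_of_fintype]
    simp [hχ]
  refine ⟨χ, fun j => nonempty_coneSymbols (hpc' j) fun ξ hξ => ?_, fun ξ => ?_, fun ξ h1 h2 => ?_⟩
  · have h1 : tsupport (χ j) ⊆ tsupport (p j) := closure_mono fun x hx h0 => hx (by
      change ((p j x : ℝ) : ℂ) = 0
      rw [h0, Complex.ofReal_zero])
    have h2 := hp j (h1 hξ)
    linarith [h2.1, h2.2.2]
  · rw [hsum, ← Complex.ofReal_one, ← Complex.ofReal_sub, Complex.norm_real, Real.norm_eq_abs, abs_le]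
    constructor <;> linarith [p.sum_nonneg ξ, p.sum_le_one ξ]
  · rw [hsum, p.sum_eq_one ⟨h1, h2⟩, Complex.ofReal_one]

/-! ### Weighted resolvents and conjugated frequency localizations -/

/-- The operator `⟨x⟩ˢ χ(D/μ) ⟨x⟩⁻ˢ`. -/
noncomputable def conjOp (s μ : ℝ) (χ : 𝓢(E3, ℂ)) : L2 →L[ℂ] L2 :=
  kerOp fun x y => weight s x * weight (-s) y * scaledKernel μ χ (x - y)

/-- The operator `⟨x⟩⁻¹ m(D) ⟨x⟩⁻¹`. -/
noncomputable def sandwich (m : E3 → ℂ) : L2 →L[ℂ] L2 :=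
  mulOp (weight (-1)) ∘L fm m ∘L mulOp (weight (-1))

lemma sandwich_apply (m : E3 → ℂ) (f : L2) :
    sandwich m f = mulOp (weight (-1)) (fm m (mulOp (weight (-1)) f)) := rfl

lemma bddMeas_weight_neg_one : BddMeas (weight (-1)) := bddMeas_weight (by norm_num)

lemma bracket_div_le (x y : E3) : bracket x / bracket y ≤ 1 + ‖x - y‖ := by
  rw [div_le_iff₀ (bracket_pos y)]
  nlinarith [bracket_le_add x y, one_le_bracket y, norm_nonneg (x - y)]

lemma norm_weight_mul_weight_le {s : ℝ} (hs : s = 1 ∨ s = -1) (x y : E3) :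
    ‖weight s x * weight (-s) y‖ ≤ 1 + ‖x - y‖ := by
  rw [norm_mul, norm_weight, norm_weight]
  rcases hs with rfl | rfl
  · rw [Real.rpow_one, Real.rpow_neg_one, ← div_eq_mul_inv]
    exact bracket_div_le x y
  · rw [neg_neg, Real.rpow_one, Real.rpow_neg_one, ← div_eq_inv_mul, norm_sub_rev]
    exact bracket_div_le y x

lemma measurable_weight_mul_weight (s t : ℝ) :
    Measurable (Function.uncurry fun x y : E3 => weight s x * weight t y) :=
  ((continuous_weight s).measurable.comp measurable_fst).mul
    ((continuous_weight t).measurable.comp measurable_snd)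

lemma exists_kerBound_conjOp {s μ : ℝ} (hs : s = 1 ∨ s = -1) (hμ : 0 < μ) (χ : 𝓢(E3, ℂ)) :
    ∃ κ, KerBound (fun x y => weight s x * weight (-s) y * scaledKernel μ χ (x - y)) κ := by
  obtain ⟨κ, h, -⟩ := exists_kerBound_scaled hμ χ (α := 1) (β := 1) (γ := 0)
    (measurable_weight_mul_weight s (-s)) zero_le_one zero_le_one le_rfl
    fun x y => by simpa using norm_weight_mul_weight_le hs x y
  exact ⟨κ, h⟩

lemma mulOp_weight_conjOp {μ : ℝ} (hμ : 0 < μ) (χ : 𝓢(E3, ℂ)) (f : L2) :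
    mulOp (weight (-1)) (conjOp 1 μ χ f) = fm (scaledSymbol μ χ) (mulOp (weight (-1)) f) := by
  obtain ⟨κ, h⟩ := exists_kerBound_conjOp (Or.inl rfl) hμ χ
  obtain ⟨κ', h', -⟩ := exists_kerBound_scaledKernel hμ χ
  rw [fm_scaledSymbol_eq_kerOp hμ, conjOp]
  refine h.mulOp_comp h' bddMeas_weight_neg_one bddMeas_weight_neg_one (fun x y => ?_) f
  rw [← mul_assoc, ← mul_assoc, weight_mul]
  norm_num
  rw [weight_zero, one_mul, mul_comm]

lemma conjOp_mulOp_weight {μ : ℝ} (hμ : 0 < μ) (χ : 𝓢(E3, ℂ)) (f : L2) :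
    conjOp (-1) μ χ (mulOp (weight (-1)) f) = mulOp (weight (-1)) (fm (scaledSymbol μ χ) f) := by
  obtain ⟨κ, h⟩ := exists_kerBound_conjOp (Or.inr rfl) hμ χ
  obtain ⟨κ', h', -⟩ := exists_kerBound_scaledKernel hμ χ
  rw [fm_scaledSymbol_eq_kerOp hμ, conjOp]
  refine (h'.mulOp_comp h bddMeas_weight_neg_one bddMeas_weight_neg_one (fun x y => ?_) f).symm
  have h1 : weight (- -1) y * weight (-1) y = 1 := by
    rw [weight_mul]
    norm_num [weight_zero]
  linear_combination (-(weight (-1) x * scaledKernel μ χ (x - y))) * h1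

/-- The conjugated localization commutes with the weighted resolvent, up to exchanging
`⟨x⟩ χ(D/μ) ⟨x⟩⁻¹` and `⟨x⟩⁻¹ χ(D/μ) ⟨x⟩`. -/
lemma conjOp_sandwich {μ : ℝ} (hμ : 0 < μ) (χ : 𝓢(E3, ℂ)) {m : E3 → ℂ} (hm : BddMeas m) (f : L2) :
    conjOp (-1) μ χ (sandwich m f) = sandwich m (conjOp 1 μ χ f) := by
  have hχ := bddMeas_scaledSymbol hμ χ
  rw [sandwich_apply, conjOp_mulOp_weight hμ, sandwich_apply, mulOp_weight_conjOp hμ,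
    fm_fm hχ hm, fm_fm hm hχ]
  simp_rw [mul_comm]

lemma norm_conjOp_commutator_le {μ : ℝ} (hμ : 0 < μ) (χ : 𝓢(E3, ℂ)) {g : E3 → ℂ} (hg : BddMeas g)
    {G L : ℝ} (hG : ∀ x, ‖g x‖ ≤ G) (hL : 0 ≤ L) (hgL : ∀ x y, ‖g x - g y‖ ≤ L * ‖x - y‖) (f : L2) :
    ‖conjOp 1 μ χ (mulOp g f) - mulOp g (conjOp (-1) μ χ f)‖
      ≤ (2 * G + L) * (kernelMoment 1 χ / μ) * ‖f‖ := by
  have hG0 : 0 ≤ G := (norm_nonneg _).trans (hG 0)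
  obtain ⟨κ₁, h₁⟩ := exists_kerBound_conjOp (Or.inl rfl) hμ χ
  obtain ⟨κ₂, h₂⟩ := exists_kerBound_conjOp (Or.inr rfl) hμ χ
  have hw : ∀ x y : E3, ‖weight 1 x * weight (-1) y - 1‖ ≤ ‖x - y‖ := fun x y => by
    rw [weight, weight, ← Complex.ofReal_mul, ← Complex.ofReal_one, ← Complex.ofReal_sub,
      Complex.norm_real, Real.norm_eq_abs, Real.rpow_one, Real.rpow_neg_one, abs_le]
    have hy := one_le_bracket y
    have e : bracket x * (bracket y)⁻¹ - 1 = (bracket x - bracket y) / bracket y := by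
      field_simp
    have h1 := bracket_le_add x y
    have h2 := bracket_le_add y x
    rw [norm_sub_rev] at h2
    rw [e, le_div_iff₀ (by linarith), div_le_iff₀ (by linarith)]
    constructor <;> nlinarith [norm_nonneg (x - y)]
  obtain ⟨κ, h, hκ⟩ := exists_kerBound_scaled hμ χ
    (g := fun x y => weight 1 x * weight (-1) y * g y - g x * (weight (-1) x * weight 1 y))
    (α := 0) (β := 2 * G + L) (γ := 0)
    (((measurable_weight_mul_weight 1 (-1)).mul (hg.meas.comp measurable_snd)).sub
      ((hg.meas.comp measurable_fst).mul (measurable_weight_mul_weight (-1) 1)))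
    le_rfl (by positivity) le_rfl (fun x y => by
      have e : weight 1 x * weight (-1) y * g y - g x * (weight (-1) x * weight 1 y)
          = (weight 1 x * weight (-1) y - 1) * g y - g x * (weight 1 y * weight (-1) x - 1)
            + (g y - g x) := by ring
      rw [e, zero_add, zero_mul, add_zero]
      have a1 : ‖(weight 1 x * weight (-1) y - 1) * g y‖ ≤ ‖x - y‖ * G := by
        rw [norm_mul]
        exact mul_le_mul (hw x y) (hG y) (norm_nonneg _) (norm_nonneg _)
      have a2 : ‖g x * (weight 1 y * weight (-1) x - 1)‖ ≤ G * ‖x - y‖ := by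
        rw [norm_mul, norm_sub_rev x y]
        exact mul_le_mul (hG x) (hw y x) (norm_nonneg _) hG0
      have a3 := hgL y x
      rw [norm_sub_rev y x] at a3
      refine (norm_add_le _ _).trans ((add_le_add_left (norm_sub_le _ _) _).trans ?_)
      linarith)
  have e : conjOp 1 μ χ (mulOp g f) - mulOp g (conjOp (-1) μ χ f) = kerOp _ f :=
    h₁.commutator h₂ h hg hg (fun x y => by rw [neg_neg]; ring) f
  rw [e]
  refine ((kerOp _).le_of_opNorm_le h.norm_kerOp_le f).trans (le_of_eq ?_)
  rw [hκ]
  ring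

lemma im_sq_add_I_mul (t η : ℝ) : ((t : ℂ) ^ 2 + Complex.I * η).im = η := by
  rw [← Complex.ofReal_pow, Complex.add_im, Complex.ofReal_im, Complex.I_mul_im, Complex.ofReal_re,
    zero_add]

/-- The directional resolvent estimate, for the weighted resolvents on `L²`. -/
theorem exists_directional_estimate_sandwich {ω : E3} (hω : ‖ω‖ = 1) {χ : 𝓢(E3, ℂ)}
    (S : ConeSymbols ω χ) :
    ∃ C : ℝ, 0 < C ∧ ∀ N : ℝ, 1 ≤ N → ∃ μ₀ : ℝ, 1 ≤ μ₀ ∧ ∀ μ, μ₀ ≤ μ → ∀ η : ℝ, 0 < η →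
      ∀ z : ℂ, z = ((2 * Real.pi * μ : ℝ) : ℂ) ^ 2 + Complex.I * η → ∀ h : L2,
      (∀ a, ‖dirOp ω (expW N) (sandwich (fun ξ => derivSymbol (basisVec a) ξ * resSymbol z ξ)
          (conjOp 1 μ χ h))‖ ≤ C / N * ‖dirOp ω (expW N) (conjOp 1 μ χ h)‖) ∧
      ‖dirOp ω (expW N) (sandwich (resSymbol z) (conjOp 1 μ χ h))‖
        ≤ C / (N * μ) * ‖dirOp ω (expW N) (conjOp 1 μ χ h)‖ := by
  obtain ⟨C, hC, H⟩ := exists_directional_estimate hω S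
  refine ⟨C, hC, fun N hN => ?_⟩
  obtain ⟨μ₀, hμ₀, H⟩ := H N hN
  refine ⟨μ₀, hμ₀, fun μ hμ η hη z hz h => ?_⟩
  have hN0 : 0 ≤ N := by linarith
  have hμ0 : 0 < μ := by linarith
  have hzim : z.im ≠ 0 := by
    rw [hz, im_sq_add_I_mul]
    exact hη.ne'
  have bw := bddMeas_weight_neg_one
  have bE := (bddCont_expW hN0).bddMeas ω
  have bψ := (bddCont_expPsi hN0).bddMeas ω
  have bχ := bddMeas_scaledSymbol hμ0 χ
  -- the weight `⟨x⟩⁻¹ e^{-N arctan}` is dominated by `(1 + (x·ω)²)^{-1/2} e^{-N arctan}`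
  have hle : ∀ f : L2, ‖dirOp ω (expW N) (mulOp (weight (-1)) f)‖ ≤ ‖dirOp ω (expPsi N) f‖ := by
    intro f
    rw [← one_mul ‖dirOp ω (expPsi N) f‖]
    refine Lp.norm_le_mul_norm_of_ae_le_mul ?_
    filter_upwards [mulOp_ae bw f, mulOp_ae bE (mulOp (weight (-1)) f), mulOp_ae bψ f] with x h1 h2 h3
    rw [dirOp, dirOp, h2, h1, h3, norm_mul, norm_mul, norm_mul, one_mul, Complex.norm_real,
      Complex.norm_real, Real.norm_eq_abs, Real.norm_eq_abs, abs_of_pos (expPsi_pos _ _),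
      abs_of_pos (expW_pos _ _), ← mul_assoc, norm_weight]
    refine mul_le_mul_of_nonneg_right ?_ (norm_nonneg _)
    rw [expPsi, Real.rpow_neg_one, ← div_eq_mul_inv]
    refine div_le_div_of_nonneg_left (expW_pos _ _).le (by positivity) (Real.sqrt_le_sqrt ?_)
    have h1 : |inner ℝ ω x| ≤ ‖x‖ := by simpa [hω] using abs_real_inner_le_norm ω x
    have h2 : (inner ℝ ω x : ℝ) ^ 2 ≤ ‖x‖ ^ 2 := by
      rw [← sq_abs]
      gcongr
    linarith
  refine denseRange_toH.induction_on (p := fun h =>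
      (∀ a, ‖dirOp ω (expW N) (sandwich (fun ξ => derivSymbol (basisVec a) ξ * resSymbol z ξ)
          (conjOp 1 μ χ h))‖ ≤ C / N * ‖dirOp ω (expW N) (conjOp 1 μ χ h)‖) ∧
      ‖dirOp ω (expW N) (sandwich (resSymbol z) (conjOp 1 μ χ h))‖
        ≤ C / (N * μ) * ‖dirOp ω (expW N) (conjOp 1 μ χ h)‖) h ?_ fun f => ?_
  · have c1 : ∀ T : L2 →L[ℂ] L2, Continuous fun h => ‖T (conjOp 1 μ χ h)‖ := fun T => by fun_prop
    simp only [Set.ofPred_and, Set.ofPred_forall]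
    refine IsClosed.inter (isClosed_iInter fun a => ?_) ?_
    · exact isClosed_le (c1 (dirOp ω (expW N) ∘L sandwich _)) (continuous_const.mul (c1 _))
    · exact isClosed_le (c1 (dirOp ω (expW N) ∘L sandwich _)) (continuous_const.mul (c1 _))
  · have hT := mulOp_toH bw (hasTemperateGrowth_weight (-1)) f
    have key := mulOp_weight_conjOp hμ0 χ (toH f)
    rw [hT] at key
    obtain ⟨H1, H2⟩ := H μ hμ η hη z hz _ _ key.symm
    have e : ∀ m : E3 → ℂ, BddMeas m → sandwich m (conjOp 1 μ χ (toH f))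
        = mulOp (weight (-1)) (fm (fun ξ => m ξ * scaledSymbol μ χ ξ)
          (toH (SchwartzMap.smulLeftCLM ℂ (weight (-1)) f))) := fun m hm => by
      rw [sandwich_apply, key, fm_fm hm bχ]
    refine ⟨fun a => ?_, ?_⟩
    · rw [e _ (bddMeas_derivSymbol_mul_resSymbol hzim _)]
      exact (hle _).trans (H1 a)
    · rw [e _ (bddMeas_resSymbol hzim)]
      exact (hle _).trans H2

/-! ### Elliptic bounds away from the sphere -/

/-- The weighted derivative `⟨x⟩⁻¹ ∂_a R₀(z) ⟨x⟩⁻¹` of the free resolvent. -/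
noncomputable def resGrad (z : ℂ) (a : Fin 3) : L2 →L[ℂ] L2 :=
  sandwich fun ξ => derivSymbol (basisVec a) ξ * resSymbol z ξ

/-- The weighted free resolvent `⟨x⟩⁻¹ R₀(z) ⟨x⟩⁻¹`. -/
noncomputable def resOp (z : ℂ) : L2 →L[ℂ] L2 := sandwich (resSymbol z)

lemma norm_sandwich_sub_sum_le {ι : Type*} [Fintype ι] (χ : ι → 𝓢(E3, ℂ)) {μ : ℝ} (hμ : 0 < μ)
    {m : E3 → ℂ} (hm : BddMeas m) {C : ℝ}
    (hC : ∀ ξ, ‖m ξ * (1 - ∑ j, χ j (μ⁻¹ • ξ))‖ ≤ C) (f : L2) :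
    ‖sandwich m (f - ∑ j, conjOp 1 μ (χ j) f)‖ ≤ C * ‖f‖ := by
  have hC0 : 0 ≤ C := (norm_nonneg _).trans (hC 0)
  have bχ : ∀ j, BddMeas (scaledSymbol μ (χ j)) := fun j => bddMeas_scaledSymbol hμ _
  have bs : BddMeas fun ξ => ∑ j, scaledSymbol μ (χ j) ξ := (mulOp_sum _ (fun j _ => bχ j) 0).1
  have bq : BddMeas fun ξ => 1 + (-1) * ∑ j, scaledSymbol μ (χ j) ξ :=
    (BddMeas.const 1).add ((BddMeas.const (-1)).mul bs)
  have e : mulOp (weight (-1)) (f - ∑ j, conjOp 1 μ (χ j) f)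
      = fm (fun ξ => 1 + (-1) * ∑ j, scaledSymbol μ (χ j) ξ) (mulOp (weight (-1)) f) := by
    rw [fm_add (.const 1) ((BddMeas.const (-1)).mul bs), fm_one, fm_smul bs,
      fm_sum _ fun j _ => bχ j, map_sub, map_sum, neg_one_smul, sub_eq_add_neg]
    simp only [mulOp_weight_conjOp hμ]
  have hw : ∀ g : L2, ‖mulOp (weight (-1)) g‖ ≤ ‖g‖ := fun g => by
    simpa using norm_mulOp_apply_le bddMeas_weight_neg_one (norm_weight_le_one (by norm_num)) g
  rw [sandwich_apply, e, fm_fm hm bq]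
  calc _ ≤ C * ‖mulOp (weight (-1)) f‖ := (hw _).trans (norm_fm_apply_le (hm.mul bq) (fun ξ => by
        have := hC ξ
        rwa [neg_one_mul, ← sub_eq_add_neg]) _)
    _ ≤ C * ‖f‖ := mul_le_mul_of_nonneg_left (hw f) hC0

lemma norm_resSymbol_le_of_off_sphere {μ : ℝ} (hμ : 0 < μ) {z : ℂ} (hz : z.re = (2 * Real.pi * μ) ^ 2)
    {ξ : E3} (hξ : ‖ξ‖ < μ / 2 ∨ 3 * μ / 2 < ‖ξ‖) :
    ‖resSymbol z ξ‖ ≤ 1 / μ ^ 2 ∧ 2 * Real.pi * ‖ξ‖ * ‖resSymbol z ξ‖ ≤ 1 / μ := by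
  have hπ := Real.pi_gt_three
  have ht := norm_nonneg ξ
  set t := ‖ξ‖ with ht'
  have h1 : |4 * Real.pi ^ 2 * (t ^ 2 - μ ^ 2)| ≤ ‖((4 * Real.pi ^ 2 * t ^ 2 : ℝ) : ℂ) - z‖ := by
    refine le_trans (le_of_eq ?_) (Complex.abs_re_le_norm _)
    rw [Complex.sub_re, Complex.ofReal_re, hz]
    congr 1
    ring
  have h2 : 1 * μ ^ 2 ≤ |t ^ 2 - μ ^ 2| * 2 ∧ t * μ ≤ |t ^ 2 - μ ^ 2| * 2 := by
    rcases hξ with h | h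
    · have : |t ^ 2 - μ ^ 2| = μ ^ 2 - t ^ 2 := by rw [abs_sub_comm, abs_of_nonneg (by nlinarith)]
      rw [this]
      constructor <;> nlinarith
    · have : |t ^ 2 - μ ^ 2| = t ^ 2 - μ ^ 2 := abs_of_nonneg (by nlinarith)
      rw [this]
      constructor <;> nlinarith
  rw [abs_mul, abs_of_pos (by positivity)] at h1
  set X := |t ^ 2 - μ ^ 2|
  have hX : 0 ≤ X := abs_nonneg _
  set Q := ‖((4 * Real.pi ^ 2 * t ^ 2 : ℝ) : ℂ) - z‖ with hQ
  have hπ2 : 2 * Real.pi * 2 ≤ 4 * Real.pi ^ 2 := by nlinarith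
  have h3 : 2 * Real.pi * (2 * X) ≤ Q := by nlinarith
  have h4 : μ ^ 2 ≤ Q := by nlinarith
  have h5 : 2 * Real.pi * t * μ ≤ Q := by nlinarith
  have hQ0 : 0 < Q := lt_of_lt_of_le (by positivity) h4
  have e : ‖resSymbol z ξ‖ = 1 / Q := by rw [resSymbol, norm_inv, one_div]
  rw [e]
  refine ⟨one_div_le_one_div_of_le (by positivity) h4, ?_⟩
  rw [mul_one_div, div_le_div_iff₀ hQ0 hμ, one_mul]
  exact h5

lemma norm_conjOp_le {s μ : ℝ} (hs : s = 1 ∨ s = -1) (hμ : 1 ≤ μ) (χ : 𝓢(E3, ℂ)) (f : L2) :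
    ‖conjOp s μ χ f‖ ≤ (kernelMoment 0 χ + kernelMoment 1 χ) * ‖f‖ := by
  obtain ⟨κ, h, hκ⟩ := exists_kerBound_scaled (by linarith : 0 < μ) χ (α := 1) (β := 1) (γ := 0)
    (measurable_weight_mul_weight s (-s)) zero_le_one zero_le_one le_rfl
    fun x y => by simpa using norm_weight_mul_weight_le hs x y
  refine ((kerOp _).le_of_opNorm_le h.norm_kerOp_le f).trans ?_
  rw [hκ, one_mul, one_mul, zero_mul, add_zero]
  gcongr
  exact div_le_self (kernelMoment_nonneg 1 χ) hμ

lemma norm_dirOp_expW_le {N : ℝ} (hN : 0 ≤ N) (ω : E3) (f : L2) :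
    ‖dirOp ω (expW N) f‖ ≤ Real.exp (2 * N) * ‖f‖ :=
  norm_mulOp_apply_le ((bddCont_expW hN).bddMeas ω) (fun x => by
    rw [Complex.norm_real, Real.norm_eq_abs, abs_of_pos (expW_pos _ _)]
    exact expW_le hN _) f

lemma norm_le_dirOp_expW {N : ℝ} (hN : 0 ≤ N) (ω : E3) (f : L2) :
    ‖f‖ ≤ Real.exp (2 * N) * ‖dirOp ω (expW N) f‖ := by
  refine Lp.norm_le_mul_norm_of_ae_le_mul ?_
  filter_upwards [mulOp_ae ((bddCont_expW hN).bddMeas ω) f] with x hx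
  rw [dirOp, hx, norm_mul, Complex.norm_real, Real.norm_eq_abs, abs_of_pos (expW_pos _ _),
    ← mul_assoc]
  refine le_mul_of_one_le_left (norm_nonneg _) ?_
  calc (1 : ℝ) = Real.exp (2 * N) * Real.exp (-(2 * N)) := by rw [← Real.exp_add]; simp
    _ ≤ _ := by gcongr; exact le_expW hN _

/-- Bounds for the weighted free resolvent that are uniform up to the real axis: it is `O(1/μ)`, its
gradient is `O(1)`, and localized to a cone the gradient gains `1/N` in the norm with weight
`e^{-N arctan(x·ω)}`. -/
theorem exists_resolvent_bounds : ∃ (χ : Fin 3 × Bool → 𝓢(E3, ℂ)) (C : ℝ), 0 < C ∧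
    ∀ N : ℝ, 1 ≤ N → ∃ μ₀ : ℝ, 1 ≤ μ₀ ∧ ∀ μ, μ₀ ≤ μ → ∀ η : ℝ, 0 < η →
      ∀ z : ℂ, z = ((2 * Real.pi * μ : ℝ) : ℂ) ^ 2 + Complex.I * η → ∀ f : L2,
      (∀ j a, ‖dirOp (axis j) (expW N) (resGrad z a (conjOp 1 μ (χ j) f))‖
        ≤ C / N * ‖dirOp (axis j) (expW N) (conjOp 1 μ (χ j) f)‖) ∧
      (∀ a, ‖resGrad z a (f - ∑ j, conjOp 1 μ (χ j) f)‖ ≤ 1 / μ * ‖f‖) ∧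
      (∀ a, ‖resGrad z a f‖ ≤ C * ‖f‖) ∧ ‖resOp z f‖ ≤ C / μ * ‖f‖ := by
  obtain ⟨χ, hS, hχ1, hχ0⟩ := exists_cone_partition
  have H := fun j => exists_directional_estimate_sandwich (norm_axis j) (hS j).some
  choose C hC H using H
  choose μ₀ hμ₀ H using H
  set M : ℝ := ∑ j, (kernelMoment 0 (χ j) + kernelMoment 1 (χ j)) with hM
  set CC : ℝ := ∑ j, C j with hCC
  set e : ℝ := Real.exp (2 * 1) with he
  have hCj : ∀ j, C j ≤ CC := fun j =>
    Finset.single_le_sum (f := C) (fun j _ => (hC j).le) (Finset.mem_univ j)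
  have hCC0 : 0 < CC := (hC (0, true)).trans_le (hCj _)
  have hM0 : ∀ j, 0 ≤ kernelMoment 0 (χ j) + kernelMoment 1 (χ j) := fun j =>
    add_nonneg (kernelMoment_nonneg _ _) (kernelMoment_nonneg _ _)
  have hM1 : 0 ≤ M := Finset.sum_nonneg fun j _ => hM0 j
  refine ⟨χ, CC + (e * (CC * (e * M)) + 1), by positivity, fun N hN => ?_⟩
  refine ⟨1 + ∑ j, μ₀ j N hN + ∑ j, μ₀ j 1 le_rfl, ?_, fun μ hμ η hη z hz f => ?_⟩
  · have h1 : 0 ≤ ∑ j, μ₀ j N hN := Finset.sum_nonneg fun j _ => by linarith [hμ₀ j N hN]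
    have h2 : 0 ≤ ∑ j, μ₀ j 1 le_rfl := Finset.sum_nonneg fun j _ => by linarith [hμ₀ j 1 le_rfl]
    linarith
  have h1 : ∀ N (hN : 1 ≤ N), ∀ j, μ₀ j N hN ≤ ∑ j, μ₀ j N hN := fun N hN j =>
    Finset.single_le_sum (f := fun j => μ₀ j N hN) (fun j _ => by linarith [hμ₀ j N hN])
      (Finset.mem_univ j)
  have h1' : ∀ N (hN : 1 ≤ N), 0 ≤ ∑ j, μ₀ j N hN := fun N hN =>
    Finset.sum_nonneg fun j _ => by linarith [hμ₀ j N hN]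
  have hμN : ∀ j, μ₀ j N hN ≤ μ := fun j => by linarith [h1 N hN j, h1' 1 le_rfl]
  have hμO : ∀ j, μ₀ j 1 le_rfl ≤ μ := fun j => by linarith [h1 1 le_rfl j, h1' N hN]
  have hμ1 : 1 ≤ μ := by linarith [h1' N hN, h1' 1 le_rfl]
  have hμ0 : 0 < μ := by linarith
  have hzim : z.im ≠ 0 := by
    rw [hz, im_sq_add_I_mul]
    exact hη.ne'
  have hzre : z.re = (2 * Real.pi * μ) ^ 2 := by
    rw [hz, ← Complex.ofReal_pow, Complex.add_re, Complex.ofReal_re, Complex.I_mul_re,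
      Complex.ofReal_im, neg_zero, add_zero]
  have hell : ∀ ξ : E3, (‖ξ‖ < μ / 2 ∨ 3 * μ / 2 < ‖ξ‖) ∨ (1 - ∑ j, χ j (μ⁻¹ • ξ)) = 0 := by
    intro ξ
    by_contra! hc
    obtain ⟨⟨h2, h3⟩, h4⟩ := hc
    refine h4 ?_
    have h5 : ‖μ⁻¹ • ξ‖ = ‖ξ‖ / μ := by
      rw [norm_smul, Real.norm_eq_abs, abs_of_pos (inv_pos.2 hμ0), ← div_eq_inv_mul]
    rw [hχ0, sub_self]
    · rw [h5, le_div_iff₀ hμ0]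
      linarith
    · rw [h5, div_le_iff₀ hμ0]
      linarith
  have hD0 : ∀ (a : Fin 3) (f : L2), ‖resGrad z a (f - ∑ j, conjOp 1 μ (χ j) f)‖ ≤ 1 / μ * ‖f‖ := by
    refine fun a => norm_sandwich_sub_sum_le χ hμ0 (bddMeas_derivSymbol_mul_resSymbol hzim _)
      fun ξ => ?_
    rcases hell ξ with h2 | h2
    · rw [norm_mul, norm_mul]
      have h3 := (norm_resSymbol_le_of_off_sphere hμ0 hzre h2).2
      have h4 := norm_derivSymbol_le (basisVec a) ξ
      have h5 : ‖basisVec a‖ = 1 := by simp [basisVec]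
      rw [h5, mul_one] at h4
      calc _ ≤ (2 * Real.pi * ‖ξ‖ * ‖resSymbol z ξ‖) * 1 := by gcongr; exact hχ1 _
        _ ≤ _ := by linarith
    · rw [h2, mul_zero, norm_zero]
      positivity
  have hR0 : ∀ f : L2, ‖resOp z (f - ∑ j, conjOp 1 μ (χ j) f)‖ ≤ 1 / μ * ‖f‖ := by
    refine norm_sandwich_sub_sum_le χ hμ0 (bddMeas_resSymbol hzim) fun ξ => ?_
    rcases hell ξ with h2 | h2
    · rw [norm_mul]
      calc _ ≤ 1 / μ ^ 2 * 1 := by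
            gcongr
            · exact (norm_resSymbol_le_of_off_sphere hμ0 hzre h2).1
            · exact hχ1 _
        _ ≤ _ := by
            rw [mul_one]
            exact one_div_le_one_div_of_le hμ0 (by nlinarith)
    · rw [h2, mul_zero, norm_zero]
      positivity
  -- an operator bounded on all localized pieces is bounded
  have hT : ∀ (T : L2 →L[ℂ] L2) (c c' : ℝ), 0 ≤ c →
      (∀ j f, ‖dirOp (axis j) (expW 1) (T (conjOp 1 μ (χ j) f))‖
        ≤ c * ‖dirOp (axis j) (expW 1) (conjOp 1 μ (χ j) f)‖) →
      (∀ f, ‖T (f - ∑ j, conjOp 1 μ (χ j) f)‖ ≤ c' * ‖f‖) → ∀ f,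
      ‖T f‖ ≤ (e * (c * (e * M)) + c') * ‖f‖ := by
    intro T c c' hc h2 h3 f
    have h4 : T f = ∑ j, T (conjOp 1 μ (χ j) f) + T (f - ∑ j, conjOp 1 μ (χ j) f) := by
      rw [map_sub, map_sum]
      abel
    have h5 : ∀ j, ‖T (conjOp 1 μ (χ j) f)‖
        ≤ e * (c * (e * ((kernelMoment 0 (χ j) + kernelMoment 1 (χ j)) * ‖f‖))) := fun j => by
      refine (norm_le_dirOp_expW zero_le_one (axis j) _).trans ?_
      gcongr
      refine (h2 j f).trans ?_
      gcongr
      refine (norm_dirOp_expW_le zero_le_one (axis j) _).trans ?_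
      gcongr
      exact norm_conjOp_le (Or.inl rfl) hμ1 _ _
    rw [h4]
    calc _ ≤ ∑ j, ‖T (conjOp 1 μ (χ j) f)‖ + c' * ‖f‖ :=
          (norm_add_le _ _).trans (add_le_add (norm_sum_le _ _) (h3 f))
      _ ≤ ∑ j, e * (c * (e * ((kernelMoment 0 (χ j) + kernelMoment 1 (χ j)) * ‖f‖))) + c' * ‖f‖ := by
          gcongr with j
          exact h5 j
      _ = _ := by
          simp only [← Finset.mul_sum, ← Finset.sum_mul, ← hM]
          ring
  have hinv : 1 / μ ≤ 1 := by rw [div_le_one hμ0]; exact hμ1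
  refine ⟨fun j a => ?_, fun a => hD0 a f, fun a => ?_, ?_⟩
  · refine ((H j N hN μ (hμN j) η hη z hz f).1 a).trans ?_
    gcongr
    linarith [hCj j, show 0 ≤ e * (CC * (e * M)) + 1 by positivity]
  · refine (hT (resGrad z a) CC (1 / μ) hCC0.le (fun j f => ?_) (hD0 a) f).trans ?_
    · refine ((H j 1 le_rfl μ (hμO j) η hη z hz f).1 a).trans ?_
      rw [div_one]
      gcongr
      exact hCj j
    · refine mul_le_mul_of_nonneg_right ?_ (norm_nonneg _)
      linarith
  · refine (hT (resOp z) (CC / μ) (1 / μ) (by positivity) (fun j f => ?_) hR0 f).trans ?_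
    · refine (H j 1 le_rfl μ (hμO j) η hη z hz f).2.trans ?_
      rw [one_mul]
      gcongr
      exact hCj j
    · rw [show e * (CC / μ * (e * M)) + 1 / μ = (e * (CC * (e * M)) + 1) / μ by ring]
      refine mul_le_mul_of_nonneg_right (div_le_div_of_nonneg_right ?_ hμ0.le) (norm_nonneg _)
      linarith

/-! ### The iteration -/

section step

variable {H ι κ : Type*} [NormedAddCommGroup H] [NormedSpace ℂ H] [Fintype ι] [Fintype κ]

/-- The norm adapted to a frequency localization `∑ⱼ Pⱼ + P₀ = 1` and to weights `Eⱼ`. -/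
noncomputable def locNorm (P E : ι → H →L[ℂ] H) (f : H) : ℝ :=
  ∑ j, ‖E j (P j f)‖ + ‖f - ∑ j, P j f‖

variable {P P' E : ι → H →L[ℂ] H} {D B : κ → H →L[ℂ] H}

lemma locNorm_nonneg (f : H) : 0 ≤ locNorm P E f :=
  add_nonneg (Finset.sum_nonneg fun _ _ => norm_nonneg _) (norm_nonneg _)

lemma locNorm_zero : locNorm P E (0 : H) = 0 := by simp [locNorm]

lemma locNorm_smul (c : ℂ) (f : H) : locNorm P E (c • f) = ‖c‖ * locNorm P E f := by
  simp only [locNorm, map_smul, ← Finset.smul_sum, ← smul_sub, norm_smul, ← Finset.mul_sum, mul_add]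

lemma locNorm_add (f g : H) : locNorm P E (f + g) ≤ locNorm P E f + locNorm P E g := by
  have h1 : ∑ j, ‖E j (P j (f + g))‖ ≤ ∑ j, ‖E j (P j f)‖ + ∑ j, ‖E j (P j g)‖ := by
    rw [← Finset.sum_add_distrib]
    refine Finset.sum_le_sum fun j _ => ?_
    rw [map_add, map_add]
    exact norm_add_le _ _
  have h2 : ‖f + g - ∑ j, P j (f + g)‖ ≤ ‖f - ∑ j, P j f‖ + ‖g - ∑ j, P j g‖ := by
    simp only [map_add, Finset.sum_add_distrib, add_sub_add_comm]
    exact norm_add_le _ _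
  rw [locNorm, locNorm, locNorm]
  linarith

lemma locNorm_sum {α : Type*} (s : Finset α) (f : α → H) :
    locNorm P E (∑ a ∈ s, f a) ≤ ∑ a ∈ s, locNorm P E (f a) :=
  Finset.le_sum_of_subadditive _ locNorm_zero.le locNorm_add s f

lemma norm_le_locNorm {e : ℝ} (he : 1 ≤ e) (hE' : ∀ j f, ‖f‖ ≤ e * ‖E j f‖) (f : H) :
    ‖f‖ ≤ e * locNorm P E f := by
  have h1 : ‖f‖ ≤ ∑ j, ‖P j f‖ + ‖f - ∑ j, P j f‖ := by
    calc ‖f‖ = ‖∑ j, P j f + (f - ∑ j, P j f)‖ := by rw [add_sub_cancel]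
      _ ≤ ‖∑ j, P j f‖ + ‖f - ∑ j, P j f‖ := norm_add_le _ _
      _ ≤ _ := by gcongr; exact norm_sum_le _ _
  have h2 : ∑ j, ‖P j f‖ ≤ e * ∑ j, ‖E j (P j f)‖ := by
    rw [Finset.mul_sum]
    exact Finset.sum_le_sum fun j _ => hE' j _
  have h3 : ‖f - ∑ j, P j f‖ ≤ e * ‖f - ∑ j, P j f‖ := le_mul_of_one_le_left (norm_nonneg _) he
  rw [locNorm, mul_add]
  linarith

lemma locNorm_le {e p : ℝ} (he : 0 ≤ e) (hE : ∀ j f, ‖E j f‖ ≤ e * ‖f‖)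
    (hP : ∀ j f, ‖P j f‖ ≤ p * ‖f‖) (f : H) :
    locNorm P E f ≤ (Fintype.card ι * (e * p) + 1 + Fintype.card ι * p) * ‖f‖ := by
  have h1 : ∑ j, ‖E j (P j f)‖ ≤ Fintype.card ι * (e * (p * ‖f‖)) := by
    rw [← nsmul_eq_mul]
    exact Finset.sum_le_card_nsmul _ _ _ fun j _ =>
      (hE j _).trans (mul_le_mul_of_nonneg_left (hP j f) he)
  have h2 : ‖∑ j, P j f‖ ≤ Fintype.card ι * (p * ‖f‖) := by
    rw [← nsmul_eq_mul]
    exact (norm_sum_le _ _).trans (Finset.sum_le_card_nsmul _ _ _ fun j _ => hP j f)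
  have h3 := norm_sub_le f (∑ j, P j f)
  rw [locNorm]
  linarith

/-- One step `h ↦ (B_b ∑_a c D_a h_a)_b` of the iteration, in the adapted norm: localized
resolvents gain `γ`, and all commutators are small. -/
lemma sum_locNorm_step_le {e β δ δ' γ d : ℝ} (he : 1 ≤ e) (hβ : 0 ≤ β) (hδ : 0 ≤ δ)
    (hγ : 0 ≤ γ) (hδ' : 0 ≤ δ') (hE : ∀ j f, ‖E j f‖ ≤ e * ‖f‖) (hE' : ∀ j f, ‖f‖ ≤ e * ‖E j f‖)
    (hB : ∀ b f, ‖B b f‖ ≤ β * ‖f‖) (hEB : ∀ j b f, E j (B b f) = B b (E j f))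
    (hPB : ∀ j b f, ‖P j (B b f) - B b (P' j f)‖ ≤ δ * ‖f‖)
    (hPD : ∀ j a f, P' j (D a f) = D a (P j f))
    (hED : ∀ j a f, ‖E j (D a (P j f))‖ ≤ γ * ‖E j (P j f)‖)
    (hD0 : ∀ a f, ‖D a (f - ∑ j, P j f)‖ ≤ δ' * ‖f‖) (hD : ∀ a f, ‖D a f‖ ≤ d * ‖f‖)
    (c : ℂ) (h : κ → H) :
    ∑ b, locNorm P E (B b (∑ a, c • D a (h a)))
      ≤ Fintype.card κ * ‖c‖ * (Fintype.card ι * (e * (δ * (d * e)) + β * γ)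
        + (β * (δ' * e) + Fintype.card ι * (δ * (d * e)))) * ∑ a, locNorm P E (h a) := by
  have he0 : 0 ≤ e := by linarith
  set K := Fintype.card ι * (e * (δ * (d * e)) + β * γ)
        + (β * (δ' * e) + Fintype.card ι * (δ * (d * e))) with hK
  have key : ∀ b a, locNorm P E (B b (D a (h a))) ≤ K * locNorm P E (h a) := by
    intro b a
    set n := locNorm P E (h a) with hn
    have hh : ‖h a‖ ≤ e * n := norm_le_locNorm he hE' _
    have hu : ‖D a (h a)‖ ≤ d * e * n := by
      rcases le_or_gt 0 d with hd | hd
      · calc _ ≤ d * ‖h a‖ := hD _ _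
          _ ≤ d * (e * n) := by gcongr
          _ = _ := by ring
      · have h0 : ‖h a‖ = 0 := by
          have := (norm_nonneg _).trans (hD a (h a))
          nlinarith [norm_nonneg (h a)]
        have h1 : h a = 0 := norm_eq_zero.1 h0
        have h2 : n = 0 := by rw [hn, h1, locNorm_zero]
        rw [h1, h2, map_zero, norm_zero, mul_zero]
    have hc : ∀ j, ‖P j (B b (D a (h a))) - B b (P' j (D a (h a)))‖ ≤ δ * (d * e * n) := fun j =>
      (hPB _ _ _).trans (mul_le_mul_of_nonneg_left hu hδ)
    have h1 : ∀ j, ‖E j (P j (B b (D a (h a))))‖ ≤ (e * (δ * (d * e)) + β * γ) * n := by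
      intro j
      have e1 : E j (P j (B b (D a (h a)))) = E j (P j (B b (D a (h a))) - B b (P' j (D a (h a))))
          + B b (E j (D a (P j (h a)))) := by
        rw [map_sub, ← hPD, hEB]
        abel
      have hj : ‖E j (P j (h a))‖ ≤ n := by
        have := Finset.single_le_sum (f := fun j => ‖E j (P j (h a))‖)
          (fun j _ => norm_nonneg _) (Finset.mem_univ j)
        rw [hn, locNorm]
        linarith [norm_nonneg (h a - ∑ j, P j (h a))]
      rw [e1]
      calc _ ≤ e * (δ * (d * e * n)) + β * (γ * n) := by
            refine (norm_add_le _ _).trans (add_le_add ?_ ?_)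
            · exact (hE _ _).trans (mul_le_mul_of_nonneg_left (hc j) he0)
            · refine (hB _ _).trans (mul_le_mul_of_nonneg_left ?_ hβ)
              exact (hED _ _ _).trans (mul_le_mul_of_nonneg_left hj hγ)
        _ = _ := by ring
    have h2 : ‖B b (D a (h a)) - ∑ j, P j (B b (D a (h a)))‖
        ≤ (β * (δ' * e) + Fintype.card ι * (δ * (d * e))) * n := by
      have e1 : B b (D a (h a)) - ∑ j, P j (B b (D a (h a)))
          = B b (D a (h a - ∑ j, P j (h a)))
            - ∑ j, (P j (B b (D a (h a))) - B b (P' j (D a (h a)))) := by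
        simp only [map_sub, map_sum, hPD, Finset.sum_sub_distrib]
        abel
      rw [e1]
      calc _ ≤ β * (δ' * (e * n)) + Fintype.card ι * (δ * (d * e * n)) := by
            refine (norm_sub_le _ _).trans (add_le_add ?_ ?_)
            · refine (hB _ _).trans (mul_le_mul_of_nonneg_left ?_ hβ)
              exact (hD0 _ _).trans (mul_le_mul_of_nonneg_left hh hδ')
            · rw [← nsmul_eq_mul]
              exact (norm_sum_le _ _).trans (Finset.sum_le_card_nsmul _ _ _ fun j _ => hc j)
        _ = _ := by ring
    have h3 : ∑ j, ‖E j (P j (B b (D a (h a))))‖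
        ≤ Fintype.card ι * ((e * (δ * (d * e)) + β * γ) * n) := by
      rw [← nsmul_eq_mul]
      exact Finset.sum_le_card_nsmul _ _ _ fun j _ => h1 j
    rw [locNorm, hK]
    linarith
  have hb : ∀ b, locNorm P E (B b (∑ a, c • D a (h a)))
      ≤ ‖c‖ * (K * ∑ a, locNorm P E (h a)) := by
    intro b
    rw [map_sum]
    refine (locNorm_sum _ _).trans ?_
    rw [Finset.mul_sum, Finset.mul_sum]
    refine Finset.sum_le_sum fun a _ => ?_
    rw [map_smul, locNorm_smul]
    exact mul_le_mul_of_nonneg_left (key b a) (norm_nonneg _)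
  calc _ ≤ (Finset.univ : Finset κ).card • (‖c‖ * (K * ∑ a, locNorm P E (h a))) :=
        Finset.sum_le_card_nsmul _ _ _ fun b _ => hb b
    _ = _ := by rw [nsmul_eq_mul, Finset.card_univ]; ring

end step

/-- The map `(h_a)_a ↦ (g_b ∑_a 2i ⟨x⟩⁻¹ ∂_a R₀(z) ⟨x⟩⁻¹ h_a)_b`. -/
noncomputable def magStep (z : ℂ) (g : Fin 3 → E3 → ℂ) (h : Fin 3 → L2) : Fin 3 → L2 :=
  fun b => mulOp (g b) (∑ a, (2 * Complex.I) • resGrad z a (h a))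

/-- For large frequencies, the iterates of `magStep` decay geometrically. -/
theorem exists_iterate_magStep_le {g : Fin 3 → E3 → ℂ} (hg : ∀ b, BddMeas (g b)) {G L : ℝ}
    (hG : ∀ b x, ‖g b x‖ ≤ G) (hL : 0 ≤ L) (hgL : ∀ b x y, ‖g b x - g b y‖ ≤ L * ‖x - y‖) :
    ∃ K μ₀ : ℝ, 0 ≤ K ∧ 1 ≤ μ₀ ∧ ∀ μ, μ₀ ≤ μ → ∀ η : ℝ, 0 < η →
      ∀ z : ℂ, z = ((2 * Real.pi * μ : ℝ) : ℂ) ^ 2 + Complex.I * η → ∀ (n : ℕ) (h : Fin 3 → L2),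
      ∑ b, ‖(magStep z g)^[n] h b‖ ≤ K * (1 / 2) ^ n * ∑ b, ‖h b‖ := by
  have hG0 : 0 ≤ G := (norm_nonneg _).trans (hG 0 0)
  obtain ⟨χ, C, hC, H⟩ := exists_resolvent_bounds
  -- a localized piece loses at most `36 G` in the step and gains `C / N`; this `N` makes the product `≤ 1/4`
  set N : ℝ := 1 + 144 * G * C with hN
  have hN1 : 1 ≤ N := by
    have : 0 ≤ 144 * G * C := by positivity
    linarith
  have hN0 : 0 ≤ N := by linarith
  obtain ⟨μ₀, hμ₀, H⟩ := H N hN1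
  set e : ℝ := Real.exp (2 * N) with he
  have he1 : 1 ≤ e := Real.one_le_exp (by linarith)
  set M : ℝ := ∑ j, (kernelMoment 0 (χ j) + kernelMoment 1 (χ j)) with hM
  have hM0 : ∀ j, 0 ≤ kernelMoment 0 (χ j) + kernelMoment 1 (χ j) := fun j =>
    add_nonneg (kernelMoment_nonneg _ _) (kernelMoment_nonneg _ _)
  have hMj : ∀ j, kernelMoment 0 (χ j) + kernelMoment 1 (χ j) ≤ M := fun j =>
    Finset.single_le_sum (f := fun j => kernelMoment 0 (χ j) + kernelMoment 1 (χ j))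
      (fun j _ => hM0 j) (Finset.mem_univ j)
  have hM1 : 0 ≤ M := Finset.sum_nonneg fun j _ => hM0 j
  set D : ℝ := (2 * G + L) * M with hD
  have hD0 : 0 ≤ D := by positivity
  set Q : ℝ := 6 * (6 * (e * (D * (C * e))) + (G * e + 6 * (D * (C * e)))) with hQ
  have hQ0 : 0 ≤ Q := by positivity
  set K₁ : ℝ := 6 * (e * M) + 1 + 6 * M with hK₁
  refine ⟨e * K₁, μ₀ + 4 * Q, by positivity, by linarith, fun μ hμ η hη z hz n h => ?_⟩
  have hμ1 : 1 ≤ μ := by linarith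
  have hμ0 : 0 < μ := by linarith
  have H' := H μ (by linarith) η hη z hz
  set P : Fin 3 × Bool → L2 →L[ℂ] L2 := fun j => conjOp 1 μ (χ j) with hP
  set E : Fin 3 × Bool → L2 →L[ℂ] L2 := fun j => dirOp (axis j) (expW N) with hE
  have hzim : z.im ≠ 0 := by
    rw [hz, im_sq_add_I_mul]
    exact hη.ne'
  have hE1 : ∀ j f, ‖E j f‖ ≤ e * ‖f‖ := fun j f => norm_dirOp_expW_le hN0 _ f
  have hE2 : ∀ j f, ‖f‖ ≤ e * ‖E j f‖ := fun j f => norm_le_dirOp_expW hN0 _ f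
  have hstep : ∀ h : Fin 3 → L2, ∑ b, locNorm P E (magStep z g h b)
      ≤ 1 / 2 * ∑ b, locNorm P E (h b) := by
    intro h
    refine (sum_locNorm_step_le (P' := fun j => conjOp (-1) μ (χ j)) (B := fun b => mulOp (g b))
      (D := resGrad z) (e := e) (β := G) (δ := D / μ) (δ' := 1 / μ) (γ := C / N) (d := C)
      he1 hG0 (by positivity) (by positivity) (by positivity) hE1 hE2
      (fun b f => norm_mulOp_apply_le (hg b) (hG b) f)
      (fun j b f => mulOp_comm ((bddCont_expW hN0).bddMeas _) (hg b) f) (fun j b f => ?_)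
      (fun j a f => conjOp_sandwich hμ0 _ (bddMeas_derivSymbol_mul_resSymbol hzim _) f)
      (fun j a f => (H' f).1 j a) (fun a f => (H' f).2.1 a) (fun a f => (H' f).2.2.1 a)
      (2 * Complex.I) h).trans ?_
    · refine (norm_conjOp_commutator_le hμ0 (χ j) (hg b) (hG b) hL (hgL b) f).trans ?_
      rw [hD, mul_div_assoc]
      gcongr
      linarith [hMj j, kernelMoment_nonneg 0 (χ j)]
    · refine mul_le_mul_of_nonneg_right ?_ (Finset.sum_nonneg fun b _ => locNorm_nonneg _)
      have h2 : ‖(2 * Complex.I : ℂ)‖ = 2 := by simp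
      have h3 : 36 * G * C / N ≤ 1 / 4 := by
        rw [div_le_iff₀ (by linarith), hN]
        linarith
      have h4 : Q / μ ≤ 1 / 4 := by
        rw [div_le_iff₀ hμ0]
        linarith
      rw [h2, Fintype.card_prod, Fintype.card_fin, Fintype.card_bool]
      push_cast
      calc _ = 36 * G * C / N + Q / μ := by rw [hQ]; ring
        _ ≤ _ := by linarith
  have hiter : ∑ b, locNorm P E ((magStep z g)^[n] h b) ≤ (1 / 2) ^ n * ∑ b, locNorm P E (h b) := by
    induction n with
    | zero => simp
    | succ n ih =>
      rw [Function.iterate_succ_apply', pow_succ']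
      refine (hstep _).trans ?_
      rw [mul_assoc]
      exact mul_le_mul_of_nonneg_left ih (by norm_num)
  have hfin : ∑ b, locNorm P E (h b) ≤ K₁ * ∑ b, ‖h b‖ := by
    rw [Finset.mul_sum]
    refine Finset.sum_le_sum fun b _ => ?_
    refine (locNorm_le (by linarith) hE1 (p := M) (fun j f => ?_) (h b)).trans (le_of_eq ?_)
    · refine (norm_conjOp_le (Or.inl rfl) hμ1 (χ j) f).trans ?_
      gcongr
      exact hMj j
    · rw [Fintype.card_prod, Fintype.card_fin, Fintype.card_bool]
      push_cast
      rw [hK₁]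
  calc ∑ b, ‖(magStep z g)^[n] h b‖ ≤ ∑ b, e * locNorm P E ((magStep z g)^[n] h b) :=
        Finset.sum_le_sum fun b _ => norm_le_locNorm he1 hE2 _
    _ ≤ e * ((1 / 2) ^ n * (K₁ * ∑ b, ‖h b‖)) := by
        rw [← Finset.mul_sum]
        gcongr
        exact hiter.trans (mul_le_mul_of_nonneg_left hfin (by positivity))
    _ = _ := by ring

/-! ### The Helmholtz kernel -/

/-- The outgoing Helmholtz kernel `e^{iks}/s` as a function of the radius. -/
noncomputable def helm (k : ℂ) (s : ℝ) : ℂ := Complex.exp (Complex.I * k * s) / s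

/-- The function `s⁻¹ (d/ds)` of `helm k`. -/
noncomputable def helmD (k : ℂ) (s : ℝ) : ℂ :=
  Complex.exp (Complex.I * k * s) * (Complex.I * k * s - 1) / (s : ℂ) ^ 3

/-- The function `(s⁻¹ d/ds)²` of `helm k`. -/
noncomputable def helmDD (k : ℂ) (s : ℝ) : ℂ :=
  Complex.exp (Complex.I * k * s) * (3 - 3 * (Complex.I * k * s) + (Complex.I * k * s) ^ 2)
    / (s : ℂ) ^ 5

lemma hasDerivAt_helm (k : ℂ) {s : ℝ} (hs : s ≠ 0) : HasDerivAt (helm k) (s * helmD k s) s := by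
  have hs' : (s : ℂ) ≠ 0 := by exact_mod_cast hs
  have h0 : HasDerivAt (fun s : ℝ => (s : ℂ)) 1 s := Complex.ofRealCLM.hasDerivAt
  have h1 : HasDerivAt (fun s : ℝ => Complex.I * k * (s : ℂ)) (Complex.I * k * 1) s :=
    h0.const_mul _
  refine (h1.cexp.div h0 hs').congr_deriv ?_
  rw [helmD]
  field_simp

lemma hasDerivAt_helmD (k : ℂ) {s : ℝ} (hs : s ≠ 0) : HasDerivAt (helmD k) (s * helmDD k s) s := by
  have hs' : (s : ℂ) ≠ 0 := by exact_mod_cast hs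
  have h0 : HasDerivAt (fun s : ℝ => (s : ℂ)) 1 s := Complex.ofRealCLM.hasDerivAt
  have h1 : HasDerivAt (fun s : ℝ => Complex.I * k * (s : ℂ)) (Complex.I * k * 1) s :=
    h0.const_mul _
  refine ((h1.cexp.mul (h1.sub_const 1)).div (h0.pow 3) (pow_ne_zero 3 hs')).congr_deriv ?_
  rw [helmDD]
  simp only [Pi.pow_apply, Pi.mul_apply]
  field_simp
  ring

/-- The radial Helmholtz equation away from the origin. -/
lemma helm_equation (k : ℂ) {s : ℝ} (hs : s ≠ 0) :
    3 * helmD k s + (s : ℂ) ^ 2 * helmDD k s = -(k ^ 2 * helm k s) := by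
  have hs' : (s : ℂ) ≠ 0 := by exact_mod_cast hs
  rw [helm, helmD, helmDD]
  field_simp
  linear_combination (k ^ 2 * s ^ 2) * Complex.I_sq

lemma norm_exp_le_one {k : ℂ} (hk : 0 ≤ k.im) {s : ℝ} (hs : 0 ≤ s) :
    ‖Complex.exp (Complex.I * k * s)‖ ≤ 1 := by
  rw [Complex.norm_exp]
  refine Real.exp_le_one_iff.2 ?_
  have : (Complex.I * k * s).re = -(k.im * s) := by simp
  rw [this]
  nlinarith [mul_nonneg hk hs]

lemma norm_helm_le {k : ℂ} (hk : 0 ≤ k.im) {s : ℝ} (hs : 0 ≤ s) : ‖helm k s‖ ≤ s⁻¹ := by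
  rw [helm, norm_div, Complex.norm_real, Real.norm_eq_abs, abs_of_nonneg hs, div_eq_mul_inv]
  exact mul_le_of_le_one_left (inv_nonneg.2 hs) (norm_exp_le_one hk hs)

lemma norm_helmD_le {k : ℂ} (hk : 0 ≤ k.im) {s : ℝ} (hs : 0 ≤ s) :
    ‖helmD k s‖ ≤ (‖k‖ * s + 1) / s ^ 3 := by
  rw [helmD, norm_div, norm_mul, norm_pow, Complex.norm_real, Real.norm_eq_abs, abs_of_nonneg hs]
  gcongr
  have h1 : ‖Complex.I * k * s - 1‖ ≤ ‖k‖ * s + 1 := by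
    refine (norm_sub_le _ _).trans (le_of_eq ?_)
    simp [abs_of_nonneg hs]
  calc _ ≤ 1 * (‖k‖ * s + 1) := mul_le_mul (norm_exp_le_one hk hs) h1 (norm_nonneg _) zero_le_one
    _ = _ := one_mul _

lemma norm_helmDD_le {k : ℂ} (hk : 0 ≤ k.im) {s : ℝ} (hs : 0 ≤ s) :
    ‖helmDD k s‖ ≤ (3 + 3 * (‖k‖ * s) + (‖k‖ * s) ^ 2) / s ^ 5 := by
  rw [helmDD, norm_div, norm_mul, norm_pow, Complex.norm_real, Real.norm_eq_abs, abs_of_nonneg hs]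
  gcongr
  have h0 : ‖Complex.I * k * s‖ = ‖k‖ * s := by simp [abs_of_nonneg hs]
  have h1 : ‖3 - 3 * (Complex.I * k * s) + (Complex.I * k * s) ^ 2‖
      ≤ 3 + 3 * (‖k‖ * s) + (‖k‖ * s) ^ 2 := by
    refine (norm_add_le _ _).trans (add_le_add ((norm_sub_le _ _).trans (le_of_eq ?_)) ?_)
    · rw [norm_mul, h0]
      simp
    · rw [norm_pow, h0]
  calc _ ≤ 1 * (3 + 3 * (‖k‖ * s) + (‖k‖ * s) ^ 2) :=
        mul_le_mul (norm_exp_le_one hk hs) h1 (norm_nonneg _) zero_le_one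
    _ = _ := one_mul _

/-- The regularized distance `(|y - x|² + δ²)^{1/2}`. -/
noncomputable def regDist (x : E3) (δ : ℝ) (y : E3) : ℝ := Real.sqrt (‖y - x‖ ^ 2 + δ ^ 2)

section regDist

variable {x : E3} {δ : ℝ} (hδ : 0 < δ)
include hδ

omit hδ in
lemma le_regDist (y : E3) : δ ≤ regDist x δ y :=
  Real.le_sqrt_of_sq_le (by nlinarith [sq_nonneg ‖y - x‖])

lemma regDist_pos (y : E3) : 0 < regDist x δ y := hδ.trans_le (le_regDist y)

omit hδ in
lemma norm_sub_le_regDist (y : E3) : ‖y - x‖ ≤ regDist x δ y :=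
  Real.le_sqrt_of_sq_le (by nlinarith [sq_nonneg δ])

omit hδ in
lemma regDist_sq (y : E3) : regDist x δ y ^ 2 = ‖y - x‖ ^ 2 + δ ^ 2 := Real.sq_sqrt (by positivity)

omit hδ in
lemma continuous_regDist : Continuous (regDist x δ) := by
  unfold regDist
  fun_prop

lemma hasLineDerivAt_regDist (y v : E3) :
    HasLineDerivAt ℝ (regDist x δ) (inner ℝ (y - x) v / regDist x δ y) y v := by
  have h1 : HasFDerivAt (fun y : E3 => ‖y - x‖ ^ 2 + δ ^ 2) _ y :=
    (((hasFDerivAt_id y).sub_const x).norm_sq).add_const (δ ^ 2)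
  have h2 := (h1.sqrt (by positivity)).hasLineDerivAt v
  refine h2.congr_deriv ?_
  simp [regDist]
  field_simp
  rw [inner_sub_left]

lemma hasLineDerivAt_comp_regDist {f : ℝ → ℂ} {f' : ℂ} (y v : E3)
    (hf : HasDerivAt f (regDist x δ y * f') (regDist x δ y)) :
    HasLineDerivAt ℝ (fun y => f (regDist x δ y)) ((inner ℝ (y - x) v : ℝ) * f') y v := by
  have h1 := hasLineDerivAt_regDist (x := x) hδ y v
  unfold HasLineDerivAt at h1 ⊢
  have h2 : HasDerivAt f (regDist x δ y * f') (regDist x δ (y + (0 : ℝ) • v)) := by simpa using hf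
  refine (h2.scomp (0 : ℝ) h1).congr_deriv ?_
  have := (regDist_pos (x := x) hδ y).ne'
  have h3 : ((regDist x δ y : ℝ) : ℂ) ≠ 0 := by exact_mod_cast this
  rw [Complex.real_smul]
  push_cast
  field_simp

lemma hasLineDerivAt_helm_regDist (k : ℂ) (y v : E3) :
    HasLineDerivAt ℝ (fun y => helm k (regDist x δ y))
      ((inner ℝ (y - x) v : ℝ) * helmD k (regDist x δ y)) y v :=
  hasLineDerivAt_comp_regDist hδ y v (hasDerivAt_helm k (regDist_pos hδ y).ne')

lemma hasLineDerivAt_helmD_regDist (k : ℂ) (y v : E3) :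
    HasLineDerivAt ℝ (fun y => (inner ℝ (y - x) v : ℝ) * helmD k (regDist x δ y))
      ((inner ℝ v v : ℝ) * helmD k (regDist x δ y)
        + (inner ℝ (y - x) v : ℝ) ^ 2 * helmDD k (regDist x δ y)) y v := by
  have h1 := hasLineDerivAt_comp_regDist (x := x) hδ y v
    (hasDerivAt_helmD k (regDist_pos hδ y).ne')
  have h2 : HasLineDerivAt ℝ (fun y : E3 => ((inner ℝ (y - x) v : ℝ) : ℂ)) ((inner ℝ v v : ℝ) : ℂ) y v := by
    have h3 : HasFDerivAt (fun y : E3 => (inner ℝ (y - x) v : ℝ)) _ y :=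
      ((hasFDerivAt_id y).sub_const x).inner ℝ (hasFDerivAt_const v y)
    refine ((Complex.ofRealCLM.hasFDerivAt.comp y h3).hasLineDerivAt v).congr_deriv ?_
    simp
  unfold HasLineDerivAt at h1 h2 ⊢
  refine (h2.mul h1).congr_deriv ?_
  simp only [zero_smul, add_zero]
  ring

omit hδ in
lemma abs_inner_sub_le_regDist {v : E3} (hv : ‖v‖ = 1) (y : E3) :
    |inner ℝ (y - x) v| ≤ regDist x δ y := by
  have := abs_real_inner_le_norm (y - x) v
  rw [hv, mul_one] at this
  exact this.trans (norm_sub_le_regDist y)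

lemma continuous_helm_regDist (k : ℂ) : Continuous fun y => helm k (regDist x δ y) := by
  have h : ∀ y, ((regDist x δ y : ℝ) : ℂ) ≠ 0 := fun y => by exact_mod_cast (regDist_pos hδ y).ne'
  have hc := continuous_regDist (x := x) (δ := δ)
  unfold helm
  fun_prop (disch := exact h _)

lemma continuous_helmD_regDist (k : ℂ) : Continuous fun y => helmD k (regDist x δ y) := by
  have h : ∀ y, ((regDist x δ y : ℝ) : ℂ) ^ 3 ≠ 0 := fun y => by
    exact_mod_cast (pow_ne_zero 3 (regDist_pos hδ y).ne')
  have hc := continuous_regDist (x := x) (δ := δ)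
  unfold helmD
  fun_prop (disch := exact h _)

lemma continuous_helmDD_regDist (k : ℂ) : Continuous fun y => helmDD k (regDist x δ y) := by
  have h : ∀ y, ((regDist x δ y : ℝ) : ℂ) ^ 5 ≠ 0 := fun y => by
    exact_mod_cast (pow_ne_zero 5 (regDist_pos hδ y).ne')
  have hc := continuous_regDist (x := x) (δ := δ)
  unfold helmDD
  fun_prop (disch := exact h _)

lemma exists_helmDD_regDist_bound {k : ℂ} (hk : 0 ≤ k.im) :
    ∃ C, 0 ≤ C ∧ ∀ y, (1 + regDist x δ y) ^ 2 * ‖helmDD k (regDist x δ y)‖ ≤ C := by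
  refine ⟨(1 + δ⁻¹) ^ 2 * (3 * (δ⁻¹) ^ 3 + 3 * ‖k‖ * (δ⁻¹) ^ 2 + ‖k‖ ^ 2 * δ⁻¹), by positivity,
    fun y => ?_⟩
  have h1 := norm_helmDD_le hk (regDist_pos (x := x) hδ y).le
  have hs := regDist_pos (x := x) hδ y
  set s := regDist x δ y
  have h2 : s⁻¹ ≤ δ⁻¹ := inv_anti₀ hδ (le_regDist y)
  have h2' : 0 ≤ s⁻¹ := by positivity
  calc _ ≤ (1 + s) ^ 2 * ((3 + 3 * (‖k‖ * s) + (‖k‖ * s) ^ 2) / s ^ 5) := by gcongr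
    _ = (1 + s⁻¹) ^ 2 * (3 * (s⁻¹) ^ 3 + 3 * ‖k‖ * (s⁻¹) ^ 2 + ‖k‖ ^ 2 * s⁻¹) := by
      field_simp
      ring
    _ ≤ _ := by gcongr

lemma exists_helmD_regDist_bound {k : ℂ} (hk : 0 ≤ k.im) :
    ∃ C, 0 ≤ C ∧ ∀ y, (1 + regDist x δ y) * ‖helmD k (regDist x δ y)‖ ≤ C := by
  refine ⟨(1 + δ⁻¹) * (‖k‖ * δ⁻¹ + (δ⁻¹) ^ 2), by positivity, fun y => ?_⟩
  have h1 := norm_helmD_le hk (regDist_pos (x := x) hδ y).le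
  have hs := regDist_pos (x := x) hδ y
  set s := regDist x δ y
  have h2 : s⁻¹ ≤ δ⁻¹ := inv_anti₀ hδ (le_regDist y)
  have h2' : 0 ≤ s⁻¹ := by positivity
  calc _ ≤ (1 + s) * ((‖k‖ * s + 1) / s ^ 3) := by gcongr
    _ = (1 + s⁻¹) * (‖k‖ * s⁻¹ + (s⁻¹) ^ 2) := by
      field_simp
      ring
    _ ≤ _ := by gcongr

end regDist

lemma integrable_bdd_mul_schwartz {g : E3 → ℂ} (hg : Continuous g) {C : ℝ} (hC : ∀ y, ‖g y‖ ≤ C)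
    (φ : 𝓢(E3, ℂ)) : Integrable fun y => g y * φ y :=
  φ.integrable.bdd_mul hg.aestronglyMeasurable (Eventually.of_forall hC)

lemma integral_mul_lineDeriv {g g' : E3 → ℂ} (hg : Continuous g) (hg' : Continuous g') {C C' : ℝ}
    (hC : ∀ y, ‖g y‖ ≤ C) (hC' : ∀ y, ‖g' y‖ ≤ C') {v : E3} (hd : ∀ y, HasLineDerivAt ℝ g (g' y) y v)
    (φ : 𝓢(E3, ℂ)) : ∫ y, g y * (∂_{v} φ) y = -∫ y, g' y * φ y :=
  integral_bilinear_hasLineDerivAt_right_eq_neg_left_of_integrable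
    (B := ContinuousLinearMap.mul ℝ ℂ) (integrable_bdd_mul_schwartz hg' hC' φ)
    (integrable_bdd_mul_schwartz hg hC _) (integrable_bdd_mul_schwartz hg hC φ)
    (fun y _ => hd y) fun y _ => by
      rw [SchwartzMap.lineDerivOp_apply_eq_fderiv]
      exact (φ.hasFDerivAt y).hasLineDerivAt v

/-- The Helmholtz operator applied to the regularized kernel is an approximate identity. -/
lemma integral_helm_regDist {k : ℂ} (hk : 0 ≤ k.im) {δ : ℝ} (hδ : 0 < δ) (x : E3) (φ : 𝓢(E3, ℂ)) :
    ∫ y, helm k (regDist x δ y) * (-(Laplacian.laplacian φ y) - k ^ 2 * φ y)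
      = (δ : ℂ) ^ 2 * ∫ y, helmDD k (regDist x δ y) * φ y := by
  obtain ⟨C₁, hC₁0, hC₁⟩ := exists_helmD_regDist_bound (x := x) hδ hk
  obtain ⟨C₂, hC₂0, hC₂⟩ := exists_helmDD_regDist_bound (x := x) hδ hk
  have c0 := continuous_helm_regDist (x := x) hδ k
  have c1 := continuous_helmD_regDist (x := x) hδ k
  have c2 := continuous_helmDD_regDist (x := x) hδ k
  have hs := fun y => regDist_pos (x := x) hδ y
  have b0 : ∀ y, ‖helm k (regDist x δ y)‖ ≤ δ⁻¹ := fun y =>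
    (norm_helm_le hk (hs y).le).trans (inv_anti₀ hδ (le_regDist y))
  have b1 : ∀ y, ‖helmD k (regDist x δ y)‖ ≤ C₁ := fun y =>
    (le_mul_of_one_le_left (norm_nonneg _) (by linarith [hs y])).trans (hC₁ y)
  have b2 : ∀ y, ‖helmDD k (regDist x δ y)‖ ≤ C₂ := fun y =>
    (le_mul_of_one_le_left (norm_nonneg _) (by nlinarith [hs y])).trans (hC₂ y)
  have hin : ∀ v : E3, Continuous fun y : E3 => ((inner ℝ (y - x) v : ℝ) : ℂ) := fun v => by fun_prop
  have hv : ∀ a : Fin 3, ‖basisVec a‖ = 1 := fun a => by simp [basisVec]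
  have b1' : ∀ (a : Fin 3) (y : E3),
      ‖((inner ℝ (y - x) (basisVec a) : ℝ) : ℂ) * helmD k (regDist x δ y)‖ ≤ C₁ := fun a y => by
    rw [norm_mul, Complex.norm_real, Real.norm_eq_abs]
    refine le_trans ?_ (hC₁ y)
    gcongr
    exact (abs_inner_sub_le_regDist (hv a) y).trans (by linarith)
  have b2' : ∀ (a : Fin 3) (y : E3),
      ‖((inner ℝ (y - x) (basisVec a) : ℝ) : ℂ) ^ 2 * helmDD k (regDist x δ y)‖ ≤ C₂ := fun a y => by
    rw [norm_mul, norm_pow, Complex.norm_real, Real.norm_eq_abs]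
    refine le_trans ?_ (hC₂ y)
    gcongr
    exact (abs_inner_sub_le_regDist (hv a) y).trans (by linarith)
  have hi2 : ∀ a : Fin 3, Integrable fun y => (helmD k (regDist x δ y)
      + ((inner ℝ (y - x) (basisVec a) : ℝ) : ℂ) ^ 2 * helmDD k (regDist x δ y)) * φ y := fun a =>
    integrable_bdd_mul_schwartz (c1.add (((hin _).pow 2).mul c2)) (C := C₁ + C₂)
      (fun y => (norm_add_le _ _).trans (add_le_add (b1 y) (b2' a y))) φ
  have key : ∀ a : Fin 3, ∫ y, helm k (regDist x δ y) * (∂_{basisVec a} (∂_{basisVec a} φ)) y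
      = ∫ y, (helmD k (regDist x δ y)
        + ((inner ℝ (y - x) (basisVec a) : ℝ) : ℂ) ^ 2 * helmDD k (regDist x δ y)) * φ y := by
    intro a
    have h1 := integral_mul_lineDeriv c0 ((hin (basisVec a)).mul c1) b0 (b1' a)
      (fun y => hasLineDerivAt_helm_regDist (x := x) hδ k y (basisVec a)) (∂_{basisVec a} φ)
    have h2 := integral_mul_lineDeriv ((hin (basisVec a)).mul c1)
      (c1.add (((hin (basisVec a)).pow 2).mul c2)) (b1' a) (C' := C₁ + C₂)
      (fun y => (norm_add_le _ _).trans (add_le_add (b1 y) (b2' a y)))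
      (v := basisVec a)
      (fun y => (hasLineDerivAt_helmD_regDist (x := x) hδ k y (basisVec a)).congr_deriv (by
        rw [real_inner_self_eq_norm_sq, hv]
        simp)) φ
    rw [h1, h2, neg_neg]
    rfl
  have hi0 : ∀ a : Fin 3, Integrable fun y =>
      helm k (regDist x δ y) * (∂_{basisVec a} (∂_{basisVec a} φ)) y := fun a =>
    integrable_bdd_mul_schwartz c0 b0 _
  have hi1 : Integrable fun y => helm k (regDist x δ y) * φ y := integrable_bdd_mul_schwartz c0 b0 _
  have e1 : (fun y => helm k (regDist x δ y) * (-(Laplacian.laplacian φ y) - k ^ 2 * φ y))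
      = fun y => (-∑ a, helm k (regDist x δ y) * (∂_{basisVec a} (∂_{basisVec a} φ)) y)
        - k ^ 2 * (helm k (regDist x δ y) * φ y) := by
    ext y
    have h1 : Laplacian.laplacian φ y = ∑ a, (∂_{basisVec a} (∂_{basisVec a} φ)) y := by
      rw [laplacian_eq_sum']
      simp
    rw [h1, ← Finset.mul_sum]
    ring
  have i1 : Integrable fun y => -∑ a, helm k (regDist x δ y) * (∂_{basisVec a} (∂_{basisVec a} φ)) y :=
    (integrable_finsetSum _ fun a _ => hi0 a).neg
  have i2 : Integrable fun y => -∑ a, (helmD k (regDist x δ y)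
      + ((inner ℝ (y - x) (basisVec a) : ℝ) : ℂ) ^ 2 * helmDD k (regDist x δ y)) * φ y :=
    (integrable_finsetSum _ fun a _ => hi2 a).neg
  rw [e1, integral_sub i1 (hi1.const_mul _), integral_neg, integral_finsetSum _ fun a _ => hi0 a]
  simp only [key]
  rw [← integral_finsetSum _ fun a _ => hi2 a, ← integral_neg, ← integral_sub i2 (hi1.const_mul _),
    ← integral_const_mul]
  refine integral_congr_ae (Eventually.of_forall fun y => ?_)
  have h1 := helm_equation k (hs y).ne'
  have h2 : ∑ a : Fin 3, ((inner ℝ (y - x) (basisVec a) : ℝ) : ℂ) ^ 2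
      = (regDist x δ y : ℂ) ^ 2 - (δ : ℂ) ^ 2 := by
    simp only [inner_basisVec]
    rw [← Complex.ofReal_pow (regDist x δ y), regDist_sq, EuclideanSpace.norm_sq_eq]
    simp only [Real.norm_eq_abs, sq_abs, PiLp.sub_apply]
    push_cast
    ring
  simp only [← Finset.sum_mul, Finset.sum_add_distrib, h2, Finset.sum_const, Finset.card_univ,
    Fintype.card_fin, nsmul_eq_mul]
  push_cast
  linear_combination (-φ y) * h1

lemma integrable_bracket_rpow {r : ℝ} (hr : 3 < r) : Integrable fun x : E3 => bracket x ^ (-r) := by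
  have h := integrable_rpow_neg_one_add_norm_sq (E := E3) (μ := volume) (r := r)
    (by rw [finrank_euclideanSpace_fin]; exact_mod_cast hr)
  refine h.congr (Eventually.of_forall fun x => ?_)
  simp only [bracket]
  rw [Real.sqrt_eq_rpow, ← Real.rpow_mul (by positivity)]
  congr 1
  ring

/-- The singularity `|x|⁻²`, cut off to the unit ball. -/
noncomputable def nearKernel : E3 → ℝ := (Metric.ball (0 : E3) 1).indicator fun y => ‖y‖⁻¹ ^ 2

lemma nearKernel_nonneg (y : E3) : 0 ≤ nearKernel y :=
  Set.indicator_nonneg (fun _ _ => by positivity) y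

lemma measurable_nearKernel : Measurable nearKernel :=
  ((measurable_norm.inv).pow_const 2).indicator Metric.isOpen_ball.measurableSet

lemma integrable_nearKernel : Integrable nearKernel := by
  refine (integrableOn_ball_of_norm_le_rpow (C := 1) (α := 2) (E := E3) (μ := volume) ?_ ?_ ?_
    ?_).integrable_indicator Metric.isOpen_ball.measurableSet
  · rw [finrank_euclideanSpace_fin]; norm_num
  · rw [finrank_euclideanSpace_fin]; norm_num
  · refine Eventually.of_forall fun y => ?_
    rw [one_mul, Real.rpow_neg (norm_nonneg y), Real.rpow_two, norm_pow, norm_inv, norm_norm, inv_pow]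
  · exact ((measurable_norm.inv).pow_const 2).aestronglyMeasurable

lemma inv_norm_le_one_add_nearKernel (y : E3) : ‖y‖⁻¹ ≤ 1 + nearKernel y := by
  by_cases h : ‖y‖ < 1
  · have h1 : nearKernel y = ‖y‖⁻¹ ^ 2 := Set.indicator_of_mem (by simpa using h) _
    rw [h1]
    nlinarith [sq_nonneg (‖y‖⁻¹ - 1)]
  · have := inv_le_one_of_one_le₀ (not_lt.1 h)
    linarith [nearKernel_nonneg y]

lemma integrable_inv_norm_sub_mul (x : E3) (ψ : 𝓢(E3, ℂ)) :
    Integrable fun y => ‖y - x‖⁻¹ * ‖ψ y‖ := by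
  obtain ⟨C, hC⟩ := (SchwartzMap.bddMeas ψ).bdd
  have h1 : Integrable fun y => ‖ψ y‖ + nearKernel (y - x) * C :=
    ψ.integrable.norm.add ((integrable_nearKernel.comp_sub_right x).mul_const C)
  refine h1.mono' ?_ (Eventually.of_forall fun y => ?_)
  · exact (((measurable_id.sub_const x).norm.inv).mul ψ.continuous.measurable.norm).aestronglyMeasurable
  · rw [Real.norm_of_nonneg (by positivity)]
    calc _ ≤ (1 + nearKernel (y - x)) * ‖ψ y‖ := by
          gcongr
          exact inv_norm_le_one_add_nearKernel _
      _ = ‖ψ y‖ + nearKernel (y - x) * ‖ψ y‖ := by ring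
      _ ≤ _ := by
          gcongr
          · exact nearKernel_nonneg _
          · exact hC y

/-- The mass `∫ 3 ⟨v⟩⁻⁵ dv` of the approximate identity generated by the Helmholtz operator. -/
noncomputable def helmConst : ℝ := ∫ v : E3, 3 * bracket v ^ (-5 : ℝ)

lemma helmConst_pos : 0 < helmConst := by
  have hp : ∀ v : E3, 0 < 3 * bracket v ^ (-5 : ℝ) := fun v =>
    mul_pos (by norm_num) (Real.rpow_pos_of_pos (bracket_pos v) _)
  refine (integral_pos_iff_support_of_nonneg (fun v => (hp v).le)
    ((integrable_bracket_rpow (by norm_num)).const_mul 3)).2 ?_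
  have : Function.support (fun v : E3 => 3 * bracket v ^ (-5 : ℝ)) = Set.univ :=
    Set.eq_univ_of_forall fun v => (hp v).ne'
  rw [this]
  simp

lemma regDist_add_smul (x v : E3) {δ : ℝ} (hδ : 0 < δ) :
    regDist x δ (x + δ • v) = δ * bracket v := by
  rw [regDist, bracket, add_sub_cancel_left, norm_smul, Real.norm_eq_abs, abs_of_pos hδ]
  have : (δ * ‖v‖) ^ 2 + δ ^ 2 = δ ^ 2 * (1 + ‖v‖ ^ 2) := by ring
  rw [this, Real.sqrt_mul (by positivity), Real.sqrt_sq hδ.le]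

/-- The rescaled approximate identity. -/
noncomputable def helmProfile (k : ℂ) (δ : ℝ) (v : E3) : ℂ :=
  Complex.exp (Complex.I * k * (δ * bracket v : ℝ))
    * (3 - 3 * (Complex.I * k * (δ * bracket v : ℝ)) + (Complex.I * k * (δ * bracket v : ℝ)) ^ 2)
    * ((bracket v ^ (-5 : ℝ) : ℝ) : ℂ)

lemma helmProfile_zero (k : ℂ) (v : E3) :
    helmProfile k 0 v = ((3 * bracket v ^ (-5 : ℝ) : ℝ) : ℂ) := by
  simp [helmProfile]

lemma integral_helmDD_eq (k : ℂ) {δ : ℝ} (hδ : 0 < δ) (x : E3) (φ : 𝓢(E3, ℂ)) :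
    (δ : ℂ) ^ 2 * ∫ y, helmDD k (regDist x δ y) * φ y
      = ∫ v, helmProfile k δ v * φ (x + δ • v) := by
  have h1 : ∫ y, helmDD k (regDist x δ y) * φ y
      = ∫ y, helmDD k (regDist x δ (x + y)) * φ (x + y) :=
    (integral_add_left_eq_self (fun y => helmDD k (regDist x δ y) * φ y) x).symm
  have h2 := Measure.integral_comp_smul (volume : Measure E3)
    (fun y => helmDD k (regDist x δ (x + y)) * φ (x + y)) δ
  rw [finrank_euclideanSpace_fin, abs_of_pos (by positivity)] at h2
  have h3 : ∫ y, helmDD k (regDist x δ (x + y)) * φ (x + y)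
      = δ ^ 3 • ∫ v, helmDD k (regDist x δ (x + δ • v)) * φ (x + δ • v) := by
    rw [h2, smul_smul, mul_inv_cancel₀ (by positivity), one_smul]
  rw [h1, h3, Complex.real_smul, ← mul_assoc, ← integral_const_mul]
  refine integral_congr_ae (Eventually.of_forall fun v => ?_)
  have hb : ((bracket v : ℝ) : ℂ) ≠ 0 := by exact_mod_cast (bracket_pos v).ne'
  have hd : (δ : ℂ) ≠ 0 := by exact_mod_cast hδ.ne'
  have hb5 : bracket v ^ (-5 : ℝ) = (bracket v ^ 5)⁻¹ := by
    rw [Real.rpow_neg (bracket_pos v).le]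
    congr 1
    exact_mod_cast Real.rpow_natCast (bracket v) 5
  simp only [helmProfile, regDist_add_smul x v hδ, helmDD, hb5]
  push_cast
  field_simp

lemma exists_norm_helmProfile_le {k : ℂ} (hk : 0 < k.im) :
    ∃ C, ∀ δ, 0 ≤ δ → ∀ v, ‖helmProfile k δ v‖ ≤ C * bracket v ^ (-5 : ℝ) := by
  refine ⟨3 + 3 * (‖k‖ / k.im) + 2 * (‖k‖ / k.im) ^ 2, fun δ hδ v => ?_⟩
  set ρ : ℝ := δ * bracket v with hρ
  have hρ0 : 0 ≤ ρ := mul_nonneg hδ (bracket_pos v).le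
  have h0 : ‖Complex.I * k * (ρ : ℝ)‖ = ‖k‖ * ρ := by simp [abs_of_nonneg hρ0]
  have h1 : ‖3 - 3 * (Complex.I * k * (ρ : ℝ)) + (Complex.I * k * (ρ : ℝ)) ^ 2‖
      ≤ 3 + 3 * (‖k‖ * ρ) + (‖k‖ * ρ) ^ 2 := by
    refine (norm_add_le _ _).trans (add_le_add ((norm_sub_le _ _).trans (le_of_eq ?_)) ?_)
    · rw [norm_mul, h0]
      simp
    · rw [norm_pow, h0]
  have h2 : ‖Complex.exp (Complex.I * k * (ρ : ℝ))‖ = Real.exp (-(k.im * ρ)) := by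
    rw [Complex.norm_exp]
    simp
  rw [helmProfile, norm_mul, norm_mul, h2, Complex.norm_real,
    Real.norm_of_nonneg (Real.rpow_nonneg (bracket_pos v).le _)]
  refine mul_le_mul_of_nonneg_right ?_ (Real.rpow_nonneg (bracket_pos v).le _)
  set t := k.im * ρ with ht
  have ht0 : 0 ≤ t := mul_nonneg hk.le hρ0
  have hq := Real.quadratic_le_exp_of_nonneg ht0
  have hkρ : ‖k‖ * ρ = ‖k‖ / k.im * t := by rw [ht]; field_simp
  set r := ‖k‖ / k.im with hr
  have hr0 : 0 ≤ r := by positivity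
  rw [hkρ] at h1
  calc _ ≤ Real.exp (-t) * (3 + 3 * (r * t) + (r * t) ^ 2) := by gcongr
    _ ≤ Real.exp (-t) * ((3 + 3 * r + 2 * r ^ 2) * Real.exp t) := by
        gcongr
        have e1 : 1 ≤ Real.exp t := by nlinarith
        have e2 : t ≤ Real.exp t := by nlinarith
        have e3 : t ^ 2 ≤ 2 * Real.exp t := by nlinarith
        nlinarith [mul_le_mul_of_nonneg_left e2 hr0, mul_le_mul_of_nonneg_left e3 (sq_nonneg r)]
    _ = _ := by rw [mul_comm, mul_assoc, ← Real.exp_add]; simp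

/-- `e^{ik|x|}/|x|` is, up to a constant, the fundamental solution of `-Δ - k²`. -/
theorem integral_helm_mul {k : ℂ} (hk : 0 < k.im) (x : E3) (φ : 𝓢(E3, ℂ)) :
    ∫ y, helm k ‖y - x‖ * (-(Laplacian.laplacian φ y) - k ^ 2 * φ y) = helmConst * φ x := by
  set ψ : 𝓢(E3, ℂ) := -(Laplacian.laplacian φ) - k ^ 2 • φ with hψ
  have hψ' : ∀ y, -(Laplacian.laplacian φ y) - k ^ 2 * φ y = ψ y := fun y => by simp [hψ]
  -- the left-hand side
  have hL : Tendsto (fun δ : ℝ => ∫ y, helm k (regDist x δ y) * ψ y) (𝓝[>] 0)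
      (𝓝 (∫ y, helm k ‖y - x‖ * ψ y)) := by
    refine tendsto_integral_filter_of_dominated_convergence (fun y => ‖y - x‖⁻¹ * ‖ψ y‖) ?_ ?_
      (integrable_inv_norm_sub_mul x ψ) ?_
    · filter_upwards [self_mem_nhdsWithin] with δ hδ
      exact ((continuous_helm_regDist hδ k).mul ψ.continuous).aestronglyMeasurable
    · have hne : ∀ᵐ y : E3, y ≠ x := by simp [ae_iff]
      filter_upwards [self_mem_nhdsWithin] with δ hδ
      filter_upwards [hne] with y hy
      rw [norm_mul]
      gcongr
      refine (norm_helm_le hk.le (regDist_pos hδ y).le).trans ?_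
      exact inv_anti₀ (norm_pos_iff.2 (sub_ne_zero.2 hy)) (norm_sub_le_regDist y)
    · have hne : ∀ᵐ y : E3, y ≠ x := by simp [ae_iff]
      filter_upwards [hne] with y hy
      have hy0 : ‖y - x‖ ≠ 0 := norm_ne_zero_iff.2 (sub_ne_zero.2 hy)
      have h1 : Tendsto (fun δ : ℝ => regDist x δ y) (𝓝[>] 0) (𝓝 ‖y - x‖) := by
        have h2 : Continuous fun δ : ℝ => regDist x δ y := by
          unfold regDist
          fun_prop
        have h3 := h2.tendsto 0
        have h4 : regDist x 0 y = ‖y - x‖ := by simp [regDist]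
        rw [h4] at h3
        exact h3.mono_left nhdsWithin_le_nhds
      exact (((hasDerivAt_helm k hy0).continuousAt.tendsto).comp h1).mul_const _
  -- the right-hand side
  have hR : Tendsto (fun δ : ℝ => ∫ v, helmProfile k δ v * φ (x + δ • v)) (𝓝[>] 0)
      (𝓝 (∫ v, helmProfile k 0 v * φ (x + (0 : ℝ) • v))) := by
    obtain ⟨C, hC⟩ := exists_norm_helmProfile_le hk
    obtain ⟨M, hM⟩ := (SchwartzMap.bddMeas φ).bdd
    have hcont : Continuous fun p : ℝ × E3 => helmProfile k p.1 p.2 * φ (x + p.1 • p.2) := by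
      have h1 := continuous_bracket
      have h2 : Continuous fun p : ℝ × E3 => bracket p.2 ^ (-5 : ℝ) :=
        (continuous_bracket_rpow (-5)).comp continuous_snd
      have h3 := φ.continuous
      have h4 : Continuous fun p : ℝ × E3 => Complex.exp (Complex.I * k * (p.1 * bracket p.2 : ℝ))
          * (3 - 3 * (Complex.I * k * (p.1 * bracket p.2 : ℝ))
            + (Complex.I * k * (p.1 * bracket p.2 : ℝ)) ^ 2) := by fun_prop
      exact (h4.mul (Complex.continuous_ofReal.comp h2)).mul (by fun_prop)
    refine tendsto_integral_filter_of_dominated_convergence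
      (fun v => C * bracket v ^ (-5 : ℝ) * M) ?_ ?_
      (((integrable_bracket_rpow (by norm_num)).const_mul C).mul_const M) ?_
    · exact Eventually.of_forall fun δ =>
        (hcont.comp (Continuous.prodMk_right δ)).aestronglyMeasurable
    · filter_upwards [self_mem_nhdsWithin] with δ hδ
      refine Eventually.of_forall fun v => ?_
      rw [norm_mul]
      exact mul_le_mul (hC δ (le_of_lt hδ) v) (hM _) (norm_nonneg _)
        ((norm_nonneg _).trans (hC δ (le_of_lt hδ) v))
    · refine Eventually.of_forall fun v => ?_
      have := (hcont.comp (Continuous.prodMk_left v)).tendsto 0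
      exact this.mono_left nhdsWithin_le_nhds
  have hE : (fun δ : ℝ => ∫ y, helm k (regDist x δ y) * ψ y) =ᶠ[𝓝[>] 0]
      fun δ => ∫ v, helmProfile k δ v * φ (x + δ • v) := by
    filter_upwards [self_mem_nhdsWithin] with δ hδ
    rw [← integral_helmDD_eq k hδ, ← integral_helm_regDist hk.le hδ]
    simp only [hψ']
  simp only [hψ']
  rw [tendsto_nhds_unique (hL.congr' hE) hR]
  simp only [helmProfile_zero, zero_smul, add_zero, integral_mul_const, integral_complex_ofReal]
  rfl

/-! ### Pointwise bounds for the free resolvent -/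

/-- The free resolvent `(-Δ - z)⁻¹` on Schwartz functions. -/
noncomputable def resSchwartz (z : ℂ) : 𝓢(E3, ℂ) →L[ℂ] 𝓢(E3, ℂ) :=
  SchwartzMap.fourierMultiplierCLM ℂ (resSymbol z)

lemma fm_resSymbol_toH {z : ℂ} (hz : z.im ≠ 0) (h : 𝓢(E3, ℂ)) :
    fm (resSymbol z) (toH h) = toH (resSchwartz z h) :=
  fm_toH (bddMeas_resSymbol hz) (hasTemperateGrowth_resSymbol hz) h

lemma hasTemperateGrowth_norm_sq_sub (z : ℂ) :
    (fun ξ : E3 => ((4 * Real.pi ^ 2 * ‖ξ‖ ^ 2 : ℝ) : ℂ) - z).HasTemperateGrowth := by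
  have h0 := Function.hasTemperateGrowth_norm_sq E3
  have h1 : (fun ξ : E3 => ((4 * Real.pi ^ 2 * ‖ξ‖ ^ 2 : ℝ) : ℂ)).HasTemperateGrowth :=
    Function.Complex.hasTemperateGrowth_ofReal.comp (by fun_prop)
  exact h1.sub (Function.HasTemperateGrowth.const z)

lemma helmholtz_eq_multiplier (z : ℂ) (h : 𝓢(E3, ℂ)) :
    -(Laplacian.laplacian h) - z • h = SchwartzMap.fourierMultiplierCLM ℂ
      (fun ξ => ((4 * Real.pi ^ 2 * ‖ξ‖ ^ 2 : ℝ) : ℂ) - z) h := by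
  have t1 : (fun ξ : E3 => ((4 * Real.pi ^ 2 * ‖ξ‖ ^ 2 : ℝ) : ℂ)).HasTemperateGrowth := by
    simpa using hasTemperateGrowth_norm_sq_sub 0
  have t2 : (fun _ : E3 => z).HasTemperateGrowth := Function.HasTemperateGrowth.const z
  have e1 := SchwartzMap.smulLeftCLM_sub (F := ℂ) t1 t2
  have e2 : z • h = SchwartzMap.fourierMultiplierCLM ℂ (fun _ : E3 => z) h := by
    rw [SchwartzMap.fourierMultiplierCLM_const]
    rfl
  rw [laplacian_eq_multiplier, e2, SchwartzMap.fourierMultiplierCLM_apply,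
    SchwartzMap.fourierMultiplierCLM_apply, SchwartzMap.fourierMultiplierCLM_apply]
  refine (map_sub (FourierTransform.fourierInvCLM ℂ 𝓢(E3, ℂ)) _ _).symm.trans ?_
  rw [← sub_apply, ← e1]
  rfl

/-- The Fourier multiplier `m(D)`, composed with `-Δ - z`. -/
lemma fourierMultiplierCLM_helmholtz (z : ℂ) {m : E3 → ℂ} (hm : m.HasTemperateGrowth)
    (h : 𝓢(E3, ℂ)) :
    SchwartzMap.fourierMultiplierCLM ℂ m (-(Laplacian.laplacian h) - z • h)
      = SchwartzMap.fourierMultiplierCLM ℂ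
        (fun ξ => m ξ * (((4 * Real.pi ^ 2 * ‖ξ‖ ^ 2 : ℝ) : ℂ) - z)) h := by
  rw [helmholtz_eq_multiplier,
    SchwartzMap.fourierMultiplierCLM_fourierMultiplierCLM_apply hm (hasTemperateGrowth_norm_sq_sub z)]
  rfl

lemma resSchwartz_equation {z : ℂ} (hz : z.im ≠ 0) (h : 𝓢(E3, ℂ)) :
    -(Laplacian.laplacian (resSchwartz z h)) - z • resSchwartz z h = h := by
  rw [helmholtz_eq_multiplier, resSchwartz,
    SchwartzMap.fourierMultiplierCLM_fourierMultiplierCLM_apply (hasTemperateGrowth_norm_sq_sub z)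
    (hasTemperateGrowth_resSymbol hz)]
  have : (fun ξ : E3 => ((4 * Real.pi ^ 2 * ‖ξ‖ ^ 2 : ℝ) : ℂ) - z) * resSymbol z = fun _ => 1 := by
    ext ξ
    exact mul_resSymbol hz ξ
  rw [this, SchwartzMap.fourierMultiplierCLM_const, one_smul]
  rfl

/-- The kernel of the free resolvent is `e^{ik|x-y|}/|x-y|`, up to a constant. -/
lemma resSchwartz_eq_integral {k : ℂ} (hk : 0 < k.im) (hz : (k ^ 2).im ≠ 0) (h : 𝓢(E3, ℂ)) (x : E3) :
    resSchwartz (k ^ 2) h x = (helmConst : ℂ)⁻¹ * ∫ y, helm k ‖y - x‖ * h y := by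
  have h0 : (helmConst : ℂ) ≠ 0 := by exact_mod_cast helmConst_pos.ne'
  have h1 := integral_helm_mul hk x (resSchwartz (k ^ 2) h)
  have h2 : ∀ y, -(Laplacian.laplacian (resSchwartz (k ^ 2) h) y) - k ^ 2 * resSchwartz (k ^ 2) h y
      = h y := fun y => by
    have := congrArg (fun f : 𝓢(E3, ℂ) => f y) (resSchwartz_equation hz h)
    simpa using this
  simp only [h2] at h1
  rw [h1, inv_mul_cancel_left₀ h0]

lemma exists_sqrt {z : ℂ} (hz : z.im ≠ 0) : ∃ k : ℂ, 0 < k.im ∧ k ^ 2 = z := by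
  obtain ⟨k, hk⟩ := IsAlgClosed.exists_pow_nat_eq z (n := 2) (by norm_num)
  have h0 : k.im ≠ 0 := fun h => hz (by rw [← hk, sq, Complex.mul_im, h]; ring)
  rcases lt_or_gt_of_ne h0 with h | h
  · exact ⟨-k, by simpa using h, by rw [neg_sq, hk]⟩
  · exact ⟨k, h, hk⟩

lemma measurable_helm (k : ℂ) : Measurable (helm k) := by
  unfold helm
  fun_prop

lemma integrable_helm_mul {k : ℂ} (hk : 0 < k.im) (x : E3) (h : 𝓢(E3, ℂ)) :
    Integrable fun y => helm k ‖y - x‖ * h y := by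
  refine (integrable_inv_norm_sub_mul x h).mono' ?_ (Eventually.of_forall fun y => ?_)
  · exact (((measurable_helm k).comp (measurable_id.sub_const x).norm).mul
      h.continuous.measurable).aestronglyMeasurable
  · rw [norm_mul]
    gcongr
    exact norm_helm_le hk.le (norm_nonneg _)

/-- The kernel bound `|x - y|⁻¹`, uniform in the spectral parameter. -/
lemma enorm_resSchwartz_le {z : ℂ} (hz : z.im ≠ 0) (h : 𝓢(E3, ℂ)) (x : E3) :
    ‖resSchwartz z h x‖ₑ ≤ ENNReal.ofReal helmConst⁻¹
      * ∫⁻ y, ENNReal.ofReal ‖y - x‖⁻¹ * ‖h y‖ₑ := by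
  obtain ⟨k, hk, rfl⟩ := exists_sqrt hz
  rw [resSchwartz_eq_integral hk hz, enorm_mul]
  gcongr
  · rw [← Complex.ofReal_inv, ← ofReal_norm, Complex.norm_real,
      Real.norm_of_nonneg (inv_nonneg.2 helmConst_pos.le)]
  · refine (enorm_integral_le_lintegral_enorm _).trans (lintegral_mono fun y => ?_)
    rw [enorm_mul]
    gcongr
    rw [← ofReal_norm]
    exact ENNReal.ofReal_le_ofReal (norm_helm_le hk.le (norm_nonneg _))

lemma norm_exp_sub_exp_le {a b : ℂ} (ha : a.re ≤ 0) (hb : b.re ≤ 0) :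
    ‖Complex.exp a - Complex.exp b‖ ≤ ‖a - b‖ := by
  have h := Convex.norm_image_sub_le_of_norm_hasDerivWithin_le (𝕜 := ℂ) (f := Complex.exp)
    (f' := Complex.exp) (s := {w : ℂ | w.re ≤ 0}) (C := 1)
    (fun w _ => (Complex.hasDerivAt_exp w).hasDerivWithinAt)
    (fun w hw => by rw [Complex.norm_exp]; exact Real.exp_le_one_iff.2 hw)
    (convex_halfSpace_re_le 0) hb ha
  simpa using h

lemma norm_helm_sub_le {k k' : ℂ} (hk : 0 ≤ k.im) (hk' : 0 ≤ k'.im) {s : ℝ} (hs : 0 ≤ s) :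
    ‖helm k s - helm k' s‖ ≤ ‖k - k'‖ := by
  rcases hs.eq_or_lt with h0 | h0
  · simp [helm, ← h0]
  · rw [helm, helm, ← sub_div, norm_div, Complex.norm_real, Real.norm_of_nonneg hs, div_le_iff₀ h0]
    refine (norm_exp_sub_exp_le (by simpa using mul_nonneg hk hs)
      (by simpa using mul_nonneg hk' hs)).trans (le_of_eq ?_)
    rw [← sub_mul, ← mul_sub, norm_mul, norm_mul, Complex.norm_I, one_mul, Complex.norm_real,
      Real.norm_of_nonneg hs]

lemma norm_resSchwartz_sub_le {k k' : ℂ} (hk : 0 < k.im) (hk' : 0 < k'.im) (hz : (k ^ 2).im ≠ 0)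
    (hz' : (k' ^ 2).im ≠ 0) (h : 𝓢(E3, ℂ)) (x : E3) :
    ‖resSchwartz (k ^ 2) h x - resSchwartz (k' ^ 2) h x‖
      ≤ helmConst⁻¹ * (∫ y, ‖h y‖) * ‖k - k'‖ := by
  rw [resSchwartz_eq_integral hk hz, resSchwartz_eq_integral hk' hz', ← mul_sub,
    ← integral_sub (integrable_helm_mul hk x h) (integrable_helm_mul hk' x h), norm_mul,
    ← Complex.ofReal_inv, Complex.norm_real, Real.norm_of_nonneg (inv_nonneg.2 helmConst_pos.le),
    mul_assoc, mul_comm (∫ y, ‖h y‖), ← integral_const_mul]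
  refine mul_le_mul_of_nonneg_left ?_ (inv_nonneg.2 helmConst_pos.le)
  refine norm_integral_le_of_norm_le (h.integrable.norm.const_mul _) (Eventually.of_forall fun y => ?_)
  rw [← sub_mul, norm_mul]
  exact mul_le_mul_of_nonneg_right (norm_helm_sub_le hk.le hk'.le (norm_nonneg _)) (norm_nonneg _)

/-! ### Weighted bounds and limits on the real axis -/

/-- The modulus of the kernel of `⟨x⟩^{-σ} R₀(z) ⟨y⟩^{-s}`, up to a constant. -/
noncomputable def weightedKernel (σ s : ℝ) (x y : E3) : ℝ≥0∞ :=
  ENNReal.ofReal (bracket x ^ (-σ) * bracket y ^ (-s) * ‖y - x‖⁻¹)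

lemma measurable_bracket_rpow (s : ℝ) : Measurable fun x => bracket x ^ s :=
  (continuous_bracket_rpow s).measurable

lemma measurable_weightedKernel (σ s : ℝ) : Measurable (Function.uncurry (weightedKernel σ s)) := by
  have h1 : Measurable fun p : E3 × E3 => bracket p.1 ^ (-σ) :=
    (measurable_bracket_rpow (-σ)).comp measurable_fst
  have h2 : Measurable fun p : E3 × E3 => bracket p.2 ^ (-s) :=
    (measurable_bracket_rpow (-s)).comp measurable_snd
  have h3 : Measurable fun p : E3 × E3 => ‖p.2 - p.1‖⁻¹ := by fun_prop
  exact ((h1.mul h2).mul h3).ennreal_ofReal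

/-- Near the diagonal the weight in `y` is dropped; away from it, `|x - y|⁻¹ ≲ ⟨x⟩ ⟨y⟩⁻¹`. -/
lemma weightedKernel_sq_le {σ s : ℝ} (hσ : 4 ≤ σ) (hs : 0 ≤ s) (x y : E3) :
    weightedKernel σ s x y ^ 2
      ≤ ENNReal.ofReal (bracket x ^ (-8 : ℝ)) * ENNReal.ofReal (nearKernel (y - x))
        + ENNReal.ofReal (4 * bracket x ^ (-6 : ℝ)) * ENNReal.ofReal (bracket y ^ (-(2 * s + 2))) := by
  have hx := one_le_bracket x
  have hy := one_le_bracket y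
  have hx0 := bracket_pos x
  have hy0 := bracket_pos y
  have px : ∀ t : ℝ, 0 ≤ bracket x ^ t := fun t => Real.rpow_nonneg hx0.le t
  have py : ∀ t : ℝ, 0 ≤ bracket y ^ t := fun t => Real.rpow_nonneg hy0.le t
  have hn := nearKernel_nonneg (y - x)
  rw [weightedKernel, ← ENNReal.ofReal_pow (by positivity), ← ENNReal.ofReal_mul (px _),
    ← ENNReal.ofReal_mul (by positivity), ← ENNReal.ofReal_add (by positivity) (by positivity)]
  refine ENNReal.ofReal_le_ofReal ?_
  have h1 : bracket x ^ (-σ) ≤ bracket x ^ (-4 : ℝ) := Real.rpow_le_rpow_of_exponent_le hx (by linarith)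
  have h2 : bracket y ^ (-s) ≤ 1 := Real.rpow_le_one_of_one_le_of_nonpos hy (by linarith)
  by_cases h : ‖y - x‖ < 1
  · have e : nearKernel (y - x) = ‖y - x‖⁻¹ ^ 2 := Set.indicator_of_mem (by simpa using h) _
    have e8 : bracket x ^ (-8 : ℝ) = (bracket x ^ (-4 : ℝ)) ^ 2 := by
      rw [← Real.rpow_mul_natCast hx0.le]; norm_num
    have hle : bracket x ^ (-σ) * bracket y ^ (-s) * ‖y - x‖⁻¹
        ≤ bracket x ^ (-4 : ℝ) * 1 * ‖y - x‖⁻¹ := by gcongr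
    calc _ ≤ (bracket x ^ (-4 : ℝ) * 1 * ‖y - x‖⁻¹) ^ 2 := by gcongr
      _ = bracket x ^ (-8 : ℝ) * nearKernel (y - x) := by rw [e, e8]; ring
      _ ≤ _ := le_add_of_nonneg_right (by positivity)
  · have h' := not_lt.1 h
    have h3 : ‖y - x‖⁻¹ ≤ 2 * bracket x * (bracket y)⁻¹ := by
      rw [← div_eq_mul_inv, le_div_iff₀ hy0, inv_mul_le_iff₀ (by linarith)]
      have := bracket_le_add y x
      nlinarith
    have e6 : 4 * bracket x ^ (-6 : ℝ) * bracket y ^ (-(2 * s + 2))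
        = (bracket x ^ (-4 : ℝ) * bracket y ^ (-s) * (2 * bracket x * (bracket y)⁻¹)) ^ 2 := by
      have e1 : bracket x ^ (-6 : ℝ) = (bracket x ^ (-4 : ℝ) * bracket x) ^ 2 := by
        rw [← Real.rpow_add_one hx0.ne', ← Real.rpow_mul_natCast hx0.le]; norm_num
      have e2 : bracket y ^ (-(2 * s + 2)) = (bracket y ^ (-s) * (bracket y)⁻¹) ^ 2 := by
        rw [← Real.rpow_neg_one, ← Real.rpow_add hy0, ← Real.rpow_mul_natCast hy0.le]
        congr 1
        push_cast
        ring
      rw [e1, e2]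
      ring
    calc _ ≤ (bracket x ^ (-4 : ℝ) * bracket y ^ (-s) * (2 * bracket x * (bracket y)⁻¹)) ^ 2 := by
          gcongr
      _ = 4 * bracket x ^ (-6 : ℝ) * bracket y ^ (-(2 * s + 2)) := e6.symm
      _ ≤ _ := le_add_of_nonneg_left (by positivity)

lemma lintegral_ofReal_ne_top {f : E3 → ℝ} (hf : Integrable f) : ∫⁻ x, ENNReal.ofReal (f x) ≠ ∞ :=
  ne_top_of_le_ne_top hf.2.ne (lintegral_mono fun x => by
    rw [← ofReal_norm]
    exact ENNReal.ofReal_le_ofReal (Real.le_norm_self _))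

/-- The weighted resolvent has a finite Hilbert-Schmidt norm. -/
lemma lintegral_weightedKernel_sq_ne_top {σ s : ℝ} (hσ : 4 ≤ σ) (hs : 1 / 2 < s) :
    ∫⁻ x, ∫⁻ y, weightedKernel σ s x y ^ 2 ≠ ∞ := by
  have m1 : Measurable fun y : E3 => ENNReal.ofReal (nearKernel y) := measurable_nearKernel.ennreal_ofReal
  have m2 : Measurable fun y => ENNReal.ofReal (bracket y ^ (-(2 * s + 2))) :=
    (measurable_bracket_rpow _).ennreal_ofReal
  set I := ∫⁻ y, ENNReal.ofReal (nearKernel y) with hI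
  set J := ∫⁻ y, ENNReal.ofReal (bracket y ^ (-(2 * s + 2))) with hJ
  have hI' : I ≠ ∞ := lintegral_ofReal_ne_top integrable_nearKernel
  have hJ' : J ≠ ∞ := lintegral_ofReal_ne_top (integrable_bracket_rpow (by linarith))
  have h1 : ∀ x, ∫⁻ y, weightedKernel σ s x y ^ 2
      ≤ ENNReal.ofReal (bracket x ^ (-8 : ℝ)) * I + ENNReal.ofReal (4 * bracket x ^ (-6 : ℝ)) * J := by
    intro x
    refine (lintegral_mono fun y => weightedKernel_sq_le hσ (by linarith) x y).trans (le_of_eq ?_)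
    have m3 : Measurable fun y : E3 => ENNReal.ofReal (nearKernel (y - x)) :=
      m1.comp (measurable_id.sub_const x)
    rw [lintegral_add_left (m3.const_mul _), lintegral_const_mul _ m3, lintegral_const_mul _ m2,
      lintegral_sub_right_eq_self (fun y => ENNReal.ofReal (nearKernel y)) x]
  refine ne_top_of_le_ne_top ?_ (lintegral_mono h1)
  rw [lintegral_add_left ((measurable_bracket_rpow _).ennreal_ofReal.mul_const _),
    lintegral_mul_const _ (measurable_bracket_rpow _).ennreal_ofReal,
    lintegral_mul_const _ ((measurable_bracket_rpow _).const_mul 4).ennreal_ofReal]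
  refine ENNReal.add_ne_top.2 ⟨ENNReal.mul_ne_top ?_ hI', ENNReal.mul_ne_top ?_ hJ'⟩
  · exact lintegral_ofReal_ne_top (integrable_bracket_rpow (by norm_num))
  · exact lintegral_ofReal_ne_top ((integrable_bracket_rpow (by norm_num)).const_mul 4)

/-- The operator `⟨x⟩^{-σ} R₀(z) ⟨x⟩^{-s}`. -/
noncomputable def weightedRes (σ s : ℝ) (z : ℂ) : L2 →L[ℂ] L2 :=
  mulOp (weight (-σ)) ∘L fm (resSymbol z) ∘L mulOp (weight (-s))

lemma weightedRes_apply (σ s : ℝ) (z : ℂ) (f : L2) :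
    weightedRes σ s z f = mulOp (weight (-σ)) (fm (resSymbol z) (mulOp (weight (-s)) f)) := rfl

/-- The weighted free resolvent is bounded uniformly in the spectral parameter. -/
theorem exists_norm_weightedRes_le {σ s : ℝ} (hσ : 4 ≤ σ) (hs : 1 / 2 < s) :
    ∃ C : ℝ, 0 ≤ C ∧ ∀ z : ℂ, z.im ≠ 0 → ∀ f, ‖weightedRes σ s z f‖ ≤ C * ‖f‖ := by
  set Q := ∫⁻ x, ∫⁻ y, weightedKernel σ s x y ^ 2 with hQ
  have hQ' : Q ≠ ∞ := lintegral_weightedKernel_sq_ne_top hσ hs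
  have hc0 : 0 ≤ helmConst⁻¹ := inv_nonneg.2 helmConst_pos.le
  set C : ℝ := helmConst⁻¹ * Real.sqrt Q.toReal with hC
  have hC0 : 0 ≤ C := by positivity
  refine ⟨C, hC0, fun z hz f => ?_⟩
  refine denseRange_toH.induction_on (p := fun f => ‖weightedRes σ s z f‖ ≤ C * ‖f‖) f
    (isClosed_le (by fun_prop) (by fun_prop)) fun f => ?_
  have bs : BddMeas (weight (-s)) := bddMeas_weight (by linarith)
  have bσ : BddMeas (weight (-σ)) := bddMeas_weight (by linarith)
  set h := SchwartzMap.smulLeftCLM ℂ (weight (-s)) f with hh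
  have e1 : weightedRes σ s z (toH f) = mulOp (weight (-σ)) (toH (resSchwartz z h)) := by
    rw [weightedRes_apply, mulOp_toH bs (hasTemperateGrowth_weight _), fm_resSymbol_toH hz]
  have hhy : ∀ y, ‖h y‖ₑ = ENNReal.ofReal (bracket y ^ (-s)) * ‖f y‖ₑ := fun y => by
    rw [hh, SchwartzMap.smulLeftCLM_apply_apply (hasTemperateGrowth_weight _), smul_eq_mul, enorm_mul,
      ← ofReal_norm, norm_weight]
  have hpt : ∀ x, ‖weight (-σ) x * resSchwartz z h x‖ₑ
      ≤ ENNReal.ofReal helmConst⁻¹ * ∫⁻ y, weightedKernel σ s x y * ‖f y‖ₑ := by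
    intro x
    have px : 0 ≤ bracket x ^ (-σ) := Real.rpow_nonneg (bracket_pos x).le _
    rw [enorm_mul, ← ofReal_norm, norm_weight]
    calc _ ≤ ENNReal.ofReal (bracket x ^ (-σ)) * (ENNReal.ofReal helmConst⁻¹
          * ∫⁻ y, ENNReal.ofReal ‖y - x‖⁻¹ * ‖h y‖ₑ) := by
            gcongr
            exact enorm_resSchwartz_le hz h x
      _ = ENNReal.ofReal helmConst⁻¹ * ∫⁻ y, weightedKernel σ s x y * ‖f y‖ₑ := by
            rw [mul_left_comm, ← lintegral_const_mul' _ _ ENNReal.ofReal_ne_top]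
            congr 1
            refine lintegral_congr fun y => ?_
            rw [hhy, weightedKernel, ENNReal.ofReal_mul (mul_nonneg px
              (Real.rpow_nonneg (bracket_pos y).le _)), ENNReal.ofReal_mul px]
            ring
  rw [e1]
  refine L2.norm_le_of_lintegral_sq_le hC0 ?_
  calc ∫⁻ x, ‖(mulOp (weight (-σ)) (toH (resSchwartz z h)) : L2) x‖ₑ ^ 2
      ≤ ∫⁻ x, (ENNReal.ofReal helmConst⁻¹) ^ 2 * (∫⁻ y, weightedKernel σ s x y * ‖f y‖ₑ) ^ 2 := by
        refine lintegral_mono_ae ?_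
        filter_upwards [mulOp_ae bσ (toH (resSchwartz z h)), toH_ae (resSchwartz z h)] with x h1 h2
        rw [h1, h2, ← mul_pow]
        gcongr
        exact hpt x
    _ ≤ (ENNReal.ofReal helmConst⁻¹) ^ 2 * (Q * ∫⁻ y, ‖f y‖ₑ ^ 2) := by
        rw [lintegral_const_mul' _ _ (by finiteness)]
        gcongr
        exact lintegral_hilbertSchmidt_sq_le (measurable_weightedKernel σ s)
          f.continuous.enorm.measurable.aemeasurable
    _ = ENNReal.ofReal C ^ 2 * ∫⁻ y, ‖(toH f) y‖ₑ ^ 2 := by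
        have e2 : ∫⁻ y, ‖(toH f) y‖ₑ ^ 2 = ∫⁻ y, ‖f y‖ₑ ^ 2 :=
          lintegral_congr_ae ((toH_ae f).mono fun y hy => by simp only [hy])
        have e3 : ENNReal.ofReal (Real.sqrt Q.toReal) ^ 2 = Q := by
          rw [← ENNReal.ofReal_pow (Real.sqrt_nonneg _), Real.sq_sqrt ENNReal.toReal_nonneg,
            ENNReal.ofReal_toReal hQ']
        rw [e2, hC, ENNReal.ofReal_mul hc0, mul_pow, e3, mul_assoc]

/-- The weighted free resolvent tends to zero for high frequencies. The part of the input at bounded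
distance from the origin is controlled by the resolvent estimate on the scale of weights `⟨x⟩⁻¹`, the
remaining part by the room in the weight. -/
theorem exists_norm_weightedRes_le_small {σ s : ℝ} (hσ : 4 ≤ σ) (hs : 1 / 2 < s) {τ : ℝ} (hτ : 0 < τ) :
    ∃ μ₀ : ℝ, 1 ≤ μ₀ ∧ ∀ μ, μ₀ ≤ μ → ∀ η : ℝ, 0 < η →
      ∀ z : ℂ, z = ((2 * Real.pi * μ : ℝ) : ℂ) ^ 2 + Complex.I * η → ∀ f : L2,
      ‖weightedRes σ s z f‖ ≤ τ * ‖f‖ := by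
  obtain ⟨χ, C, hC, H⟩ := exists_resolvent_bounds
  obtain ⟨μ₁, hμ₁, H⟩ := H 1 le_rfl
  set s' : ℝ := (s + 1 / 2) / 2 with hs'
  have hss : s' < s := by rw [hs']; linarith
  obtain ⟨C', hC', H'⟩ := exists_norm_weightedRes_le hσ (s := s') (by rw [hs']; linarith)
  obtain ⟨R, hR1, hR⟩ : ∃ R : ℝ, 1 ≤ R ∧ C' * R ^ (-(s - s')) ≤ τ / 2 := by
    have h1 : Tendsto (fun R : ℝ => C' * R ^ (-(s - s'))) atTop (𝓝 (C' * 0)) :=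
      (tendsto_rpow_neg_atTop (sub_pos.2 hss)).const_mul _
    rw [mul_zero] at h1
    obtain ⟨R, h2, h3⟩ := ((h1.eventually_le_const (half_pos hτ)).and (eventually_ge_atTop 1)).exists
    exact ⟨R, h3, h2⟩
  set S : Set E3 := {y | bracket y ≤ R} with hS
  have hSm : MeasurableSet S := measurableSet_le continuous_bracket.measurable measurable_const
  set g₁ : E3 → ℂ := S.indicator (weight (1 - s)) with hg₁
  set g₂ : E3 → ℂ := Sᶜ.indicator (weight (s' - s)) with hg₂
  have b₁ : ∀ y, ‖g₁ y‖ ≤ R := fun y => by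
    by_cases hy : y ∈ S
    · rw [hg₁, Set.indicator_of_mem hy, norm_weight]
      calc bracket y ^ (1 - s) ≤ bracket y ^ (1 : ℝ) :=
            Real.rpow_le_rpow_of_exponent_le (one_le_bracket y) (by linarith)
        _ ≤ R := by rw [Real.rpow_one]; exact hy
    · rw [hg₁, Set.indicator_of_notMem hy, norm_zero]
      linarith
  have b₂ : ∀ y, ‖g₂ y‖ ≤ R ^ (-(s - s')) := fun y => by
    by_cases hy : y ∈ S
    · rw [hg₂, Set.indicator_of_notMem (by simpa using hy), norm_zero]
      positivity
    · rw [hg₂, Set.indicator_of_mem (by simpa using hy), norm_weight, neg_sub]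
      exact Real.rpow_le_rpow_of_nonpos (by linarith) (not_le.1 hy).le (by linarith)
  have m₁ : BddMeas g₁ := ⟨(continuous_weight _).measurable.indicator hSm, _, b₁⟩
  have m₂ : BddMeas g₂ := ⟨(continuous_weight _).measurable.indicator hSm.compl, _, b₂⟩
  have hsplit : weight (-s) = fun y => weight (-1) y * g₁ y + weight (-s') y * g₂ y := by
    ext y
    by_cases hy : y ∈ S
    · rw [hg₁, hg₂, Set.indicator_of_mem hy, Set.indicator_of_notMem (by simpa using hy), weight_mul]
      ring_nf
    · rw [hg₁, hg₂, Set.indicator_of_notMem hy, Set.indicator_of_mem (by simpa using hy), weight_mul]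
      ring_nf
  have bs' : BddMeas (weight (-s')) := bddMeas_weight (by linarith)
  have hσ1 : (fun x => weight (1 - σ) x * weight (-1) x) = weight (-σ) := by
    ext x
    rw [weight_mul]
    ring_nf
  refine ⟨max μ₁ (2 * (C * R) / τ), hμ₁.trans (le_max_left _ _), fun μ hμ η hη z hz f => ?_⟩
  have hμ0 : 0 < μ := by linarith [(le_max_left _ _).trans hμ]
  have e : weightedRes σ s z f
      = mulOp (weight (1 - σ)) (resOp z (mulOp g₁ f)) + weightedRes σ s' z (mulOp g₂ f) := by
    rw [weightedRes_apply, hsplit, mulOp_add (bddMeas_weight_neg_one.mul m₁) (bs'.mul m₂),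
      ← mulOp_mulOp bddMeas_weight_neg_one m₁, ← mulOp_mulOp bs' m₂, map_add, map_add,
      weightedRes_apply, resOp, sandwich_apply,
      mulOp_mulOp (bddMeas_weight (by linarith)) bddMeas_weight_neg_one, hσ1]
  have hzim : z.im ≠ 0 := by
    rw [hz, im_sq_add_I_mul]
    exact hη.ne'
  have h1 : ‖mulOp (weight (1 - σ)) (resOp z (mulOp g₁ f))‖ ≤ C / μ * (R * ‖f‖) := by
    refine (norm_mulOp_apply_le (bddMeas_weight (by linarith)) (norm_weight_le_one (by linarith)) _).trans ?_
    rw [one_mul]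
    refine ((H μ ((le_max_left _ _).trans hμ) η hη z hz _).2.2.2).trans ?_
    gcongr
    exact norm_mulOp_apply_le m₁ b₁ f
  have h2 : ‖weightedRes σ s' z (mulOp g₂ f)‖ ≤ C' * (R ^ (-(s - s')) * ‖f‖) := by
    refine (H' z hzim _).trans ?_
    gcongr
    exact norm_mulOp_apply_le m₂ b₂ f
  have h3 : C / μ * R ≤ τ / 2 := by
    have := (div_le_iff₀ hτ).1 ((le_max_right _ _).trans hμ)
    rw [div_mul_eq_mul_div, div_le_iff₀ hμ0]
    linarith
  rw [e]
  calc _ ≤ C / μ * (R * ‖f‖) + C' * (R ^ (-(s - s')) * ‖f‖) := norm_add_le_of_le h1 h2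
    _ = (C / μ * R + C' * R ^ (-(s - s'))) * ‖f‖ := by ring
    _ ≤ τ * ‖f‖ := by gcongr; linarith

/-- The square root in the upper half plane of a point just above `l²`. -/
lemma exists_sqrt_near {l η : ℝ} (hl : 0 < l) (hη : 0 < η) :
    ∃ k : ℂ, 0 < k.im ∧ k ^ 2 = (l : ℂ) ^ 2 + Complex.I * η ∧ ‖k - l‖ ≤ η / l := by
  have him := im_sq_add_I_mul l η
  obtain ⟨k, hk, hk2⟩ := exists_sqrt (z := (l : ℂ) ^ 2 + Complex.I * η) (by rw [him]; exact hη.ne')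
  refine ⟨k, hk, hk2, ?_⟩
  have hre : 0 < k.re := by
    rw [← hk2, sq, Complex.mul_im] at him
    by_contra! h
    nlinarith
  have h1 : (k - l) * (k + l) = Complex.I * η := by linear_combination hk2
  have h2 : l ≤ ‖k + l‖ := by
    refine le_trans ?_ (Complex.re_le_norm _)
    rw [Complex.add_re, Complex.ofReal_re]
    linarith
  have h3 : ‖k - l‖ * ‖k + l‖ = η := by
    rw [← norm_mul, h1, norm_mul, Complex.norm_I, Complex.norm_real, Real.norm_of_nonneg hη.le, one_mul]
  rw [le_div_iff₀ hl]
  calc ‖k - l‖ * l ≤ ‖k - l‖ * ‖k + l‖ := by gcongr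
    _ = η := h3

lemma memLp_weight {σ : ℝ} (hσ : 3 / 2 < σ) : MemLp (weight (-σ)) 2 volume := by
  refine memLp_two_of_lintegral_sq_ne_top (continuous_weight _).aestronglyMeasurable ?_
  have : ∀ x, ‖weight (-σ) x‖ₑ ^ 2 = ENNReal.ofReal (bracket x ^ (-(2 * σ))) := fun x => by
    rw [← ofReal_norm, norm_weight, ← ENNReal.ofReal_pow (Real.rpow_nonneg (bracket_pos x).le _),
      ← Real.rpow_mul_natCast (bracket_pos x).le]
    congr 2
    push_cast
    ring
  simp_rw [this]
  exact lintegral_ofReal_ne_top (integrable_bracket_rpow (by linarith))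

/-- The limiting absorption principle for Schwartz functions: the kernels `e^{ik|x-y|} / |x-y|` depend
on `k` in a Lipschitz way. -/
lemma exists_tendsto_fm_resSymbol {l σ : ℝ} (hl : 0 < l) (hσ : 3 / 2 < σ) (h : 𝓢(E3, ℂ)) :
    ∃ v : L2, Tendsto (fun η : ℝ => mulOp (weight (-σ))
      (fm (resSymbol ((l : ℂ) ^ 2 + Complex.I * η)) (toH h))) (𝓝[>] 0) (𝓝 v) := by
  set F : ℝ → L2 := fun η => mulOp (weight (-σ)) (fm (resSymbol ((l : ℂ) ^ 2 + Complex.I * η)) (toH h))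
    with hF
  set w : L2 := (memLp_weight hσ).toLp with hw
  set D : ℝ := helmConst⁻¹ * (∫ y, ‖h y‖) with hD
  have hD0 : 0 ≤ D := mul_nonneg (inv_nonneg.2 helmConst_pos.le) (integral_nonneg fun _ => norm_nonneg _)
  have bσ : BddMeas (weight (-σ)) := bddMeas_weight (by linarith)
  have key : ∀ η η' : ℝ, 0 < η → 0 < η' → ‖F η - F η'‖ ≤ D * (η / l + η' / l) * ‖w‖ := by
    intro η η' hη hη'
    obtain ⟨k, hk, hk2, hkl⟩ := exists_sqrt_near hl hη
    obtain ⟨k', hk', hk2', hkl'⟩ := exists_sqrt_near hl hη'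
    have i1 : (k ^ 2).im ≠ 0 := by rw [hk2, im_sq_add_I_mul]; exact hη.ne'
    have i2 : (k' ^ 2).im ≠ 0 := by rw [hk2', im_sq_add_I_mul]; exact hη'.ne'
    have e : F η - F η' = mulOp (weight (-σ)) (toH (resSchwartz (k ^ 2) h - resSchwartz (k' ^ 2) h)) := by
      simp only [hF]
      rw [← hk2, ← hk2', fm_resSymbol_toH i1, fm_resSymbol_toH i2, ← map_sub, ← map_sub]
    have hkk : ‖k - k'‖ ≤ η / l + η' / l := by
      calc ‖k - k'‖ = ‖(k - l) - (k' - l)‖ := by ring_nf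
        _ ≤ _ := (norm_sub_le _ _).trans (add_le_add hkl hkl')
    rw [e]
    refine Lp.norm_le_mul_norm_of_ae_le_mul ?_
    filter_upwards [mulOp_ae bσ (toH (resSchwartz (k ^ 2) h - resSchwartz (k' ^ 2) h)),
      toH_ae (resSchwartz (k ^ 2) h - resSchwartz (k' ^ 2) h), (memLp_weight hσ).coeFn_toLp] with x h1 h2 h3
    rw [h1, h2, hw, h3, norm_mul, mul_comm]
    gcongr
    refine (norm_resSchwartz_sub_le hk hk' i1 i2 h x).trans ?_
    gcongr
  have hc : Cauchy (map F (𝓝[>] 0)) := by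
    refine Metric.cauchy_iff.2 ⟨inferInstance, fun ε hε => ?_⟩
    set r : ℝ := ε * l / (2 * (D * ‖w‖ + 1)) with hr
    have hr0 : 0 < r := by positivity
    refine ⟨F '' Set.Ioo 0 r, image_mem_map (Ioo_mem_nhdsGT hr0), ?_⟩
    rintro _ ⟨η, hη, rfl⟩ _ ⟨η', hη', rfl⟩
    rw [dist_eq_norm]
    refine (key η η' hη.1 hη'.1).trans_lt ?_
    have h1 : η / l + η' / l < ε / (D * ‖w‖ + 1) := by
      rw [← add_div, div_lt_iff₀ hl]
      have : ε / (D * ‖w‖ + 1) * l = 2 * r := by rw [hr]; field_simp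
      linarith [hη.2, hη'.2]
    have h2 : 0 ≤ η / l + η' / l := by have := hη.1; have := hη'.1; positivity
    calc D * (η / l + η' / l) * ‖w‖ = D * ‖w‖ * (η / l + η' / l) := by ring
      _ ≤ D * ‖w‖ * (ε / (D * ‖w‖ + 1)) := by gcongr
      _ < (D * ‖w‖ + 1) * (ε / (D * ‖w‖ + 1)) := by
          have : 0 < ε / (D * ‖w‖ + 1) := by positivity
          nlinarith
      _ = ε := mul_div_cancel₀ _ (by positivity)
  exact CompleteSpace.complete hc

section limits

variable {H : Type*} [NormedAddCommGroup H] [NormedSpace ℂ H] {F : Filter ℝ}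
  {S : ℝ → H →L[ℂ] H} {M : ℝ}

/-- A uniformly bounded family of operators that converges on a dense set converges strongly. -/
lemma exists_clm_tendsto [CompleteSpace H] [F.NeBot] (hM : 0 ≤ M) (hb : ∀ᶠ η in F, ∀ f, ‖S η f‖ ≤ M * ‖f‖)
    {ι : Type*} {e : ι → H} (he : DenseRange e)
    (hlim : ∀ i, ∃ v, Tendsto (fun η => S η (e i)) F (𝓝 v)) :
    ∃ T : H →L[ℂ] H, ∀ f, Tendsto (fun η => S η f) F (𝓝 (T f)) := by
  have h1 : ∀ f, ∃ v, Tendsto (fun η => S η f) F (𝓝 v) := by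
    intro f
    refine CompleteSpace.complete (f := map (fun η => S η f) F)
      (Metric.cauchy_iff.2 ⟨inferInstance, fun ε hε => ?_⟩)
    obtain ⟨i, hi⟩ := he.exists_dist_lt f (ε := ε / (4 * (M + 1))) (by positivity)
    obtain ⟨v, hv⟩ := hlim i
    have h2 : M * ‖f - e i‖ ≤ ε / 4 := by
      rw [dist_eq_norm] at hi
      calc M * ‖f - e i‖ ≤ (M + 1) * (ε / (4 * (M + 1))) := by
            gcongr
            linarith
        _ = ε / 4 := by field_simp
    have h3 : ∀ᶠ η in F, dist (S η f) v < ε / 2 := by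
      filter_upwards [hb, Metric.tendsto_nhds.1 hv (ε / 4) (by positivity)] with η h4 h5
      calc dist (S η f) v ≤ dist (S η f) (S η (e i)) + dist (S η (e i)) v := dist_triangle _ _ _
        _ < ε / 4 + ε / 4 := by
            refine add_lt_add_of_le_of_lt ?_ h5
            rw [dist_eq_norm, ← map_sub]
            exact (h4 _).trans h2
        _ = ε / 2 := by ring
    refine ⟨_, image_mem_map h3, ?_⟩
    rintro _ ⟨η, hη, rfl⟩ _ ⟨η', hη', rfl⟩
    calc dist (S η f) (S η' f) ≤ dist (S η f) v + dist (S η' f) v := dist_triangle_right _ _ _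
      _ < ε / 2 + ε / 2 := add_lt_add hη hη'
      _ = ε := by ring
  choose T hT using h1
  refine ⟨LinearMap.mkContinuous
    { toFun := T
      map_add' := fun f g => tendsto_nhds_unique (hT (f + g)) (by simpa using (hT f).add (hT g))
      map_smul' := fun c f => tendsto_nhds_unique (hT (c • f)) (by simpa using (hT f).const_smul c) }
    M fun f => ?_, hT⟩
  exact le_of_tendsto (hT f).norm (hb.mono fun η hη => hη f)

/-- Strong convergence of a uniformly bounded family passes to powers. -/
lemma tendsto_pow_apply {T : H →L[ℂ] H} (hb : ∀ᶠ η in F, ∀ f, ‖S η f‖ ≤ M * ‖f‖)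
    (hT : ∀ f, Tendsto (fun η => S η f) F (𝓝 (T f))) (m : ℕ) (f : H) :
    Tendsto (fun η => (S η ^ m) f) F (𝓝 ((T ^ m) f)) := by
  induction m with
  | zero => simpa using tendsto_const_nhds
  | succ m ih =>
    simp only [pow_succ', mul_apply_eq_comp]
    rw [tendsto_iff_norm_sub_tendsto_zero] at ih ⊢
    have h1 := tendsto_iff_norm_sub_tendsto_zero.1 (hT ((T ^ m) f))
    have h2 : Tendsto (fun η => M * ‖(S η ^ m) f - (T ^ m) f‖
        + ‖S η ((T ^ m) f) - T ((T ^ m) f)‖) F (𝓝 0) := by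
      simpa using (ih.const_mul M).add h1
    refine squeeze_zero' (Eventually.of_forall fun _ => norm_nonneg _) ?_ h2
    filter_upwards [hb] with η hη
    calc _ = ‖S η ((S η ^ m) f - (T ^ m) f) + (S η ((T ^ m) f) - T ((T ^ m) f))‖ := by
          rw [map_sub]; abel_nf
      _ ≤ _ := norm_add_le_of_le (hη _) le_rfl

end limits

lemma fm_derivSymbol_mul_toH {z : ℂ} (hz : z.im ≠ 0) (v : E3) (h : 𝓢(E3, ℂ)) :
    fm (fun ξ => derivSymbol v ξ * resSymbol z ξ) (toH h) = fm (resSymbol z) (toH (∂_{v} h)) := by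
  rw [fm_toH (bddMeas_derivSymbol_mul_resSymbol hz v)
    ((hasTemperateGrowth_derivSymbol v).mul (hasTemperateGrowth_resSymbol hz)),
    fm_resSymbol_toH hz, lineDeriv_eq_multiplier, resSchwartz,
    SchwartzMap.fourierMultiplierCLM_fourierMultiplierCLM_apply (hasTemperateGrowth_resSymbol hz)
      (hasTemperateGrowth_derivSymbol v), mul_comm]
  rfl

/-- The limiting absorption principle for the free resolvent. -/
lemma exists_clm_tendsto_weightedRes {l σ s : ℝ} (hl : 0 < l) (hσ : 4 ≤ σ) (hs : 1 / 2 < s) :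
    ∃ T : L2 →L[ℂ] L2, ∀ f, Tendsto (fun η : ℝ => weightedRes σ s ((l : ℂ) ^ 2 + Complex.I * η) f)
      (𝓝[>] 0) (𝓝 (T f)) := by
  obtain ⟨C, hC, H⟩ := exists_norm_weightedRes_le hσ hs
  refine exists_clm_tendsto hC ?_ denseRange_toH fun h => ?_
  · filter_upwards [self_mem_nhdsWithin] with η hη
    exact H _ (by rw [im_sq_add_I_mul]; exact (Set.mem_Ioi.1 hη).ne')
  · obtain ⟨v, hv⟩ := exists_tendsto_fm_resSymbol hl (σ := σ) (by linarith)
      (SchwartzMap.smulLeftCLM ℂ (weight (-s)) h)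
    refine ⟨v, hv.congr fun η => ?_⟩
    rw [weightedRes_apply, mulOp_toH (bddMeas_weight (by linarith)) (hasTemperateGrowth_weight _)]

/-- The limiting absorption principle for the gradient of the free resolvent. -/
lemma exists_clm_tendsto_resGrad {l σ C : ℝ} (hl : 0 < l) (hσ : 4 ≤ σ) (hC : 0 ≤ C) (a : Fin 3)
    (H : ∀ η : ℝ, 0 < η → ∀ f, ‖resGrad ((l : ℂ) ^ 2 + Complex.I * η) a f‖ ≤ C * ‖f‖) :
    ∃ T : L2 →L[ℂ] L2, ∀ f, Tendsto (fun η : ℝ => mulOp (weight (1 - σ))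
      (resGrad ((l : ℂ) ^ 2 + Complex.I * η) a f)) (𝓝[>] 0) (𝓝 (T f)) := by
  have b1 : BddMeas (weight (1 - σ)) := bddMeas_weight (by linarith)
  refine exists_clm_tendsto (S := fun η => mulOp (weight (1 - σ)) ∘L
    resGrad ((l : ℂ) ^ 2 + Complex.I * η) a) hC ?_ denseRange_toH fun h => ?_
  · filter_upwards [self_mem_nhdsWithin] with η hη f
    refine (norm_mulOp_apply_le b1 (norm_weight_le_one (by linarith)) _).trans ?_
    rw [one_mul]
    exact H η hη f
  · obtain ⟨v, hv⟩ := exists_tendsto_fm_resSymbol hl (σ := σ) (by linarith)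
      (∂_{basisVec a} (SchwartzMap.smulLeftCLM ℂ (weight (-1)) h))
    refine ⟨v, hv.congr' ?_⟩
    filter_upwards [self_mem_nhdsWithin] with η hη
    have hz : ((l : ℂ) ^ 2 + Complex.I * η).im ≠ 0 := by
      rw [im_sq_add_I_mul]
      exact (Set.mem_Ioi.1 hη).ne'
    have hσ1 : (fun x => weight (1 - σ) x * weight (-1) x) = weight (-σ) := by
      ext x
      rw [weight_mul]
      ring_nf
    rw [← fm_derivSymbol_mul_toH hz, ContinuousLinearMap.comp_apply, resGrad, sandwich_apply,
      mulOp_mulOp b1 bddMeas_weight_neg_one, hσ1,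
      mulOp_toH bddMeas_weight_neg_one (hasTemperateGrowth_weight _)]

/-! ### The weighted space and the distributional equation -/

lemma measurable_weightDensity (s : ℝ) :
    Measurable fun x : E3 => ENNReal.ofReal (bracket x ^ (2 * s)) :=
  (measurable_bracket_rpow _).ennreal_ofReal

lemma weightedMeasure_ac (s : ℝ) : weightedMeasure s ≪ volume :=
  withDensity_absolutelyContinuous _ _

lemma ac_weightedMeasure (s : ℝ) : (volume : Measure E3) ≪ weightedMeasure s :=
  withDensity_absolutelyContinuous' (measurable_weightDensity s).aemeasurable
    (Eventually.of_forall fun x => by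
      simpa using Real.rpow_pos_of_pos (bracket_pos x) _)

lemma eLpNorm_weight_mul (s : ℝ) (f : E3 → ℂ) :
    eLpNorm (fun x => weight s x * f x) 2 volume = eLpNorm f 2 (weightedMeasure s) := by
  have h : eLpNorm (fun x => weight s x * f x) 2 volume ^ 2 = eLpNorm f 2 (weightedMeasure s) ^ 2 := by
    rw [eLpNorm_two_sq, eLpNorm_two_sq, weightedMeasure,
      lintegral_withDensity_eq_lintegral_mul_non_measurable _ (measurable_weightDensity s)
        (Eventually.of_forall fun x => ENNReal.ofReal_lt_top)]
    refine lintegral_congr fun x => ?_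
    have hx := bracket_pos x
    rw [enorm_mul, mul_pow, ← ofReal_norm, norm_weight, ← ENNReal.ofReal_pow (by positivity),
      ← Real.rpow_mul_natCast hx.le, Pi.mul_apply, mul_comm s]
    rfl
  exact (ENNReal.pow_right_strictMono two_ne_zero).injective h

lemma weight_mul_weight_neg (s : ℝ) (x : E3) : weight s x * weight (-s) x = 1 := by
  rw [weight_mul, add_neg_cancel, weight_zero]

lemma memLp_weight_mul {s : ℝ} (f : WeightedL2 s) : MemLp (fun x => weight s x * f x) 2 volume :=
  ⟨(continuous_weight s).aestronglyMeasurable.mul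
    ((Lp.aestronglyMeasurable f).mono_ac (ac_weightedMeasure s)),
    (eLpNorm_weight_mul s f).trans_lt (Lp.eLpNorm_lt_top f)⟩

lemma memLp_weight_neg_mul (s : ℝ) (g : L2) :
    MemLp (fun x => weight (-s) x * g x) 2 (weightedMeasure s) :=
  ⟨(continuous_weight _).aestronglyMeasurable.mul
    ((Lp.aestronglyMeasurable g).mono_ac (weightedMeasure_ac s)), by
      rw [← eLpNorm_weight_mul]
      simp only [← mul_assoc, weight_mul_weight_neg, one_mul]
      exact Lp.eLpNorm_lt_top g⟩

/-- Multiplication by `⟨x⟩ˢ`, as an isometry of `L^{2,s}` onto `L²`. -/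
noncomputable def weightIso (s : ℝ) : WeightedL2 s ≃ₗᵢ[ℂ] L2 :=
  have h1 := memLp_weight_mul (s := s)
  have h2 := memLp_weight_neg_mul s
  { toFun := fun f => (h1 f).toLp
    invFun := fun g => (h2 g).toLp
    map_add' := fun f g => by
      refine Lp.ext ?_
      filter_upwards [(h1 (f + g)).coeFn_toLp, (h1 f).coeFn_toLp, (h1 g).coeFn_toLp,
        Lp.coeFn_add ((h1 f).toLp) ((h1 g).toLp), (ac_weightedMeasure s).ae_le (Lp.coeFn_add f g)]
        with x e1 e2 e3 e4 e5
      rw [e1, e4, Pi.add_apply, e2, e3, e5, Pi.add_apply, mul_add]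
    map_smul' := fun c f => by
      refine Lp.ext ?_
      filter_upwards [(h1 (c • f)).coeFn_toLp, (h1 f).coeFn_toLp,
        Lp.coeFn_smul c ((h1 f).toLp), (ac_weightedMeasure s).ae_le (Lp.coeFn_smul c f)]
        with x e1 e2 e3 e4
      rw [e1, RingHom.id_apply, e3, Pi.smul_apply, e2, e4, Pi.smul_apply, smul_eq_mul, smul_eq_mul,
        mul_left_comm]
    left_inv := fun f => by
      refine Lp.ext ?_
      filter_upwards [(h2 ((h1 f).toLp)).coeFn_toLp, (weightedMeasure_ac s).ae_le (h1 f).coeFn_toLp]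
        with x e1 e2
      rw [e1, e2, ← mul_assoc, mul_comm (weight (-s) x), weight_mul_weight_neg, one_mul]
    right_inv := fun g => by
      refine Lp.ext ?_
      filter_upwards [(h1 ((h2 g).toLp)).coeFn_toLp, (ac_weightedMeasure s).ae_le (h2 g).coeFn_toLp]
        with x e1 e2
      rw [e1, e2, ← mul_assoc, weight_mul_weight_neg, one_mul]
    norm_map' := fun f => by
      change ‖(h1 f).toLp‖ = ‖f‖
      rw [Lp.norm_toLp, Lp.norm_def, eLpNorm_weight_mul] }

lemma weightIso_ae (s : ℝ) (f : WeightedL2 s) : weightIso s f =ᵐ[volume] fun x => weight s x * f x :=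
  (memLp_weight_mul f).coeFn_toLp

lemma weightIso_symm_ae (s : ℝ) (g : L2) :
    (weightIso s).symm g =ᵐ[volume] fun x => weight (-s) x * g x :=
  (ac_weightedMeasure s).ae_le (memLp_weight_neg_mul s g).coeFn_toLp

/-- The complex conjugate of a Schwartz function. -/
noncomputable def conjSchwartz : 𝓢(E3, ℂ) →L[ℝ] 𝓢(E3, ℂ) :=
  SchwartzMap.postcompCLM (Complex.conjCLE : ℂ →L[ℝ] ℂ)

lemma conjSchwartz_apply (φ : 𝓢(E3, ℂ)) (x : E3) : conjSchwartz φ x = star (φ x) := rfl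

lemma conjSchwartz_smul (z : ℂ) (φ : 𝓢(E3, ℂ)) : conjSchwartz (z • φ) = star z • conjSchwartz φ := by
  ext x
  simp [conjSchwartz_apply]

lemma conjSchwartz_lineDeriv (v : E3) (φ : 𝓢(E3, ℂ)) :
    conjSchwartz (∂_{v} φ) = ∂_{v} (conjSchwartz φ) := by
  ext x
  have h := ((Complex.conjCLE : ℂ →L[ℝ] ℂ).hasFDerivAt.comp x (φ.differentiableAt (x := x)).hasFDerivAt).fderiv
  have e : ⇑(conjSchwartz φ) = (Complex.conjCLE : ℂ →L[ℝ] ℂ) ∘ φ := rfl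
  rw [SchwartzMap.lineDerivOp_apply_eq_fderiv, e, h, conjSchwartz_apply,
    SchwartzMap.lineDerivOp_apply_eq_fderiv]
  rfl

lemma conjSchwartz_laplacian (φ : 𝓢(E3, ℂ)) :
    conjSchwartz (Laplacian.laplacian φ) = Laplacian.laplacian (conjSchwartz φ) := by
  simp only [laplacian_eq_sum', map_sum, conjSchwartz_lineDeriv]

/-- The pairing of `L²` functions with Schwartz functions in terms of the inner product. -/
lemma integral_mul_schwartz (g : L2) (φ : 𝓢(E3, ℂ)) :
    Integrable (fun x => g x * φ x) ∧ ∫ x, g x * φ x = inner ℂ (toH (conjSchwartz φ)) g := by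
  have e : (fun x => inner ℂ (toH (conjSchwartz φ) x) (g x)) =ᵐ[volume] fun x => g x * φ x := by
    filter_upwards [toH_ae (conjSchwartz φ)] with x hx
    rw [hx, conjSchwartz_apply, RCLike.inner_apply]
    simp
  exact ⟨(L2.integrable_inner (𝕜 := ℂ) (toH (conjSchwartz φ)) g).congr e,
    by rw [L2.inner_def]; exact (integral_congr_ae e).symm⟩

lemma star_resSymbol (z : ℂ) (ξ : E3) : star (resSymbol z ξ) = resSymbol (star z) ξ := by
  simp [resSymbol]

lemma star_derivSymbol (v ξ : E3) : star (derivSymbol v ξ) = -derivSymbol v ξ := by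
  simp [derivSymbol]

lemma conjSchwartz_helmholtz (z : ℂ) (φ : 𝓢(E3, ℂ)) :
    conjSchwartz (-(Laplacian.laplacian φ) - z • φ)
      = -(Laplacian.laplacian (conjSchwartz φ)) - star z • conjSchwartz φ := by
  rw [map_sub, map_neg, conjSchwartz_smul, conjSchwartz_laplacian]

lemma inner_fm_right {m : E3 → ℂ} (h : BddMeas m) (f₁ f₂ : L2) :
    inner ℂ f₁ (fm m f₂) = inner ℂ (fm (fun x => star (m x)) f₁) f₂ := by
  rw [← inner_conj_symm, inner_fm_left h, inner_conj_symm]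

/-- `R₀(z) Q` is a distributional solution of the Helmholtz equation with right-hand side `Q`. -/
lemma inner_helmholtz_fm_resSymbol {z : ℂ} (hz : z.im ≠ 0) (φ : 𝓢(E3, ℂ)) (Q : L2) :
    inner ℂ (toH (conjSchwartz (-(Laplacian.laplacian φ) - z • φ))) (fm (resSymbol z) Q)
      = inner ℂ (toH (conjSchwartz φ)) Q := by
  have hz' : (star z).im ≠ 0 := by simpa using hz
  have e : (fun ξ => star (resSymbol z ξ)) = resSymbol (star z) := funext (star_resSymbol z)
  have e1 : (fun ξ : E3 => resSymbol (star z) ξ * (((4 * Real.pi ^ 2 * ‖ξ‖ ^ 2 : ℝ) : ℂ) - star z))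
      = fun _ => 1 := by
    ext ξ
    rw [mul_comm, mul_resSymbol hz']
  rw [inner_fm_right (bddMeas_resSymbol hz), e, conjSchwartz_helmholtz, fm_resSymbol_toH hz', resSchwartz,
    fourierMultiplierCLM_helmholtz _ (hasTemperateGrowth_resSymbol hz'), e1,
    SchwartzMap.fourierMultiplierCLM_const, one_smul]
  rfl

/-- `∂_v R₀(z) G` is a distributional solution of the Helmholtz equation with right-hand side `∂_v G`. -/
lemma inner_helmholtz_fm_derivSymbol {z : ℂ} (hz : z.im ≠ 0) (v : E3) (φ : 𝓢(E3, ℂ)) (G : L2) :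
    inner ℂ (toH (conjSchwartz (-(Laplacian.laplacian φ) - z • φ)))
        (fm (fun ξ => derivSymbol v ξ * resSymbol z ξ) G)
      = -inner ℂ (toH (conjSchwartz (∂_{v} φ))) G := by
  have hz' : (star z).im ≠ 0 := by simpa using hz
  have e : (fun ξ => star (derivSymbol v ξ * resSymbol z ξ))
      = fun ξ => -1 * (derivSymbol v ξ * resSymbol (star z) ξ) := by
    ext ξ
    rw [star_mul', star_resSymbol, star_derivSymbol]
    ring
  have hm := (hasTemperateGrowth_derivSymbol v).mul (hasTemperateGrowth_resSymbol hz')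
  have hb := bddMeas_derivSymbol_mul_resSymbol hz' v
  have e1 : (fun ξ : E3 => (derivSymbol v * resSymbol (star z)) ξ
      * (((4 * Real.pi ^ 2 * ‖ξ‖ ^ 2 : ℝ) : ℂ) - star z)) = derivSymbol v := by
    ext ξ
    rw [Pi.mul_apply, mul_assoc, mul_comm (resSymbol _ _), mul_resSymbol hz', mul_one]
  rw [inner_fm_right (bddMeas_derivSymbol_mul_resSymbol hz v), e, conjSchwartz_helmholtz,
    fm_smul hb, fm_toH hb hm]
  change inner ℂ ((-1 : ℂ) • toH (SchwartzMap.fourierMultiplierCLM ℂ (derivSymbol v * resSymbol (star z)) _)) G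
    = _
  rw [fourierMultiplierCLM_helmholtz _ hm, e1, ← lineDeriv_eq_multiplier, conjSchwartz_lineDeriv]
  simp

lemma fderiv_eq_sum (φ : 𝓢(E3, ℂ)) (x v : E3) :
    fderiv ℝ φ x v = ∑ a, (v a : ℂ) * (∂_{basisVec a} φ) x := by
  rw [← SchwartzMap.lineDerivOp_apply_eq_fderiv, lineDeriv_eq_sum, sum_apply]
  rfl

/-- The free resolvent applied to `L f`, where `L f = ∑_a 2i ∂_a (A_a f) + (V - i div A) f`. -/
theorem isFreeResolvent_magneticL {A : E3 → E3} {V : E3 → ℝ} {f : E3 → ℂ} {z : ℂ} (hz : z.im ≠ 0)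
    {G : Fin 3 → L2} {Q₁ Q₂ : L2} (hG : ∀ a, G a =ᵐ[volume] fun x => (A x a : ℂ) * f x)
    (hQ₁ : Q₁ =ᵐ[volume] fun x => (V x : ℂ) * f x)
    (hQ₂ : Q₂ =ᵐ[volume] fun x => (divergence A x : ℂ) * f x) {u : E3 → ℂ}
    (hu : u =ᵐ[volume] (∑ a, (2 * Complex.I) •
      fm (fun ξ => derivSymbol (basisVec a) ξ * resSymbol z ξ) (G a)
      + fm (resSymbol z) (Q₁ - Complex.I • Q₂) : L2)) :
    IsFreeResolvent z (magneticL A V f) u := by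
  set U : L2 := ∑ a, (2 * Complex.I) •
      fm (fun ξ => derivSymbol (basisVec a) ξ * resSymbol z ξ) (G a)
      + fm (resSymbol z) (Q₁ - Complex.I • Q₂) with hU
  refine ⟨(Lp.memLp U).ae_eq hu.symm, fun φ => ?_⟩
  have e1 : ∫ x, u x * (-(Laplacian.laplacian φ x) - z * φ x)
      = inner ℂ (toH (conjSchwartz (-(Laplacian.laplacian φ) - z • φ))) U := by
    rw [← (integral_mul_schwartz U _).2]
    refine integral_congr_ae ?_
    filter_upwards [hu] with x hx
    rw [hx]
    rfl
  have e2 : inner ℂ (toH (conjSchwartz (-(Laplacian.laplacian φ) - z • φ))) U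
      = ∑ a, 2 * Complex.I * -(∫ x, G a x * (∂_{basisVec a} φ) x)
        + ((∫ x, Q₁ x * φ x) - Complex.I * ∫ x, Q₂ x * φ x) := by
    rw [hU, inner_add_right, inner_sum, inner_helmholtz_fm_resSymbol hz, inner_sub_right,
      inner_smul_right, ← (integral_mul_schwartz Q₁ φ).2, ← (integral_mul_schwartz Q₂ φ).2]
    congr 1
    refine Finset.sum_congr rfl fun a _ => ?_
    rw [inner_smul_right, inner_helmholtz_fm_derivSymbol hz, ← (integral_mul_schwartz (G a) _).2]
  have eG : (fun x => ∑ a, G a x * (∂_{basisVec a} φ) x) =ᵐ[volume] fun x => f x * fderiv ℝ φ x (A x) := by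
    filter_upwards [eventually_all.2 hG] with x hx
    rw [fderiv_eq_sum, Finset.mul_sum]
    refine Finset.sum_congr rfl fun a _ => ?_
    rw [hx a]
    ring
  have e3 : ∑ a, ∫ x, G a x * (∂_{basisVec a} φ) x = ∫ x, f x * fderiv ℝ φ x (A x) := by
    rw [← integral_finsetSum _ fun a _ => (integral_mul_schwartz (G a) _).1]
    exact integral_congr_ae eG
  have iG : Integrable fun x => f x * fderiv ℝ φ x (A x) :=
    (integrable_finsetSum _ fun a _ => (integral_mul_schwartz (G a) _).1).congr eG
  have eQ : (fun x => Q₂ x * φ x) =ᵐ[volume] fun x => f x * (φ x * (divergence A x : ℂ)) := by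
    filter_upwards [hQ₂] with x hx
    rw [hx]
    ring
  have e4 : ∫ x, f x * (fderiv ℝ φ x (A x) + φ x * (divergence A x : ℂ))
      = (∫ x, f x * fderiv ℝ φ x (A x)) + ∫ x, Q₂ x * φ x := by
    rw [integral_congr_ae eQ, ← integral_add iG ((integral_mul_schwartz Q₂ φ).1.congr eQ)]
    simp only [mul_add]
  have e5 : ∫ x, (V x : ℂ) * f x * φ x = ∫ x, Q₁ x * φ x :=
    integral_congr_ae (by filter_upwards [hQ₁] with x hx; rw [hx])
  rw [e1, e2, magneticL, e4, e5, ← Finset.mul_sum, Finset.sum_neg_distrib, e3]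
  ring

/-! ### The magnetic operator and its powers -/

section potentials

variable {ε : ℝ} {A : E3 → E3} {V : E3 → ℝ}

lemma AdmissiblePotentials.exists_bound (h : AdmissiblePotentials ε A V) : ∃ C : ℝ, 0 ≤ C ∧ ∀ x,
    ‖A x‖ ≤ C * bracket x ^ (-9 - ε) ∧ ‖fderiv ℝ A x‖ ≤ C * bracket x ^ (-8 - ε) ∧
      |V x| ≤ C * bracket x ^ (-8 - ε) := by
  obtain ⟨C, hC⟩ := h.decay
  have p : ∀ x, 0 < bracket x ^ (-8 - ε) := fun x => Real.rpow_pos_of_pos (bracket_pos x) _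
  have hp : ∀ x, 0 ≤ bracket x * ‖A x‖ := fun x => mul_nonneg (bracket_pos x).le (norm_nonneg _)
  refine ⟨C, ?_, fun x => ⟨?_, ?_, ?_⟩⟩
  · have h0 := hC 0
    have : 0 ≤ C * bracket 0 ^ (-8 - ε) := by
      linarith [hp 0, norm_nonneg (fderiv ℝ A 0), abs_nonneg (V 0)]
    exact nonneg_of_mul_nonneg_left this (p 0)
  · have e : bracket x ^ (-8 - ε) = bracket x * bracket x ^ (-9 - ε) := by
      rw [show -8 - ε = 1 + (-9 - ε) by ring, Real.rpow_add (bracket_pos x), Real.rpow_one]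
    have h1 : bracket x * ‖A x‖ ≤ bracket x * (C * bracket x ^ (-9 - ε)) := by
      rw [mul_left_comm, ← e]
      linarith [hC x, norm_nonneg (fderiv ℝ A x), abs_nonneg (V x)]
    exact le_of_mul_le_mul_left h1 (bracket_pos x)
  · linarith [hC x, hp x, abs_nonneg (V x)]
  · linarith [hC x, hp x, norm_nonneg (fderiv ℝ A x)]

lemma abs_divergence_le (A : E3 → E3) (x : E3) : |divergence A x| ≤ 3 * ‖fderiv ℝ A x‖ := by
  have h : ∀ j : Fin 3, |(fderiv ℝ A x (EuclideanSpace.single j 1)) j| ≤ ‖fderiv ℝ A x‖ := fun j => by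
    refine (PiLp.norm_apply_le (fderiv ℝ A x (EuclideanSpace.single j 1)) j).trans ?_
    refine ((fderiv ℝ A x).le_opNorm _).trans (le_of_eq ?_)
    simp
  calc |divergence A x| ≤ ∑ j : Fin 3, |(fderiv ℝ A x (EuclideanSpace.single j 1)) j| :=
        Finset.abs_sum_le_sum_abs _ _
    _ ≤ ∑ _j : Fin 3, ‖fderiv ℝ A x‖ := Finset.sum_le_sum fun j _ => h j
    _ = _ := by simp

lemma measurable_divergence (A : E3 → E3) : Measurable (divergence A) := by
  unfold divergence
  refine Finset.measurable_fun_sum _ fun j _ => ?_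
  have h1 : Measurable fun x => fderiv ℝ A x (EuclideanSpace.single j 1) :=
    measurable_fderiv_apply_const ℝ A _
  fun_prop

lemma norm_weight_mul_le {s t C : ℝ} (hst : s + t ≤ 0) (hC : 0 ≤ C) {x : E3} {r : ℝ}
    (hr : |r| ≤ C * bracket x ^ t) : ‖weight s x * (r : ℂ)‖ ≤ C := by
  have hx := bracket_pos x
  rw [norm_mul, norm_weight, Complex.norm_real, Real.norm_eq_abs]
  calc bracket x ^ s * |r| ≤ bracket x ^ s * (C * bracket x ^ t) := by gcongr
    _ = C * bracket x ^ (s + t) := by rw [Real.rpow_add hx]; ring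
    _ ≤ C * 1 := by
        gcongr
        exact Real.rpow_le_one_of_one_le_of_nonpos (one_le_bracket x) hst
    _ = C := mul_one C

lemma measurable_weight_mul {r : E3 → ℝ} (hr : Measurable r) (s : ℝ) :
    Measurable fun x => weight s x * (r x : ℂ) :=
  (continuous_weight s).measurable.mul (Complex.measurable_ofReal.comp hr)

/-- The field `⟨x⟩² A` is Lipschitz continuous. -/
lemma AdmissiblePotentials.exists_lipschitz (h : AdmissiblePotentials ε A V) (hε : 0 < ε) :
    ∃ L : ℝ, 0 ≤ L ∧ ∀ (b : Fin 3) (x y : E3),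
      ‖weight 2 x * (A x b : ℂ) - weight 2 y * (A y b : ℂ)‖ ≤ L * ‖x - y‖ := by
  obtain ⟨C, hC0, hC⟩ := h.exists_bound
  refine ⟨3 * C, by positivity, fun b x y => ?_⟩
  set G : E3 → E3 := fun x => (1 + ‖x‖ ^ 2) • A x with hG
  have hd : ∀ x, HasFDerivAt G ((1 + ‖x‖ ^ 2) • fderiv ℝ A x
      + (2 • innerSL ℝ x : E3 →L[ℝ] ℝ).smulRight (A x)) x := fun x =>
    (((hasStrictFDerivAt_norm_sq x).hasFDerivAt).const_add 1).smul (h.differentiable_A x).hasFDerivAt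
  have hn : ∀ x, ‖(1 + ‖x‖ ^ 2) • fderiv ℝ A x
      + (2 • innerSL ℝ x : E3 →L[ℝ] ℝ).smulRight (A x)‖ ≤ 3 * C := by
    intro x
    have hx := bracket_pos x
    have e1 : bracket x ^ 2 * bracket x ^ (-8 - ε) ≤ 1 := by
      rw [← Real.rpow_natCast, ← Real.rpow_add hx]
      exact Real.rpow_le_one_of_one_le_of_nonpos (one_le_bracket x) (by push_cast; linarith)
    have e2 : bracket x * bracket x ^ (-9 - ε) ≤ 1 := by
      nth_rewrite 1 [← Real.rpow_one (bracket x)]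
      rw [← Real.rpow_add hx]
      exact Real.rpow_le_one_of_one_le_of_nonpos (one_le_bracket x) (by linarith)
    have n1 : ‖(1 + ‖x‖ ^ 2) • fderiv ℝ A x‖ ≤ C := by
      rw [norm_smul, Real.norm_of_nonneg (by positivity), ← bracket_sq]
      calc bracket x ^ 2 * ‖fderiv ℝ A x‖ ≤ bracket x ^ 2 * (C * bracket x ^ (-8 - ε)) := by
            gcongr
            exact (hC x).2.1
        _ = C * (bracket x ^ 2 * bracket x ^ (-8 - ε)) := by ring
        _ ≤ C * 1 := by gcongr
        _ = C := mul_one C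
    have n2 : ‖(2 • innerSL ℝ x : E3 →L[ℝ] ℝ).smulRight (A x)‖ ≤ 2 * C := by
      rw [ContinuousLinearMap.norm_smulRight_apply, ← Nat.cast_smul_eq_nsmul ℝ, norm_smul, innerSL_apply_norm]
      calc ‖((2 : ℕ) : ℝ)‖ * ‖x‖ * ‖A x‖ ≤ 2 * bracket x * (C * bracket x ^ (-9 - ε)) := by
            have := norm_le_bracket x
            have := (hC x).1
            gcongr
            simp
        _ = 2 * C * (bracket x * bracket x ^ (-9 - ε)) := by ring
        _ ≤ 2 * C * 1 := by gcongr
        _ = 2 * C := mul_one _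
    exact (norm_add_le_of_le n1 n2).trans (le_of_eq (by ring))
  have hlip : ‖G x - G y‖ ≤ 3 * C * ‖x - y‖ :=
    Convex.norm_image_sub_le_of_norm_hasFDerivWithin_le (fun x _ => (hd x).hasFDerivWithinAt)
      (fun x _ => hn x) convex_univ (Set.mem_univ y) (Set.mem_univ x)
  have e : ∀ x, weight 2 x * (A x b : ℂ) = ((G x b : ℝ) : ℂ) := fun x => by
    simp only [hG, PiLp.smul_apply, smul_eq_mul, weight]
    rw [← bracket_sq, ← Real.rpow_natCast]
    push_cast
    rfl
  rw [e, e, ← Complex.ofReal_sub, Complex.norm_real]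
  exact (PiLp.norm_apply_le (G x - G y) b).trans hlip

end potentials

/-- The leading part of the conjugated operator `⟨x⟩^{-σ} R₀(z) L ⟨x⟩^{σ}`, where `α_a` stands for
`⟨x⟩^{1+σ} A_a`. -/
noncomputable def magOp (σ : ℝ) (z : ℂ) (α : Fin 3 → E3 → ℂ) : L2 →L[ℂ] L2 :=
  mulOp (weight (1 - σ)) ∘L ∑ a, (2 * Complex.I) • (resGrad z a ∘L mulOp (α a))

lemma magOp_apply (σ : ℝ) (z : ℂ) (α : Fin 3 → E3 → ℂ) (h : L2) :
    magOp σ z α h = mulOp (weight (1 - σ)) (∑ a, (2 * Complex.I) • resGrad z a (mulOp (α a) h)) := by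
  simp [magOp, sum_apply]

/-- The powers of `magOp` in terms of the iterates of `magStep`. -/
lemma magOp_pow_apply {σ : ℝ} (hσ : 1 ≤ σ) (z : ℂ) {α g : Fin 3 → E3 → ℂ} (hα : ∀ a, BddMeas (α a))
    (hg : ∀ a x, α a x * weight (1 - σ) x = g a x) (n : ℕ) (h : L2) :
    (magOp σ z α ^ (n + 1)) h = mulOp (weight (1 - σ)) (∑ a, (2 * Complex.I) •
      resGrad z a ((magStep z g)^[n] (fun a => mulOp (α a) h) a)) := by
  induction n with
  | zero => simp [magOp_apply]
  | succ n ih =>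
    rw [pow_succ', mul_apply_eq_comp, ih, magOp_apply]
    congr 1
    refine Finset.sum_congr rfl fun a _ => ?_
    rw [mulOp_mulOp (hα a) (bddMeas_weight (by linarith)), Function.iterate_succ_apply', funext (hg a)]
    rfl

lemma norm_magOp_pow_le {σ : ℝ} (hσ : 1 ≤ σ) {z : ℂ} {α g : Fin 3 → E3 → ℂ} (hα : ∀ a, BddMeas (α a))
    {M C K : ℝ} (hM : ∀ a x, ‖α a x‖ ≤ M) (hC : 0 ≤ C) (hK : 0 ≤ K)
    (hg : ∀ a x, α a x * weight (1 - σ) x = g a x) (hres : ∀ a f, ‖resGrad z a f‖ ≤ C * ‖f‖)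
    (hstep : ∀ (n : ℕ) (h : Fin 3 → L2),
      ∑ b, ‖(magStep z g)^[n] h b‖ ≤ K * (1 / 2) ^ n * ∑ b, ‖h b‖) (n : ℕ) (h : L2) :
    ‖(magOp σ z α ^ (n + 1)) h‖ ≤ 6 * C * K * M * (1 / 2) ^ n * ‖h‖ := by
  rw [magOp_pow_apply hσ z hα hg]
  refine (norm_mulOp_apply_le (bddMeas_weight (by linarith)) (norm_weight_le_one (by linarith)) _).trans ?_
  rw [one_mul]
  set k := (magStep z g)^[n] (fun a => mulOp (α a) h) with hk
  calc ‖∑ a, (2 * Complex.I) • resGrad z a (k a)‖ ≤ ∑ a, 2 * (C * ‖k a‖) := by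
        refine norm_sum_le_of_le _ fun a _ => ?_
        rw [norm_smul]
        have : ‖(2 * Complex.I : ℂ)‖ = 2 := by simp
        rw [this]
        gcongr
        exact hres a _
    _ = 2 * C * ∑ a, ‖k a‖ := by simp only [← Finset.mul_sum, mul_assoc]
    _ ≤ 2 * C * (K * (1 / 2) ^ n * ∑ a, ‖mulOp (α a) h‖) := by
        gcongr
        exact hstep n _
    _ ≤ 2 * C * (K * (1 / 2) ^ n * ∑ _a : Fin 3, M * ‖h‖) := by
        gcongr with a
        exact norm_mulOp_apply_le (hα a) (hM a) h
    _ = _ := by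
        rw [Finset.sum_const, Finset.card_univ, Fintype.card_fin, nsmul_eq_mul]
        push_cast
        ring

/-- A small perturbation changes the powers of an operator by little. -/
lemma norm_add_pow_sub_pow_le {R : Type*} [SeminormedRing R] (h₁ : ‖(1 : R)‖ ≤ 1) {a b : R}
    {M τ : ℝ} (ha : ‖a‖ ≤ M) (hb : ‖b‖ ≤ τ) (hτ : τ ≤ 1) (m : ℕ) :
    ‖(a + b) ^ m - a ^ m‖ ≤ m * (M + 1) ^ m * τ := by
  have hM : 0 ≤ M := (norm_nonneg _).trans ha
  have hτ0 : 0 ≤ τ := (norm_nonneg _).trans hb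
  induction m with
  | zero => simp
  | succ m ih =>
    have e : (a + b) ^ (m + 1) - a ^ (m + 1) = (a + b) * ((a + b) ^ m - a ^ m) + b * a ^ m := by
      rw [pow_succ', pow_succ']
      noncomm_ring
    have h1 : ‖a ^ m‖ ≤ (M + 1) ^ m := by
      rcases m.eq_zero_or_pos with rfl | hm
      · simpa using h₁
      · exact (norm_pow_le' a hm).trans (by gcongr; linarith)
    rw [e]
    calc _ ≤ (M + 1) * (m * (M + 1) ^ m * τ) + τ * (M + 1) ^ m := by
          refine norm_add_le_of_le ((norm_mul_le _ _).trans ?_) ((norm_mul_le _ _).trans ?_)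
          · gcongr
            exact norm_add_le_of_le ha (hb.trans hτ)
          · gcongr
      _ ≤ (M + 1) * (m * (M + 1) ^ m * τ) + τ * (M + 1) ^ m * (M + 1) := by
          exact add_le_add le_rfl (le_mul_of_one_le_right (by positivity) (by linarith))
      _ = _ := by push_cast; ring

/-- The operator `R₀(z) L` on `L^{2,-σ}`, conjugated to `L²`, is the sum of `magOp` and of a weighted
free resolvent. -/
lemma isFreeResolvent_weightIso_symm {A : E3 → E3} {V : E3 → ℝ} {σ s : ℝ} (hσ : 1 ≤ σ) (hs : 0 ≤ s)
    {z : ℂ} (hz : z.im ≠ 0) {α : Fin 3 → E3 → ℂ} {q₁ q₂ : E3 → ℂ}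
    (eα : ∀ a x, α a x = weight (1 + σ) x * (A x a : ℂ))
    (e₁ : ∀ x, q₁ x = weight (σ + s) x * (V x : ℂ))
    (e₂ : ∀ x, q₂ x = weight (σ + s) x * (divergence A x : ℂ))
    (hα : ∀ a, BddMeas (α a)) (h₁ : BddMeas q₁) (h₂ : BddMeas q₂) (f : WeightedL2 (-σ)) :
    IsFreeResolvent z (magneticL A V f) ((weightIso (-σ)).symm ((magOp σ z α
      + weightedRes σ s z ∘L (mulOp q₁ - Complex.I • mulOp q₂)) (weightIso (-σ) f))) := by
  set h : L2 := weightIso (-σ) f with hh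
  have bs : BddMeas (weight (-s)) := bddMeas_weight (by linarith)
  have bσ : BddMeas (weight (-σ)) := bddMeas_weight (by linarith)
  have bσ' : BddMeas (weight (1 - σ)) := bddMeas_weight (by linarith)
  have w₁ : ∀ x, weight (-1) x * weight (1 + σ) x * weight (-σ) x = 1 := fun x => by
    rw [weight_mul, weight_mul, ← weight_zero x]
    ring_nf
  have w₂ : ∀ x, weight (-s) x * weight (σ + s) x * weight (-σ) x = 1 := fun x => by
    rw [weight_mul, weight_mul, ← weight_zero x]
    ring_nf
  have hσ1 : (fun x => weight (1 - σ) x * weight (-1) x) = weight (-σ) := by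
    ext x
    rw [weight_mul]
    ring_nf
  refine isFreeResolvent_magneticL hz (G := fun a => mulOp (weight (-1)) (mulOp (α a) h))
    (Q₁ := mulOp (weight (-s)) (mulOp q₁ h)) (Q₂ := mulOp (weight (-s)) (mulOp q₂ h))
    (fun a => ?_) ?_ ?_ ?_
  · filter_upwards [mulOp_ae bddMeas_weight_neg_one (mulOp (α a) h), mulOp_ae (hα a) h,
      weightIso_ae (-σ) f] with x k1 k2 k3
    rw [k1, k2, hh, k3, eα]
    linear_combination (A x a : ℂ) * f x * w₁ x
  · filter_upwards [mulOp_ae bs (mulOp q₁ h), mulOp_ae h₁ h, weightIso_ae (-σ) f] with x k1 k2 k3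
    rw [k1, k2, hh, k3, e₁]
    linear_combination (V x : ℂ) * f x * w₂ x
  · filter_upwards [mulOp_ae bs (mulOp q₂ h), mulOp_ae h₂ h, weightIso_ae (-σ) f] with x k1 k2 k3
    rw [k1, k2, hh, k3, e₂]
    linear_combination (divergence A x : ℂ) * f x * w₂ x
  · set U : L2 := ∑ a, (2 * Complex.I) • fm (fun ξ => derivSymbol (basisVec a) ξ * resSymbol z ξ)
      (mulOp (weight (-1)) (mulOp (α a) h))
      + fm (resSymbol z) (mulOp (weight (-s)) (mulOp q₁ h)
        - Complex.I • mulOp (weight (-s)) (mulOp q₂ h)) with hU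
    have eS : (magOp σ z α + weightedRes σ s z ∘L (mulOp q₁ - Complex.I • mulOp q₂)) h
        = mulOp (weight (-σ)) U := by
      rw [hU, map_add, add_apply, magOp_apply, ContinuousLinearMap.comp_apply, weightedRes_apply,
        sub_apply, smul_apply, map_sub (mulOp (weight (-s))), map_smul (mulOp (weight (-s)))]
      congr 1
      simp only [map_sum, map_smul, resGrad, sandwich_apply, mulOp_mulOp bσ' bddMeas_weight_neg_one, hσ1]
    rw [eS]
    filter_upwards [weightIso_symm_ae (-σ) (mulOp (weight (-σ)) U), mulOp_ae bσ U] with x k1 k2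
    rw [k1, k2, ← mul_assoc, mul_comm (weight _ x), weight_mul_weight_neg, one_mul]

end MagneticSchrodinger

theorem lemma4p3 (ε : ℝ) (hε : 0 < ε)
    (A : MagneticSchrodinger.E3 → MagneticSchrodinger.E3) (V : MagneticSchrodinger.E3 → ℝ)
    (hAV : MagneticSchrodinger.AdmissiblePotentials ε A V)
    (σ : ℝ) (hσ : 4 < σ) (hσε : σ < 15 / 2 + ε) (c : ℝ) (hc : 0 < c) :
    ∃ m : ℕ, 1 ≤ m ∧ ∃ l₀ : ℝ, 0 < l₀ ∧ ∀ l : ℝ, l₀ < l →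
      ∃ T : MagneticSchrodinger.WeightedL2 (-σ) →L[ℂ] MagneticSchrodinger.WeightedL2 (-σ),
        MagneticSchrodinger.IsBoundaryResolventL A V (-σ) l T ∧ ‖T ^ m‖ ≤ c := by
  open MagneticSchrodinger in
  obtain ⟨C₀, hC₀, hbd⟩ := hAV.exists_bound
  obtain ⟨L, hL, hlip⟩ := hAV.exists_lipschitz hε
  -- the weights are distributed so that `⟨x⟩^{σ+s}` is exactly compensated by the decay of the potentials
  set s : ℝ := 8 + ε - σ with hs
  have hs' : 1 / 2 < s := by rw [hs]; linarith
  set α : Fin 3 → E3 → ℂ := fun a x => weight (1 + σ) x * (A x a : ℂ) with hα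
  set g : Fin 3 → E3 → ℂ := fun a x => weight 2 x * (A x a : ℂ) with hg
  set q₁ : E3 → ℂ := fun x => weight (σ + s) x * (V x : ℂ) with hq₁
  set q₂ : E3 → ℂ := fun x => weight (σ + s) x * (divergence A x : ℂ) with hq₂
  have mA : ∀ a, Measurable fun x => A x a := fun a => by
    have := hAV.differentiable_A.continuous
    exact Continuous.measurable (by fun_prop)
  have hA : ∀ a x, |A x a| ≤ C₀ * bracket x ^ (-9 - ε) := fun a x =>
    (PiLp.norm_apply_le (A x) a).trans (hbd x).1
  have nα : ∀ a x, ‖α a x‖ ≤ C₀ := fun a x =>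
    norm_weight_mul_le (by linarith) hC₀ (hA a x)
  have ng : ∀ a x, ‖g a x‖ ≤ C₀ := fun a x => norm_weight_mul_le (by linarith) hC₀ (hA a x)
  have n₁ : ∀ x, ‖q₁ x‖ ≤ C₀ := fun x => norm_weight_mul_le (by rw [hs]; linarith) hC₀ (hbd x).2.2
  have n₂ : ∀ x, ‖q₂ x‖ ≤ 3 * C₀ := fun x =>
    norm_weight_mul_le (t := -8 - ε) (by rw [hs]; linarith) (by positivity) (by
      linarith [abs_divergence_le A x, (hbd x).2.1])
  have bα : ∀ a, BddMeas (α a) := fun a => ⟨measurable_weight_mul (mA a) _, C₀, nα a⟩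
  have bg : ∀ a, BddMeas (g a) := fun a => ⟨measurable_weight_mul (mA a) _, C₀, ng a⟩
  have b₁ : BddMeas q₁ :=
    ⟨measurable_weight_mul hAV.differentiable_V.continuous.measurable _, C₀, n₁⟩
  have b₂ : BddMeas q₂ := ⟨measurable_weight_mul (measurable_divergence A) _, 3 * C₀, n₂⟩
  have eαg : ∀ a x, α a x * weight (1 - σ) x = g a x := fun a x => by
    have : weight (1 + σ) x * weight (1 - σ) x = weight 2 x := by
      rw [weight_mul]
      ring_nf
    simp only [hα, hg]
    rw [← this]
    ring
  obtain ⟨χ, C, hC, Hres⟩ := exists_resolvent_bounds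
  obtain ⟨μ₁, hμ₁, Hres⟩ := Hres 1 le_rfl
  obtain ⟨K, μ₂, hK, hμ₂, Hstep⟩ := exists_iterate_magStep_le bg ng hL hlip
  set M : ℝ := 6 * C * K * C₀ with hM
  have hM0 : 0 ≤ M := by positivity
  -- the power `n + 1` makes the first-order part small; `τ` is the size allowed for the zeroth-order part
  obtain ⟨n, hn⟩ : ∃ n : ℕ, M * (1 / 2) ^ n ≤ c / 2 := by
    have h1 : Tendsto (fun n : ℕ => M * (1 / 2 : ℝ) ^ n) atTop (𝓝 (M * 0)) :=
      (tendsto_pow_atTop_nhds_zero_of_lt_one (by norm_num) (by norm_num)).const_mul _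
    rw [mul_zero] at h1
    exact (h1.eventually_le_const (half_pos hc)).exists
  set τ : ℝ := min 1 (c / (2 * ((n + 1 : ℕ) * (M + 1) ^ (n + 1)))) with hτ
  have hτ0 : 0 < τ := lt_min one_pos (by positivity)
  have hτc : (n + 1 : ℕ) * (M + 1) ^ (n + 1) * τ ≤ c / 2 := by
    calc _ ≤ (n + 1 : ℕ) * (M + 1) ^ (n + 1) * (c / (2 * ((n + 1 : ℕ) * (M + 1) ^ (n + 1)))) := by
          gcongr
          exact min_le_right _ _
      _ = c / 2 := by field_simp
  obtain ⟨μ₃, hμ₃, Hsmall⟩ := exists_norm_weightedRes_le_small hσ.le hs' (τ := τ / (4 * C₀ + 1))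
    (by positivity)
  refine ⟨n + 1, by omega, 2 * Real.pi * (μ₁ + μ₂ + μ₃), by positivity, fun l hl => ?_⟩
  set μ : ℝ := l / (2 * Real.pi) with hμ
  have hμl : 2 * Real.pi * μ = l := by rw [hμ]; field_simp
  have hμ' : μ₁ + μ₂ + μ₃ ≤ μ := by
    rw [hμ, le_div_iff₀ (by positivity)]
    linarith
  have hl0 : 0 < l := lt_of_le_of_lt (by positivity) hl
  set z : ℝ → ℂ := fun η => (l : ℂ) ^ 2 + Complex.I * η with hz
  have ez : ∀ η, z η = ((2 * Real.pi * μ : ℝ) : ℂ) ^ 2 + Complex.I * η := fun η => by rw [hμl]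
  have hzim : ∀ η, 0 < η → (z η).im ≠ 0 := fun η hη => by
    simp only [hz]
    rw [im_sq_add_I_mul]
    exact hη.ne'
  set B : ℝ → L2 →L[ℂ] L2 := fun η => weightedRes σ s (z η) ∘L (mulOp q₁ - Complex.I • mulOp q₂) with hB
  set S : ℝ → L2 →L[ℂ] L2 := fun η => magOp σ (z η) α + B η with hS
  have hres : ∀ η, 0 < η → ∀ a f, ‖resGrad (z η) a f‖ ≤ C * ‖f‖ := fun η hη a f =>
    (Hres μ (by linarith) η hη (z η) (ez η) f).2.2.1 a
  have hpow : ∀ η, 0 < η → ∀ k : ℕ, ‖magOp σ (z η) α ^ (k + 1)‖ ≤ M * (1 / 2) ^ k := fun η hη k =>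
    ContinuousLinearMap.opNorm_le_bound _ (by positivity) fun h =>
      norm_magOp_pow_le (by linarith) bα nα hC.le hK eαg (hres η hη)
        (Hstep μ (by linarith) η hη (z η) (ez η)) k h
  have hone : ∀ η, 0 < η → ‖magOp σ (z η) α‖ ≤ M := fun η hη => by simpa using hpow η hη 0
  have hBτ : ∀ η, 0 < η → ‖B η‖ ≤ τ := fun η hη => by
    refine ContinuousLinearMap.opNorm_le_bound _ hτ0.le fun h => ?_
    refine (Hsmall μ (by linarith) η hη (z η) (ez η) _).trans ?_
    have h1 : ‖(mulOp q₁ - Complex.I • mulOp q₂) h‖ ≤ (4 * C₀ + 1) * ‖h‖ := by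
      rw [sub_apply, smul_apply]
      calc _ ≤ C₀ * ‖h‖ + 3 * C₀ * ‖h‖ := by
            refine norm_sub_le_of_le (norm_mulOp_apply_le b₁ n₁ h) ?_
            rw [norm_smul, Complex.norm_I, one_mul]
            exact norm_mulOp_apply_le b₂ n₂ h
        _ ≤ _ := by nlinarith [norm_nonneg h]
    calc _ ≤ τ / (4 * C₀ + 1) * ((4 * C₀ + 1) * ‖h‖) := mul_le_mul_of_nonneg_left h1 (by positivity)
      _ = τ * ‖h‖ := by field_simp
  have hSM : ∀ᶠ η in 𝓝[>] (0 : ℝ), ∀ f, ‖S η f‖ ≤ (M + τ) * ‖f‖ := by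
    filter_upwards [self_mem_nhdsWithin] with η hη f
    exact (S η).le_of_opNorm_le (norm_add_le_of_le (hone η hη) (hBτ η hη)) f
  have hSpow : ∀ᶠ η in 𝓝[>] (0 : ℝ), ∀ f, ‖(S η ^ (n + 1)) f‖ ≤ c * ‖f‖ := by
    filter_upwards [self_mem_nhdsWithin] with η hη f
    refine ContinuousLinearMap.le_of_opNorm_le _ ?_ f
    have h1 := norm_add_pow_sub_pow_le ContinuousLinearMap.norm_id_le (hone η hη) (hBτ η hη)
      (min_le_left _ _) (n + 1)
    calc ‖S η ^ (n + 1)‖ = ‖(S η ^ (n + 1) - magOp σ (z η) α ^ (n + 1)) + magOp σ (z η) α ^ (n + 1)‖ := by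
          rw [sub_add_cancel]
      _ ≤ c / 2 + c / 2 := norm_add_le_of_le (h1.trans hτc) ((hpow η hη n).trans hn)
      _ = c := by ring
  obtain ⟨R, hR⟩ := exists_clm_tendsto_weightedRes hl0 hσ.le hs'
  choose D hD using fun a => exists_clm_tendsto_resGrad hl0 hσ.le hC.le a fun η hη f => hres η hη a f
  set T₀ : L2 →L[ℂ] L2 := ∑ a, (2 * Complex.I) • (D a ∘L mulOp (α a))
    + R ∘L (mulOp q₁ - Complex.I • mulOp q₂) with hT₀
  have hlim : ∀ f, Tendsto (fun η => S η f) (𝓝[>] 0) (𝓝 (T₀ f)) := fun f => by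
    have e1 : T₀ f = ∑ a, (2 * Complex.I) • D a (mulOp (α a) f)
        + R ((mulOp q₁ - Complex.I • mulOp q₂) f) := by
      simp [hT₀, sum_apply]
    have e2 : ∀ η, S η f = ∑ a, (2 * Complex.I) • mulOp (weight (1 - σ)) (resGrad (z η) a (mulOp (α a) f))
        + weightedRes σ s (z η) ((mulOp q₁ - Complex.I • mulOp q₂) f) := fun η => by
      simp only [hS, hB]
      rw [add_apply, magOp_apply, map_sum]
      simp only [map_smul]
      rfl
    rw [e1]
    simp only [e2]
    exact (tendsto_finsetSum _ fun a _ => (hD a _).const_smul _).add (hR _)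
  have hT₀pow : ∀ f, ‖(T₀ ^ (n + 1)) f‖ ≤ c * ‖f‖ := fun f =>
    le_of_tendsto (tendsto_pow_apply hSM hlim (n + 1) f).norm (hSpow.mono fun η hη => hη f)
  set J := weightIso (-σ) with hJ
  set T : WeightedL2 (-σ) →L[ℂ] WeightedL2 (-σ) :=
    (J.symm.toContinuousLinearEquiv : L2 →L[ℂ] WeightedL2 (-σ)) ∘L T₀
      ∘L (J.toContinuousLinearEquiv : WeightedL2 (-σ) →L[ℂ] L2) with hT
  have hTapply : ∀ f, T f = J.symm (T₀ (J f)) := fun f => rfl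
  have hTpow : ∀ (k : ℕ) f, (T ^ k) f = J.symm ((T₀ ^ k) (J f)) := fun k f => by
    induction k with
    | zero => simp
    | succ k ih =>
      rw [pow_succ', pow_succ', mul_apply_eq_comp, mul_apply_eq_comp, ih, hTapply,
        LinearIsometryEquiv.apply_symm_apply]
  refine ⟨T, fun f => ⟨fun η => J.symm (S η (J f)), fun η hη => ?_, ?_⟩, ?_⟩
  · exact isFreeResolvent_weightIso_symm (by linarith) (by linarith) (hzim η hη) (fun _ _ => rfl)
      (fun _ => rfl) (fun _ => rfl) bα b₁ b₂ f
  · rw [hTapply]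
    exact (J.symm.continuous.tendsto _).comp (hlim (J f))
  · refine ContinuousLinearMap.opNorm_le_bound _ hc.le fun f => ?_
    rw [hTpow, LinearIsometryEquiv.norm_map]
    simpa using hT₀pow (J f)
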